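/- Fix $\gamma>0$, $\sigma>1$ and let $CD(\gamma,\sigma)=\{x\in\mathbb R:\ |kx-l|\ge \gamma^{-1}|k|^{-\sigma}\ \text{for all } k\in\mathbb Z\setminus\{0\},\ l\in\mathbb Z\}$. For $\alpha\in(0,1)$ let $\alpha_k=G^k(\alpha)$, where $G(x)=\{1/x\}$ is the Gauss map, let $a_k=\lfloor 1/\alpha_{k-1}\rfloor$ for $k\ge 1$, $\beta_{k-1}=\alpha_0\cdots\alpha_{k-1}$ (with $\beta_{-1}=1$), and $\mathcal K=\{k\ge 0:\ \alpha_k,\alpha_{k+1}\in CD(\gamma,\sigma)\cap(1/5,1/4]\}$. Let $\Sigma$ be the set of $\alpha\in(0,1)$ for which $\mathcal K$ contains arbitrarily large integers. For $\lambda\in\mathbb R$ and a smooth $D:\mathbb R\to SL(2,\mathbb R)$, write $(\lambda,D)$ for the map $(t,y)\mapsto(t+\lambda,D(t)y)$ of $\mathbb R\times SL(2,\mathbb R)$. A fibered $\mathbb Z^2$-action is an action of $\mathbb Z^2$ by such maps; if $x,y$ are two commuting such maps, $(x,y)$ denotes the action in which $(n,m)$ acts as $x^n y^m$. Let $E_r(\theta)$,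 $r\in\mathbb Z$, be the rotation matrix of angle $2\pi r\theta$; a continuous map $\mathbb R/\mathbb Z\to SL(2,\mathbb R)$ has degree $r$ if it is homotopic to $E_r$. Let $\alpha\in\Sigma$ and let $A\in C^\infty(\mathbb R/\mathbb Z,SL(2,\mathbb R))$ have degree $d$ and bounded fibered products: $\sup_{n\in\mathbb Z}\sup_\theta\|A_n(\theta)\|<\infty$, where $(\alpha,A)^n=(n\alpha,A_n)$. Then $\mathcal K$ is infinite, and for every integer $s_0\ge 0$ there are $U_k\in C^\infty(\mathbb R/\mathbb Z,SL(2,\mathbb R))$ such that, for all large enough $k\in\mathcal K$, the action $\mathcal A=((1,\mathrm{Id}),(\alpha,A))$ is conjugated to $((1,\mathrm{Id}),(\alpha_k,U_k))$ and $$\lim_{k\to\infty,\ k\in\mathcal K}\|U_k-E_{r_k}\|_{C^{s_0}}=0,\qquad r_k=(-1)^k d,\quad\text{so that } |r_k|=|d|.$$ Here "conjugated" means that $((1,\mathrm{Id}),(\alpha_k,U_k))$ is obtained from $\mathcal A$ by the following operations: the changes of basis $(e_1,e_2)\mapsto(e_2,e_1-a_je_2)$ of $\mathbb Z^2$ for $j=1,\dots,k$;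 the conjugation $(\lambda,D)\mapsto(\lambda,D(\cdot-\mu_k))$ by a translation, for some $\mu_k\in\mathbb R$; the conjugation $(\lambda,D)\mapsto(\lambda/\beta_{k-1},D(\beta_{k-1}\,\cdot))$ by the dilatation of ratio $\beta_{k-1}$; and the conjugation by $(0,B_k)$ for some smooth $B_k:\mathbb R\to SL(2,\mathbb R)$. -/

import Mathlib

open Filter Topology
open scoped ContDiff ENNReal

noncomputable section

namespace QPCocycle

/-- The fibre `SL(2,ℝ)`. -/
abbrev SL2 := Matrix.SpecialLinearGroup (Fin 2) ℝ

/-- A map `ℝ → SL(2,ℝ)` is smooth when its matrix entries are `C^∞`. -/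
def Smooth (D : ℝ → SL2) : Prop :=
  ∀ i j, ContDiff ℝ ∞ (fun t => (D t).1 i j)

theorem Smooth.one : Smooth (fun _ => 1) := fun _ _ => contDiff_const

theorem Smooth.mul {D D' : ℝ → SL2} (h : Smooth D) (h' : Smooth D') :
    Smooth (fun t => D t * D' t) := by
  intro i j
  simp only [Matrix.SpecialLinearGroup.coe_mul, Matrix.mul_apply]
  exact ContDiff.sum fun k _ => (h i k).mul (h' k j)

theorem Smooth.inv {D : ℝ → SL2} (h : Smooth D) : Smooth (fun t => (D t)⁻¹) := by
  intro i j
  simp only [Matrix.SpecialLinearGroup.coe_inv, Matrix.adjugate_fin_two]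
  fin_cases i <;> fin_cases j
  · simpa using h 1 1
  · simpa using (h 0 1).neg
  · simpa using (h 1 0).neg
  · simpa using h 0 0

theorem Smooth.comp {D : ℝ → SL2} (h : Smooth D) {f : ℝ → ℝ} (hf : ContDiff ℝ ∞ f) :
    Smooth (fun t => D (f t)) :=
  fun i j => (h i j).comp hf

/-! ### Fibered maps and fibered `ℤ²`-actions on `ℝ × SL(2,ℝ)` -/

/-- The fibered diffeomorphism `(γ, D) : (t, y) ↦ (t + γ, D(t) y)` of `ℝ × SL(2,ℝ)`. -/
@[ext] structure FiberedMap where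
  freq : ℝ
  fib : ℝ → SL2
  smooth : Smooth fib

namespace FiberedMap

/-- The underlying map of `ℝ × SL(2,ℝ)`. -/
def toFun (x : FiberedMap) (p : ℝ × SL2) : ℝ × SL2 := (p.1 + x.freq, x.fib p.1 * p.2)

/-- Composition. -/
instance : Mul FiberedMap where
  mul x y := ⟨x.freq + y.freq, fun t => x.fib (t + y.freq) * y.fib t,
    (x.smooth.comp (by fun_prop)).mul y.smooth⟩

/-- The identity map. -/
instance : One FiberedMap where
  one := ⟨0, fun _ => 1, Smooth.one⟩

/-- The inverse map. -/
instance : Inv FiberedMap where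
  inv x := ⟨-x.freq, fun t => (x.fib (t - x.freq))⁻¹, (x.smooth.comp (by fun_prop)).inv⟩

@[simp] theorem freq_mul (x y : FiberedMap) : (x * y).freq = x.freq + y.freq := rfl
@[simp] theorem fib_mul (x y : FiberedMap) (t : ℝ) :
    (x * y).fib t = x.fib (t + y.freq) * y.fib t := rfl
@[simp] theorem freq_one : (1 : FiberedMap).freq = 0 := rfl
@[simp] theorem fib_one (t : ℝ) : (1 : FiberedMap).fib t = 1 := rfl
@[simp] theorem freq_inv (x : FiberedMap) : (x⁻¹).freq = -x.freq := rfl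
@[simp] theorem fib_inv (x : FiberedMap) (t : ℝ) :
    (x⁻¹).fib t = (x.fib (t - x.freq))⁻¹ := rfl

theorem toFun_mul (x y : FiberedMap) : (x * y).toFun = x.toFun ∘ y.toFun := by
  funext p
  simp [toFun, mul_assoc, add_assoc, add_comm y.freq]

theorem toFun_one : (1 : FiberedMap).toFun = id := by
  funext p
  simp [toFun]

/-- Fibered maps form a group under composition. -/
instance : Group FiberedMap :=
  Group.ofLeftAxioms
    (fun x y z => by
      ext1
      · simp [add_assoc]
      · funext t
        simp only [fib_mul, freq_mul, mul_assoc]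
        rw [show t + (y.freq + z.freq) = t + z.freq + y.freq by ring])
    (fun x => by
      ext1
      · simp
      · funext t
        simp)
    (fun x => by
      ext1
      · simp
      · funext t
        simp)

/-- The vertical map `(0, B)`. -/
def vert (B : ℝ → SL2) (hB : Smooth B) : FiberedMap := ⟨0, B, hB⟩

/-- Conjugation by the dilatation `L_l (t, y) = (l t, y)`, that is
`x ↦ L_l⁻¹ ∘ x ∘ L_l`, which maps `(γ, D)` to `(γ / l, D(l ·))`. -/
def dilate (l : ℝ) (hl : l ≠ 0) : FiberedMap →* FiberedMap where
  toFun x := ⟨l⁻¹ * x.freq, fun t => x.fib (l * t), x.smooth.comp (by fun_prop)⟩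
  map_one' := by
    ext1
    · simp
    · rfl
  map_mul' x y := by
    ext1
    · simp [mul_add]
    · funext t
      simp only [fib_mul]
      rw [mul_add, mul_inv_cancel_left₀ hl]

/-- Conjugation by the translation `T_μ (t, y) = (t - μ, y)`, that is
`x ↦ T_μ⁻¹ ∘ x ∘ T_μ`, which maps `(γ, D)` to `(γ, D(· - μ))`. -/
def translate (μ : ℝ) : FiberedMap →* FiberedMap where
  toFun x := ⟨x.freq, fun t => x.fib (t - μ), x.smooth.comp (by fun_prop)⟩
  map_one' := by
    ext1 <;> rfl
  map_mul' x y := by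
    ext1
    · rfl
    · funext t
      simp only [fib_mul]
      rw [show t + y.freq - μ = t - μ + y.freq by ring]

end FiberedMap

/-- A fibered `ℤ²`-action on `ℝ × SL(2,ℝ)`. -/
abbrev FiberedAction := Multiplicative (ℤ × ℤ) →* FiberedMap

namespace FiberedAction

/-- The action `(x, y)` generated by two commuting fibered maps:
`(n, m)` acts by `x^n ∘ y^m`. -/
def ofPair (x y : FiberedMap) (h : Commute x y) : FiberedAction where
  toFun v := x ^ (Multiplicative.toAdd v).1 * y ^ (Multiplicative.toAdd v).2
  map_one' := by simp
  map_mul' v w := by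
    simp only [toAdd_mul, Prod.fst_add, Prod.snd_add, zpow_add]
    have hc := (h.zpow_zpow (Multiplicative.toAdd w).1 (Multiplicative.toAdd v).2).eq
    rw [mul_assoc, mul_assoc, ← mul_assoc (x ^ (Multiplicative.toAdd w).1), hc]
    simp only [mul_assoc]

/-- Change of basis of `ℤ²`: `v` acts as `P v` acted before. The additive automorphisms of
`ℤ²` are the elements of `GL(2,ℤ)`. -/
def baseChange (P : ℤ × ℤ ≃+ ℤ × ℤ) (𝒜 : FiberedAction) : FiberedAction :=
  𝒜.comp (AddMonoidHom.toMultiplicative P.toAddMonoidHom)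

/-- Conjugation of an action by the dilatation `L_l`. -/
def dilate (l : ℝ) (hl : l ≠ 0) (𝒜 : FiberedAction) : FiberedAction :=
  (FiberedMap.dilate l hl).comp 𝒜

/-- Conjugation of an action by the translation `T_μ`. -/
def translate (μ : ℝ) (𝒜 : FiberedAction) : FiberedAction :=
  (FiberedMap.translate μ).comp 𝒜

/-- Two actions are `f`-conjugated if `𝒜' = (0, B) ∘ 𝒜 ∘ (0, B)⁻¹` for some smooth
`B : ℝ → SL(2,ℝ)`. -/
def FConj (𝒜 𝒜' : FiberedAction) : Prop :=
  ∃ (B : ℝ → SL2) (hB : Smooth B), ∀ v,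
    𝒜' v = FiberedMap.vert B hB * 𝒜 v * (FiberedMap.vert B hB)⁻¹

end FiberedAction

/-! ### Quasi-periodic cocycles over the circle -/

/-- An element of `C^∞(ℝ/ℤ, SL(2,ℝ))`, as a smooth `1`-periodic function on `ℝ`. -/
structure SmoothLoop where
  toFun : ℝ → SL2
  smooth : Smooth toFun
  periodic : Function.Periodic toFun 1

/-- The fibered map `(1, Id)`. -/
def unitShift : FiberedMap := ⟨1, fun _ => 1, Smooth.one⟩

/-- The loop `E_r(θ)`, the rotation of angle `2π r θ`. -/
def E (r : ℤ) : SmoothLoop where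
  toFun θ := ⟨!![Real.cos (2 * Real.pi * r * θ), -Real.sin (2 * Real.pi * r * θ);
    Real.sin (2 * Real.pi * r * θ), Real.cos (2 * Real.pi * r * θ)], by
      rw [Matrix.det_fin_two_of]
      nlinarith [Real.sin_sq_add_cos_sq (2 * Real.pi * r * θ)]⟩
  smooth := by
    intro i j
    fin_cases i <;> fin_cases j <;> simp <;> fun_prop
  periodic := by
    intro θ
    have h : 2 * Real.pi * r * (θ + 1) = 2 * Real.pi * r * θ + r * (2 * Real.pi) := by ring
    apply Subtype.ext
    simp only [h, Real.cos_add_int_mul_two_pi, Real.sin_add_int_mul_two_pi]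

namespace SmoothLoop

/-- The cocycle `(α, A)`, as a fibered map. -/
def cocycle (α : ℝ) (A : SmoothLoop) : FiberedMap := ⟨α, A.toFun, A.smooth⟩

theorem commute_cocycle (α : ℝ) (A : SmoothLoop) : Commute unitShift (A.cocycle α) := by
  unfold Commute SemiconjBy
  ext1
  · simp [unitShift, cocycle, add_comm]
  · funext t
    simp only [FiberedMap.fib_mul, unitShift, cocycle, one_mul, mul_one]
    exact (A.periodic t).symm

/-- The fibered `ℤ²`-action `((1, Id), (α, A))`. -/
def action (α : ℝ) (A : SmoothLoop) : FiberedAction :=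
  FiberedAction.ofPair unitShift (A.cocycle α) (A.commute_cocycle α)

/-- The fibered product `A_n`, given by `(α, A)^n = (n α, A_n)` for `n ∈ ℤ`. -/
def fiberedProd (α : ℝ) (A : SmoothLoop) (n : ℤ) : ℝ → SL2 := ((A.cocycle α) ^ n).fib

/-- The fibered products `A_n`, `n ∈ ℤ`, are bounded uniformly in `n` and `θ`. -/
def BoundedProds (α : ℝ) (A : SmoothLoop) : Prop :=
  ∃ M : ℝ, ∀ (n : ℤ) (θ : ℝ) (i j : Fin 2), |(A.fiberedProd α n θ).1 i j| ≤ M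

/-- `A` has degree `r`: it is homotopic to `E_r` as a map from the circle to `SL(2,ℝ)`. -/
def HasDegree (A : SmoothLoop) (r : ℤ) : Prop :=
  ∃ H : unitInterval × ℝ → SL2, Continuous H ∧ (∀ s θ, H (s, θ + 1) = H (s, θ)) ∧
    (∀ θ, H (0, θ) = A.toFun θ) ∧ ∀ θ, H (1, θ) = (E r).toFun θ

/-- The `C^s` distance `max_{j ≤ s} sup_θ ‖∂^j (A - A')(θ)‖`, where the norm of a matrix is the
maximum of the absolute values of its entries. -/
def csDist (s : ℕ) (A A' : SmoothLoop) : ℝ≥0∞ :=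
  ⨆ (m : ℕ) (_ : m ≤ s) (θ : ℝ) (i : Fin 2) (j : Fin 2),
    ‖iteratedDeriv m (fun t => (A.toFun t).1 i j - (A'.toFun t).1 i j) θ‖ₑ

end SmoothLoop

/-! ### Continued fractions and the set `Σ` -/

/-- The Gauss map `G(x) = {1/x}`. -/
def gauss (x : ℝ) : ℝ := Int.fract x⁻¹

/-- `α_k = G^k(α)`. -/
def alphaIter (α : ℝ) (k : ℕ) : ℝ := gauss^[k] α

/-- `β_{k-1} = α_0 α_1 ⋯ α_{k-1}`, with `β_{-1} = 1`. -/
def betaPred (α : ℝ) (k : ℕ) : ℝ := ∏ j ∈ Finset.range k, alphaIter α j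

/-- `CD(g, σ)`: `|k α - l| ≥ g⁻¹ / |k|^σ` for all integers `k ≠ 0` and `l`. -/
def CD (g σ : ℝ) : Set ℝ :=
  {α | ∀ k : ℤ, k ≠ 0 → ∀ l : ℤ, g⁻¹ / |(k : ℝ)| ^ σ ≤ |k * α - l|}

/-- The infinite set `𝒦` of integers `k` at which `α_k` and `α_{k+1}` both lie in
`CD(g, σ) ∩ (1/5, 1/4]`. -/
def goodTimes (g σ α : ℝ) : Set ℕ :=
  {k | alphaIter α k ∈ CD g σ ∩ Set.Ioc (1 / 5) (1 / 4) ∧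
    alphaIter α (k + 1) ∈ CD g σ ∩ Set.Ioc (1 / 5) (1 / 4)}

/-- The set `Σ` of those `α ∈ (0,1)` that have arbitrarily large times in `𝒦`. -/
def SigmaSet (g σ : ℝ) : Set ℝ :=
  {α | α ∈ Set.Ioo 0 1 ∧ ∀ N : ℕ, ∃ k, N ≤ k ∧ k ∈ goodTimes g σ α}

theorem alphaIter_ne_zero {g σ α : ℝ} (hα : α ∈ SigmaSet g σ) (j : ℕ) :
    alphaIter α j ≠ 0 := by
  intro h0
  have key : ∀ n, alphaIter α (j + n) = 0 := by
    intro n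
    induction n with
    | zero => exact h0
    | succ n ih =>
      have : alphaIter α (j + (n + 1)) = gauss (alphaIter α (j + n)) := by
        rw [alphaIter, ← add_assoc, Function.iterate_succ_apply']
        rfl
      rw [this, ih]
      simp [gauss]
  obtain ⟨k, hk, hg⟩ := hα.2 j
  obtain ⟨n, rfl⟩ := Nat.exists_eq_add_of_le hk
  have h := hg.1.2.1
  rw [key n] at h
  norm_num at h

theorem betaPred_ne_zero {g σ α : ℝ} (hα : α ∈ SigmaSet g σ) (k : ℕ) : betaPred α k ≠ 0 :=
  Finset.prod_ne_zero_iff.2 fun j _ => alphaIter_ne_zero hα j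

/-- The change of basis `(e₁, e₂) ↦ (e₂, e₁ - a e₂)` of `ℤ²`. -/
def gaussStep (a : ℤ) : ℤ × ℤ ≃+ ℤ × ℤ where
  toFun v := (v.2, v.1 - a * v.2)
  invFun v := (v.2 + a * v.1, v.1)
  left_inv v := by ext <;> simp
  right_inv v := by ext <;> simp
  map_add' v w := by
    ext
    · simp
    · simp
      ring

/-- The `k`-th continued fraction basis of `ℤ²`: composition of the changes of basis
`(e₁, e₂) ↦ (e₂, e₁ - a_j e₂)`, `j = 1, …, k`, with `a_j = ⌊1/α_{j-1}⌋`. -/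
def cfBasis (α : ℝ) : ℕ → (ℤ × ℤ ≃+ ℤ × ℤ)
  | 0 => AddEquiv.refl _
  | k + 1 => (gaussStep ⌊(alphaIter α k)⁻¹⌋).trans (cfBasis α k)

end QPCocycle

end

/-! Bounded fibered products make `(α, A)` continuously conjugate to rotations. The vectors whose
whole orbit stays in the unit ball form an invariant family of compact bodies. Their area is upper
semicontinuous and invariant under an irrational translation, hence constant; therefore the bodies
vary continuously in measure and their second moments are continuous. A triangular matrix that makes
the second moments scalar conjugates `A` into rotations (`SmoothLoop.BoundedProds.exists_conj`), and
the homotopy to `E d` lifts the angle to `2π d θ + φ(θ)` with `φ` periodic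
(`SmoothLoop.BoundedProds.exists_conj_rot`). This conjugacy `B` is only continuous.

Smoothness comes from renormalization. The generators of the renormalized action are `t ↦
A_m(β_{k-1} t)` with `|m| β_{k-1} ≤ 1`. Differentiating `A_m` produces a sum of `|m|` bounded terms,
which the dilatation compensates, so all derivatives are bounded uniformly in `k`
(`SmoothLoop.BoundedProds.mbdd_rescaling`). Since `β_{k-1} → 0`, `B` is nearly the constant `B 0` at
this scale. Conjugation by that constant keeps the derivative bounds and brings the action
`C^0`-close to rotations of explicit angles, whose commutation defect is `2π (-1)^k d`; the sign is
the determinant of the change of basis (`exists_renorm_angles`).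

The first generator is then turned into `(1, Id)` by a smooth map built from a controlled path in
`SL(2,ℝ)`. What remains is a loop with bounded derivatives, `C^0`-close to the rotation by a lifted
angle `u k` that gains `2π r_k` over a period (`exists_normal_form`).

It remains to straighten that angle. Conjugation by a rotation replaces its periodic part by a long
Birkhoff average. As `α_k` lies in a fixed Diophantine set, its orbits become dense at a rate
independent of `k` (`exists_uniform_density`), so the average is nearly constant. The constant is
removed modulo `2π` by conjugating with `E n`, `n` bounded, which adds `2π n α_k`. The error is
small in `C^0` and bounded in every `C^s`, so interpolation makes it small in `C^{s₀}`
(`exists_conj_close`). A diagonal choice over the accuracy gives the sequence. -/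

noncomputable section

namespace QPCocycle

/-! ### Families of functions with uniformly bounded derivatives -/

/-- A family of smooth functions whose derivatives of order at most `s` are bounded on `S`,
uniformly in the index. -/
def UBdd {ι : Type*} (S : Set ℝ) (s : ℕ) (f : ι → ℝ → ℝ) : Prop :=
  (∀ i, ContDiff ℝ ∞ (f i)) ∧
    ∀ m ≤ s, ∃ K, ∀ i, ∀ t ∈ S, |iteratedDeriv m (f i) t| ≤ K

theorem contDiff_deriv {f : ℝ → ℝ} (h : ContDiff ℝ ∞ f) : ContDiff ℝ ∞ (deriv f) :=
  ((contDiff_infty_iff_deriv (𝕜 := ℝ)).1 h).2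

theorem contDiff_iteratedDeriv {f : ℝ → ℝ} (h : ContDiff ℝ ∞ f) (m : ℕ) :
    ContDiff ℝ ∞ (iteratedDeriv m f) := by
  induction m with
  | zero => simpa using h
  | succ m ih => rw [iteratedDeriv_succ]; exact contDiff_deriv ih

theorem _root_.ContDiff.differentiable_infty {f : ℝ → ℝ} (h : ContDiff ℝ ∞ f) :
    Differentiable ℝ f :=
  h.differentiable (by simp)

namespace UBdd

variable {ι κ : Type*} {S S' : Set ℝ} {s : ℕ} {f g : ι → ℝ → ℝ}

theorem zero_iff : UBdd S 0 f ↔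
    (∀ i, ContDiff ℝ ∞ (f i)) ∧ ∃ K, ∀ i, ∀ t ∈ S, |f i t| ≤ K := by
  unfold UBdd
  simp

/-- This is the induction step behind the closure properties below: a Leibniz or chain rule for one
derivative replaces formulas for higher ones. -/
theorem succ_iff : UBdd S (s + 1) f ↔ UBdd S 0 f ∧ UBdd S s (fun i => deriv (f i)) := by
  constructor
  · intro h
    refine ⟨⟨h.1, fun m hm => h.2 m (by omega)⟩, fun i => contDiff_deriv (h.1 i), fun m hm => ?_⟩
    obtain ⟨K, hK⟩ := h.2 (m + 1) (by omega)
    exact ⟨K, fun i t ht => by rw [← iteratedDeriv_succ']; exact hK i t ht⟩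
  · rintro ⟨h0, h1⟩
    refine ⟨h0.1, fun m hm => ?_⟩
    cases m with
    | zero => exact h0.2 0 le_rfl
    | succ m =>
      obtain ⟨K, hK⟩ := h1.2 m (by omega)
      exact ⟨K, fun i t ht => by rw [iteratedDeriv_succ']; exact hK i t ht⟩

theorem of_le {s' : ℕ} (h : UBdd S s f) (hs : s' ≤ s) : UBdd S s' f :=
  ⟨h.1, fun m hm => h.2 m (hm.trans hs)⟩

theorem mono (h : UBdd S s f) (hS : S' ⊆ S) : UBdd S' s f :=
  ⟨h.1, fun m hm => (h.2 m hm).imp fun _ hK i t ht => hK i t (hS ht)⟩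

theorem reindex (h : UBdd S s f) (e : κ → ι) : UBdd S s (fun k => f (e k)) :=
  ⟨fun k => h.1 (e k), fun m hm => (h.2 m hm).imp fun _ hK k t ht => hK (e k) t ht⟩

theorem congr (h : UBdd S s f) (hfg : ∀ i t, f i t = g i t) : UBdd S s g := by
  have : f = g := by ext i t; exact hfg i t
  rwa [← this]

theorem bound (h : UBdd S s f) : ∃ K, 0 < K ∧ ∀ i, ∀ t ∈ S, |f i t| ≤ K := by
  obtain ⟨K, hK⟩ := h.2 0 (Nat.zero_le _)
  refine ⟨max K 1, by positivity, fun i t ht => le_max_of_le_left ?_⟩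
  simpa using hK i t ht

theorem const {c : ι → ℝ} {K : ℝ} (hc : ∀ i, |c i| ≤ K) : UBdd S s (fun i _ => c i) := by
  refine ⟨fun i => contDiff_const, fun m _ => ⟨K, fun i t _ => ?_⟩⟩
  cases m with
  | zero => simpa using hc i
  | succ m =>
    rw [iteratedDeriv_const]
    simpa using (abs_nonneg _).trans (hc i)

theorem add (hf : UBdd S s f) (hg : UBdd S s g) : UBdd S s (fun i t => f i t + g i t) := by
  refine ⟨fun i => (hf.1 i).add (hg.1 i), fun m hm => ?_⟩
  obtain ⟨K, hK⟩ := hf.2 m hm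
  obtain ⟨K', hK'⟩ := hg.2 m hm
  refine ⟨K + K', fun i t ht => ?_⟩
  have := iteratedDeriv_fun_add (n := m) (x := t) ((hf.1 i).contDiffAt.of_le (by exact_mod_cast le_top))
    ((hg.1 i).contDiffAt.of_le (by exact_mod_cast le_top))
  rw [this]
  exact (abs_add_le _ _).trans (add_le_add (hK i t ht) (hK' i t ht))

theorem mul (hf : UBdd S s f) (hg : UBdd S s g) : UBdd S s (fun i t => f i t * g i t) := by
  induction s generalizing f g with
  | zero =>
    rw [zero_iff] at *
    obtain ⟨hf, K, hK⟩ := hf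
    obtain ⟨hg, K', hK'⟩ := hg
    refine ⟨fun i => (hf i).mul (hg i), K * K', fun i t ht => ?_⟩
    rw [abs_mul]
    exact mul_le_mul (hK i t ht) (hK' i t ht) (abs_nonneg _) ((abs_nonneg _).trans (hK i t ht))
  | succ s ih =>
    have hf' := succ_iff.1 hf
    have hg' := succ_iff.1 hg
    refine succ_iff.2 ⟨?_, ?_⟩
    · have := ih (hf.of_le (Nat.le_succ s)) (hg.of_le (Nat.le_succ s))
      exact this.of_le (Nat.zero_le _)
    · refine ((ih hf'.2 (hg.of_le (Nat.le_succ s))).add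
        (ih (hf.of_le (Nat.le_succ s)) hg'.2)).congr fun i t => ?_
      exact (deriv_fun_mul ((hf.1 i).differentiable_infty t)
        ((hg.1 i).differentiable_infty t)).symm

theorem const_mul {c : ι → ℝ} {K : ℝ} (hc : ∀ i, |c i| ≤ K) (hf : UBdd S s f) :
    UBdd S s (fun i t => c i * f i t) := (UBdd.const hc).mul hf

theorem neg (hf : UBdd S s f) : UBdd S s (fun i t => -f i t) :=
  (hf.const_mul (c := fun _ => -1) (K := 1) (by simp)).congr (by simp)

theorem sub (hf : UBdd S s f) (hg : UBdd S s g) : UBdd S s (fun i t => f i t - g i t) :=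
  (hf.add hg.neg).congr (by simp [sub_eq_add_neg])

/-- Each derivative brings out one factor `b i`, so `|b i| ≤ 1` keeps the bounds uniform; the shifts
`c i` are harmless because the bounds hold on the whole line. -/
theorem comp_affine (hf : UBdd Set.univ s f) {b c : ι → ℝ} (hb : ∀ i, |b i| ≤ 1) :
    UBdd Set.univ s (fun i t => f i (b i * t + c i)) := by
  induction s generalizing f with
  | zero =>
    rw [zero_iff] at *
    obtain ⟨hf, K, hK⟩ := hf
    exact ⟨fun i => (hf i).comp (by fun_prop), K, fun i t ht => hK i _ trivial⟩
  | succ s ih =>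
    have hf' := succ_iff.1 hf
    refine succ_iff.2 ⟨(ih (hf.of_le (Nat.le_succ s))).of_le (Nat.zero_le _), ?_⟩
    refine ((ih hf'.2).const_mul hb).congr fun i t => ?_
    have h1 : HasDerivAt (fun t => b i * t + c i) (b i) t := by
      simpa using ((hasDerivAt_id t).const_mul (b i)).add_const (c i)
    have h2 := ((hf.1 i).differentiable_infty (b i * t + c i)).hasDerivAt.comp t h1
    have h3 : deriv (fun t => f i (b i * t + c i)) t = deriv (f i) (b i * t + c i) * b i :=
      h2.deriv
    rw [h3, mul_comm]

theorem comp_add (hf : UBdd Set.univ s f) (c : ι → ℝ) :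
    UBdd Set.univ s (fun i t => f i (t + c i)) :=
  (hf.comp_affine (b := fun _ => 1) (c := c) (by simp)).congr (by simp)

/-- A shift by a fixed amount moves the set on which the bounds hold. -/
theorem comp_add_fixed (hf : UBdd S s f) (c : ι → ℝ) (hS : ∀ i, ∀ t ∈ S', t + c i ∈ S) :
    UBdd S' s (fun i t => f i (t + c i)) := by
  refine ⟨fun i => (hf.1 i).comp (by fun_prop), fun m hm => ?_⟩
  obtain ⟨K, hK⟩ := hf.2 m hm
  refine ⟨K, fun i t ht => ?_⟩
  rw [iteratedDeriv_comp_add_const]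
  exact hK i _ (hS i t ht)

/-- The reciprocal of a family bounded away from zero. -/
theorem inv (hf : UBdd S s f) (h0 : ∀ i t, f i t ≠ 0) {c : ℝ} (hc : 0 < c)
    (hfc : ∀ i, ∀ t ∈ S, c ≤ |f i t|) : UBdd S s (fun i t => (f i t)⁻¹) := by
  have hsm : ∀ i, ContDiff ℝ ∞ fun t => (f i t)⁻¹ := fun i => (hf.1 i).inv (h0 i)
  have hz : UBdd S 0 (fun i t => (f i t)⁻¹) := zero_iff.2 ⟨hsm, c⁻¹, fun i t ht => by
    rw [abs_inv]
    exact inv_anti₀ hc (hfc i t ht)⟩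
  induction s with
  | zero => exact hz
  | succ s ih =>
    have h := ih (hf.of_le (Nat.le_succ s))
    refine succ_iff.2 ⟨hz, ?_⟩
    refine (((succ_iff.1 hf).2.mul (h.mul h)).neg).congr fun i t => ?_
    have := ((hf.1 i).differentiable_infty t).hasDerivAt.fun_inv (h0 i t)
    rw [this.deriv]
    field_simp

/-- Cosine and sine of a family whose derivatives are bounded. -/
theorem cos_sin {u : ι → ℝ → ℝ} (hu : ∀ i, ContDiff ℝ ∞ (u i))
    (hf : UBdd S s (fun i => deriv (u i))) :
    UBdd S s (fun i t => Real.cos (u i t)) ∧ UBdd S s (fun i t => Real.sin (u i t)) := by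
  have hc : ∀ i, ContDiff ℝ ∞ fun t => Real.cos (u i t) := fun i => (hu i).cos
  have hs : ∀ i, ContDiff ℝ ∞ fun t => Real.sin (u i t) := fun i => (hu i).sin
  have hc0 : UBdd S 0 (fun i t => Real.cos (u i t)) :=
    zero_iff.2 ⟨hc, 1, fun i t _ => Real.abs_cos_le_one _⟩
  have hs0 : UBdd S 0 (fun i t => Real.sin (u i t)) :=
    zero_iff.2 ⟨hs, 1, fun i t _ => Real.abs_sin_le_one _⟩
  induction s with
  | zero => exact ⟨hc0, hs0⟩
  | succ s ih =>
    obtain ⟨h1, h2⟩ := ih (hf.of_le (Nat.le_succ s))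
    have hf' := hf.of_le (Nat.le_succ s)
    refine ⟨succ_iff.2 ⟨hc0, (h2.mul hf').neg.congr fun i t => ?_⟩,
      succ_iff.2 ⟨hs0, (h1.mul hf').congr fun i t => ?_⟩⟩
    · rw [((hu i).differentiable_infty t).hasDerivAt.cos.deriv]
      ring
    · rw [((hu i).differentiable_infty t).hasDerivAt.sin.deriv]

/-- Families that agree on an open set containing `S` have the same bounds on `S`. -/
theorem congr_of_eqOn (hf : UBdd S s f) (hg : ∀ i, ContDiff ℝ ∞ (g i)) (O : ι → Set ℝ)
    (hO : ∀ i, IsOpen (O i)) (hSO : ∀ i, S ⊆ O i) (h : ∀ i, Set.EqOn (f i) (g i) (O i)) :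
    UBdd S s g := by
  refine ⟨hg, fun m hm => (hf.2 m hm).imp fun K hK i t ht => ?_⟩
  have : f i =ᶠ[𝓝 t] g i := (h i).eventuallyEq_of_mem ((hO i).mem_nhds (hSO i ht))
  rw [← (this.iteratedDeriv_eq m)]
  exact hK i t ht

/-- Bounds over a period hold everywhere. -/
theorem of_periodic (hf : UBdd (Set.Icc 0 1) s f) (hp : ∀ i, Function.Periodic (f i) 1) :
    UBdd Set.univ s f := by
  refine ⟨hf.1, fun m hm => (hf.2 m hm).imp fun K hK i t _ => ?_⟩
  have hper : Function.Periodic (iteratedDeriv m (f i)) 1 := by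
    intro x
    have h := congrFun (iteratedDeriv_comp_add_const m (f i) 1) x
    rw [← h, funext (hp i)]
  obtain ⟨y, hy, hxy⟩ := hper.exists_mem_Ico₀ one_pos t
  rw [hxy]
  exact hK i y ⟨hy.1, hy.2.le⟩

/-- A single smooth periodic function has bounded derivatives. -/
theorem of_smooth_periodic {f : ℝ → ℝ} (hf : ContDiff ℝ ∞ f) (hp : Function.Periodic f 1) :
    UBdd Set.univ s (fun _ : ι => f) := by
  refine of_periodic ⟨fun _ => hf, fun m _ => ?_⟩ fun _ => hp
  obtain ⟨K, hK⟩ := (isCompact_Icc (a := (0:ℝ)) (b := 1)).exists_bound_of_continuousOn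
    (contDiff_iteratedDeriv hf m).continuous.continuousOn
  exact ⟨K, fun _ t ht => hK t ht⟩

/-- A single smooth function has bounded derivatives on a compact set. -/
theorem of_isCompact {f : ℝ → ℝ} (hf : ContDiff ℝ ∞ f) (hS : IsCompact S) :
    UBdd S s (fun _ : ι => f) := by
  refine ⟨fun _ => hf, fun m _ => ?_⟩
  obtain ⟨K, hK⟩ := hS.exists_bound_of_continuousOn
    (contDiff_iteratedDeriv hf m).continuous.continuousOn
  exact ⟨K, fun _ t ht => hK t ht⟩

/-- Bounds on an interval for a family, from bounds on its derivatives and at a point. -/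
theorem of_deriv {a b x₀ K₀ : ℝ} (hx₀ : x₀ ∈ Set.Icc a b) (hf : ∀ i, ContDiff ℝ ∞ (f i))
    (h0 : ∀ i, |f i x₀| ≤ K₀) (h : UBdd (Set.Icc a b) s (fun i => deriv (f i))) :
    UBdd (Set.Icc a b) s f := by
  obtain ⟨K, hK0, hK⟩ := h.bound
  refine UBdd.of_le (succ_iff.2 ⟨zero_iff.2 ⟨hf, K₀ + K * (b - a), fun i t ht => ?_⟩, h⟩)
    (Nat.le_succ s)
  have h1 := (convex_Icc a b).norm_image_sub_le_of_norm_deriv_le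
    (fun x _ => (hf i).differentiable_infty x) (fun x hx => hK i x hx) hx₀ ht
  rw [Real.norm_eq_abs, Real.norm_eq_abs] at h1
  have h2 : |t - x₀| ≤ b - a := by
    rw [abs_le]
    constructor <;> linarith [ht.1, ht.2, hx₀.1, hx₀.2]
  have h3 : K * |t - x₀| ≤ K * (b - a) := by gcongr
  have h4 := abs_sub_abs_le_abs_sub (f i t) (f i x₀)
  linarith [h0 i]

/-- Normalized sums of boundedly many terms of a family. -/
theorem weighted_sum {n : ι → ℕ} {b : ι → ℝ} {C : ℝ} (hb : ∀ i, |b i| * n i ≤ C)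
    {F : ι → ℕ → ℝ → ℝ}
    (hF : UBdd S s (fun p : {p : ι × ℕ // p.2 < n p.1} => F p.1.1 p.1.2)) :
    UBdd S s (fun i t => b i * ∑ j ∈ Finset.range (n i), F i j t) := by
  have hsm : ∀ i, ∀ j ∈ Finset.range (n i), ContDiff ℝ ∞ (F i j) := fun i j hj =>
    hF.1 ⟨(i, j), Finset.mem_range.1 hj⟩
  refine ⟨fun i => contDiff_const.mul (ContDiff.sum fun j hj => hsm i j hj), fun m hm => ?_⟩
  obtain ⟨K, hK⟩ := hF.2 m hm
  refine ⟨C * max K 0, fun i t ht => ?_⟩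
  have hs : ∀ j ∈ Finset.range (n i), ContDiffAt ℝ m (F i j) t := fun j hj =>
    (hsm i j hj).contDiffAt.of_le (by exact_mod_cast le_top)
  rw [iteratedDeriv_const_mul_field, iteratedDeriv_fun_sum hs, abs_mul]
  have h1 : |∑ j ∈ Finset.range (n i), iteratedDeriv m (F i j) t| ≤ n i * max K 0 := by
    refine (Finset.abs_sum_le_sum_abs _ _).trans ?_
    refine (Finset.sum_le_sum (g := fun _ => max K 0) fun j hj => ?_).trans (by simp)
    exact le_max_of_le_left (hK ⟨(i, j), Finset.mem_range.1 hj⟩ t ht)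
  calc |b i| * |∑ j ∈ Finset.range (n i), iteratedDeriv m (F i j) t|
      ≤ |b i| * (n i * max K 0) := by gcongr
    _ = |b i| * n i * max K 0 := by ring
    _ ≤ C * max K 0 := by gcongr; exact hb i

end UBdd

/-! ### Interpolation between derivatives. -/

/-- Landau's inequality: `‖f'‖ h ≤ 2 ‖f‖ + h² ‖f''‖`. -/
theorem abs_deriv_mul_le {f : ℝ → ℝ} (hf : ContDiff ℝ ∞ f) {a c h : ℝ} (h0 : 0 < h)
    (ha : ∀ t, |f t| ≤ a) (hc : ∀ t, |deriv (deriv f) t| ≤ c) (t : ℝ) :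
    |deriv f t| * h ≤ 2 * a + h ^ 2 * c := by
  -- At some point within distance `h` the derivative equals a difference quotient, of size at most
  -- `2 a / h`; the second derivative controls the change from there to `t`.
  obtain ⟨x, hx, hfx⟩ := exists_deriv_eq_slope f (show t < t + h by linarith)
    hf.continuous.continuousOn hf.differentiable_infty.differentiableOn
  have hd := contDiff_deriv hf
  have h1 := (convex_univ (𝕜 := ℝ) (E := ℝ)).norm_image_sub_le_of_norm_deriv_le
    (f := deriv f) (fun y _ => hd.differentiable_infty y) (fun y _ => hc y)
    (Set.mem_univ x) (Set.mem_univ t)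
  rw [Real.norm_eq_abs, Real.norm_eq_abs] at h1
  have hc0 : 0 ≤ c := (abs_nonneg _).trans (hc 0)
  have h2 : |t - x| ≤ h := by rw [abs_le]; constructor <;> linarith [hx.1, hx.2]
  have h3 : |deriv f t| ≤ |deriv f x| + c * h := by
    have := abs_sub_abs_le_abs_sub (deriv f t) (deriv f x)
    have : c * |t - x| ≤ c * h := by gcongr
    linarith
  have h4 : |deriv f x| * h ≤ 2 * a := by
    rw [hfx, abs_div, show t + h - t = h by ring, abs_of_pos h0, div_mul_cancel₀ _ h0.ne']
    have := abs_sub (f (t + h)) (f t)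
    linarith [ha t, ha (t + h)]
  calc |deriv f t| * h ≤ (|deriv f x| + c * h) * h := by gcongr
    _ ≤ 2 * a + h ^ 2 * c := by nlinarith

/-- Interpolation: if all derivatives are bounded and the function is small, then so are
its derivatives. -/
theorem exists_small_iteratedDeriv (s : ℕ) (K : ℕ → ℝ) {ε : ℝ} (hε : 0 < ε) :
    ∃ δ > 0, ∀ f : ℝ → ℝ, ContDiff ℝ ∞ f → (∀ m ≤ s + 1, ∀ t, |iteratedDeriv m f t| ≤ K m) →
      (∀ t, |f t| ≤ δ) → ∀ t, |iteratedDeriv s f t| ≤ ε := by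
  induction s generalizing ε with
  | zero => exact ⟨ε, hε, fun f _ _ h => by simpa using h⟩
  | succ s ih =>
    set c := max (K (s + 2)) 1 with hc
    have hc0 : 0 < c := by positivity
    -- This `h` makes `h ^ 2 * c` equal to `ε * h / 2`. The accuracy `ε * h / 4` one order below
    -- makes the other term of Landau's bound equal to it.
    set h := ε / (2 * c) with hh
    have h0 : 0 < h := by positivity
    obtain ⟨δ, hδ, H⟩ := ih (ε := ε * h / 4) (by positivity)
    refine ⟨δ, hδ, fun f hf hK hfδ t => ?_⟩
    have h1 := H f hf (fun m hm => hK m (by omega)) hfδ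
    have h2 := abs_deriv_mul_le (contDiff_iteratedDeriv hf s) h0 h1 (c := c) (fun x => by
      rw [← iteratedDeriv_succ, ← iteratedDeriv_succ]
      exact (hK (s + 2) (by omega) x).trans (le_max_left _ _)) t
    rw [← iteratedDeriv_succ] at h2
    have h3 : h ^ 2 * c = ε * h / 2 := by rw [hh]; field_simp
    rw [h3] at h2
    refine le_of_mul_le_mul_right ?_ h0
    linarith

/-! ### Families of matrix-valued functions -/

/-- Real `2 × 2` matrices. -/
abbrev Mat := Matrix (Fin 2) (Fin 2) ℝ

namespace SL2

theorem inv_zero_zero (x : SL2) : (x⁻¹).1 0 0 = x.1 1 1 := by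
  simp [Matrix.SpecialLinearGroup.coe_inv, Matrix.adjugate_fin_two]
theorem inv_zero_one (x : SL2) : (x⁻¹).1 0 1 = -x.1 0 1 := by
  simp [Matrix.SpecialLinearGroup.coe_inv, Matrix.adjugate_fin_two]
theorem inv_one_zero (x : SL2) : (x⁻¹).1 1 0 = -x.1 1 0 := by
  simp [Matrix.SpecialLinearGroup.coe_inv, Matrix.adjugate_fin_two]
theorem inv_one_one (x : SL2) : (x⁻¹).1 1 1 = x.1 0 0 := by
  simp [Matrix.SpecialLinearGroup.coe_inv, Matrix.adjugate_fin_two]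

theorem det_eq (x : SL2) : x.1 0 0 * x.1 1 1 - x.1 0 1 * x.1 1 0 = 1 := by
  rw [← Matrix.det_fin_two, x.2]

end SL2

/-- A family of matrix-valued functions whose entries have uniformly bounded derivatives. -/
def MBdd {ι : Type*} (S : Set ℝ) (s : ℕ) (F : ι → ℝ → Mat) : Prop :=
  ∀ a b, UBdd S s (fun i t => F i t a b)

namespace MBdd

variable {ι κ : Type*} {S S' : Set ℝ} {s : ℕ} {F G : ι → ℝ → Mat}

theorem mono (h : MBdd S s F) (hS : S' ⊆ S) : MBdd S' s F := fun a b => (h a b).mono hS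

theorem reindex (h : MBdd S s F) (e : κ → ι) : MBdd S s (fun k => F (e k)) :=
  fun a b => (h a b).reindex e

theorem congr (h : MBdd S s F) (hFG : ∀ i t, F i t = G i t) : MBdd S s G :=
  fun a b => (h a b).congr fun i t => by rw [hFG]

theorem mul (hF : MBdd S s F) (hG : MBdd S s G) : MBdd S s (fun i t => F i t * G i t) := by
  intro a b
  refine (((hF a 0).mul (hG 0 b)).add ((hF a 1).mul (hG 1 b))).congr fun i t => ?_
  simp [Matrix.mul_apply]

theorem sub (hF : MBdd S s F) (hG : MBdd S s G) : MBdd S s (fun i t => F i t - G i t) :=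
  fun a b => (hF a b).sub (hG a b)

theorem inv {F : ι → ℝ → SL2} (hF : MBdd S s (fun i t => (F i t).1)) :
    MBdd S s (fun i t => ((F i t)⁻¹).1) := by
  intro a b
  fin_cases a <;> fin_cases b
  · exact (hF 1 1).congr fun i t => (SL2.inv_zero_zero _).symm
  · exact (hF 0 1).neg.congr fun i t => (SL2.inv_zero_one _).symm
  · exact (hF 1 0).neg.congr fun i t => (SL2.inv_one_zero _).symm
  · exact (hF 0 0).congr fun i t => (SL2.inv_one_one _).symm

theorem mul' {F G : ι → ℝ → SL2} (hF : MBdd S s (fun i t => (F i t).1))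
    (hG : MBdd S s (fun i t => (G i t).1)) : MBdd S s (fun i t => (F i t * G i t).1) :=
  (hF.mul hG).congr fun _ _ => (Matrix.SpecialLinearGroup.coe_mul _ _).symm

theorem comp_add (hF : MBdd Set.univ s F) (c : ι → ℝ) :
    MBdd Set.univ s (fun i t => F i (t + c i)) := fun a b => (hF a b).comp_add c

end MBdd

/-- Needed because the iteration times are integers of either sign: each index falls under the
estimate for positive times or the one for negative times. -/
theorem UBdd.of_or {ι : Type*} {S : Set ℝ} {s : ℕ} {f g h : ι → ℝ → ℝ} (hf : UBdd S s f)
    (hg : UBdd S s g) (hh : ∀ i, h i = f i ∨ h i = g i) : UBdd S s h := by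
  refine ⟨fun i => ?_, fun m hm => ?_⟩
  · rcases hh i with h | h <;> rw [h]
    exacts [hf.1 i, hg.1 i]
  · obtain ⟨K, hK⟩ := hf.2 m hm
    obtain ⟨K', hK'⟩ := hg.2 m hm
    refine ⟨max K K', fun i t ht => ?_⟩
    rcases hh i with h | h <;> rw [h]
    exacts [le_max_of_le_left (hK i t ht), le_max_of_le_right (hK' i t ht)]

/-- The entrywise derivative. -/
def mderiv (F : ℝ → Mat) (t : ℝ) : Mat := Matrix.of fun a b => deriv (fun t => F t a b) t

theorem mderiv_mul {F G : ℝ → Mat} {t : ℝ} (hF : ∀ a b, DifferentiableAt ℝ (fun t => F t a b) t)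
    (hG : ∀ a b, DifferentiableAt ℝ (fun t => G t a b) t) :
    mderiv (fun t => F t * G t) t = mderiv F t * G t + F t * mderiv G t := by
  ext a b
  simp only [mderiv, Matrix.of_apply, Matrix.add_apply, Matrix.mul_apply, Fin.sum_univ_two]
  refine (((hF a 0).hasDerivAt.mul (hG 0 b).hasDerivAt).add
    ((hF a 1).hasDerivAt.mul (hG 1 b).hasDerivAt)).deriv.trans ?_
  ring

theorem mderiv_comp_add (F : ℝ → Mat) (c t : ℝ) :
    mderiv (fun t => F (t + c)) t = mderiv F (t + c) := by
  ext a b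
  exact deriv_comp_add_const (fun t => F t a b) c t

theorem Smooth.differentiableAt {D : ℝ → SL2} (h : Smooth D) (t : ℝ) (a b : Fin 2) :
    DifferentiableAt ℝ (fun t => (D t).1 a b) t := (h a b).differentiable_infty t

/-! ### Fibered products and the derivatives of their rescalings. -/

namespace SmoothLoop

variable {α : ℝ} (A : SmoothLoop)

theorem freq_pow (n : ℤ) : ((A.cocycle α) ^ n).freq = n * α := by
  induction n with
  | zero => simp
  | succ n ih => rw [zpow_add_one, FiberedMap.freq_mul, ih]; simp [cocycle]; ring
  | pred n ih => rw [zpow_sub_one, FiberedMap.freq_mul, ih]; simp [cocycle]; ring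

theorem fiberedProd_zero (θ : ℝ) : A.fiberedProd α 0 θ = 1 := by simp [fiberedProd]

theorem fiberedProd_one (θ : ℝ) : A.fiberedProd α 1 θ = A.toFun θ := by
  simp [fiberedProd, cocycle]

/-- The cocycle identity. -/
theorem fiberedProd_add (m n : ℤ) (θ : ℝ) :
    A.fiberedProd α (m + n) θ = A.fiberedProd α m (θ + n * α) * A.fiberedProd α n θ := by
  simp only [fiberedProd, zpow_add, FiberedMap.fib_mul, freq_pow]

theorem fiberedProd_neg (n : ℤ) (θ : ℝ) :
    A.fiberedProd α (-n) θ = (A.fiberedProd α n (θ - n * α))⁻¹ := by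
  simp only [fiberedProd, zpow_neg, FiberedMap.fib_inv, freq_pow]

theorem fiberedProd_smooth (n : ℤ) : Smooth (A.fiberedProd α n) := FiberedMap.smooth _

theorem fiberedProd_periodic (n : ℤ) : Function.Periodic (A.fiberedProd α n) 1 := by
  intro θ
  have h := congrArg (fun x => x.fib θ) ((A.commute_cocycle α).zpow_right n).eq
  simp only [FiberedMap.fib_mul, unitShift, one_mul, mul_one] at h
  exact h.symm

/-- The logarithmic derivative `A⁻¹ A'`. -/
def logDeriv (θ : ℝ) : Mat := ((A.toFun θ)⁻¹).1 * mderiv (fun t => (A.toFun t).1) θ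

theorem logDeriv_entry (a b : Fin 2) :
    ContDiff ℝ ∞ (fun t => A.logDeriv t a b) ∧
      Function.Periodic (fun t => A.logDeriv t a b) 1 := by
  constructor
  · simp only [logDeriv, Matrix.mul_apply]
    exact ContDiff.sum fun j _ => (A.smooth.inv a j).mul (contDiff_deriv (A.smooth j b))
  · intro t
    have h : mderiv (fun t => (A.toFun t).1) (t + 1) = mderiv (fun t => (A.toFun t).1) t := by
      rw [← mderiv_comp_add]
      simp only [A.periodic _]
    simp only [logDeriv, h, A.periodic t]

/-- The Leibniz rule along the product, with each factor written as `A' = A * logDeriv`. When the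
products are bounded this is a sum of `n` bounded terms, so each derivative grows at most linearly
in `n`. -/
theorem mderiv_fiberedProd (n : ℕ) (θ : ℝ) :
    mderiv (fun t => (A.fiberedProd α n t).1) θ = (A.fiberedProd α n θ).1 *
      ∑ j ∈ Finset.range n, ((A.fiberedProd α j θ)⁻¹).1 * A.logDeriv (θ + j * α) *
        (A.fiberedProd α j θ).1 := by
  induction n with
  | zero =>
    ext a b
    simp [mderiv, fiberedProd_zero]
  | succ n ih =>
    have h1 : ∀ t, (A.fiberedProd α ((n : ℤ) + 1) t).1
        = (A.toFun (t + n * α)).1 * (A.fiberedProd α n t).1 := by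
      intro t
      rw [add_comm, fiberedProd_add, fiberedProd_one, Matrix.SpecialLinearGroup.coe_mul]
      simp
    have hinv : ∀ x : SL2, x.1 * (x⁻¹).1 = 1 := fun x => by
      rw [← Matrix.SpecialLinearGroup.coe_mul, mul_inv_cancel, Matrix.SpecialLinearGroup.coe_one]
    push_cast
    simp only [h1]
    rw [mderiv_mul (fun a b => (A.smooth.comp (f := fun t => t + n * α)
        (by fun_prop)).differentiableAt θ a b)
      (fun a b => (A.fiberedProd_smooth n).differentiableAt θ a b), ih,
      mderiv_comp_add (fun t => (A.toFun t).1), Finset.sum_range_succ, mul_add, add_comm]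
    congr 1
    · rw [mul_assoc]
    · simp only [logDeriv, mul_assoc]
      rw [← mul_assoc (A.fiberedProd α n θ).1, hinv, one_mul, ← mul_assoc (A.toFun _).1, hinv,
        one_mul]

/-- The index set of admissible rescalings `t ↦ A_n (b t + c)`. -/
def Rescaling : Type := {p : ℕ × ℝ × ℝ // |p.2.1| ≤ 1 ∧ |p.2.1| * p.1 ≤ 1}

variable {A}

/-- Induction on the order. A derivative of `A_n (b t + c)` is `b` times a sum of `n` terms, each a
product of rescaled fibered products and of a smooth periodic function, all controlled at order `s`.
The condition `|b| n ≤ 1` absorbs the number of terms. -/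
theorem BoundedProds.mbdd_rescaling (hA : A.BoundedProds α) (s : ℕ) :
    MBdd Set.univ s (fun (p : Rescaling) t =>
      (A.fiberedProd α p.1.1 (p.1.2.1 * t + p.1.2.2)).1) := by
  obtain ⟨M, hM⟩ := hA
  have hsm : ∀ (p : Rescaling) a b, ContDiff ℝ ∞ (fun t =>
      (A.fiberedProd α p.1.1 (p.1.2.1 * t + p.1.2.2)).1 a b) := fun p =>
    (A.fiberedProd_smooth p.1.1).comp (f := fun t => p.1.2.1 * t + p.1.2.2) (by fun_prop)
  induction s with
  | zero => exact fun a b => UBdd.zero_iff.2 ⟨fun p => hsm p a b, M, fun p t _ => hM _ _ _ _⟩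
  | succ s ih =>
    intro a b
    refine UBdd.succ_iff.2 ⟨(ih a b).of_le (Nat.zero_le _), ?_⟩
    let κ := {q : Rescaling × ℕ // q.2 < q.1.1.1}
    -- A shorter product `A_j`, `j < n`, with the same `b` and `c` is again an admissible rescaling;
    -- this is why the induction runs over all rescalings at once.
    let e : κ → Rescaling := fun q => ⟨(q.1.2, q.1.1.1.2), q.1.1.2.1, by
      refine le_trans ?_ q.1.1.2.2
      have : (q.1.2 : ℝ) ≤ q.1.1.1.1 := by exact_mod_cast q.2.le
      gcongr⟩
    have hP := ih.reindex e
    have hL : MBdd Set.univ s (fun (q : κ) t =>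
        A.logDeriv (q.1.1.1.2.1 * t + q.1.1.1.2.2 + q.1.2 * α)) := by
      intro a b
      obtain ⟨h1, h2⟩ := A.logDeriv_entry a b
      refine ((UBdd.of_smooth_periodic (ι := κ) h1 h2).comp_affine
        (b := fun q => q.1.1.1.2.1) (c := fun q => q.1.1.1.2.2 + q.1.2 * α)
        (fun q => q.1.1.2.1)).congr fun q t => by rw [← add_assoc]
    have hT := (hP.inv.mul hL).mul hP
    have hsum : ∀ l, UBdd Set.univ s (fun (p : Rescaling) t => p.1.2.1 *
        ∑ j ∈ Finset.range p.1.1, (((A.fiberedProd α j (p.1.2.1 * t + p.1.2.2))⁻¹).1 *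
          A.logDeriv (p.1.2.1 * t + p.1.2.2 + j * α) *
            (A.fiberedProd α j (p.1.2.1 * t + p.1.2.2)).1) l b) := fun l =>
      UBdd.weighted_sum (C := 1) (n := fun p : Rescaling => p.1.1) (b := fun p => p.1.2.1)
        (F := fun p j t => (((A.fiberedProd α j (p.1.2.1 * t + p.1.2.2))⁻¹).1 *
          A.logDeriv (p.1.2.1 * t + p.1.2.2 + j * α) *
            (A.fiberedProd α j (p.1.2.1 * t + p.1.2.2)).1) l b)
        (fun p => p.2.2) (hT l b)
    refine (((ih a 0).mul (hsum 0)).add ((ih a 1).mul (hsum 1))).congr fun p t => ?_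
    have h1 : HasDerivAt (fun t => p.1.2.1 * t + p.1.2.2) p.1.2.1 t := by
      simpa using ((hasDerivAt_id t).const_mul p.1.2.1).add_const p.1.2.2
    have h2 := (((A.fiberedProd_smooth (α := α) p.1.1).differentiableAt
      (p.1.2.1 * t + p.1.2.2) a b).hasDerivAt.comp t h1).deriv
    have h3 : deriv (fun t => (A.fiberedProd α p.1.1 t).1 a b) (p.1.2.1 * t + p.1.2.2)
        = mderiv (fun t => (A.fiberedProd α p.1.1 t).1) (p.1.2.1 * t + p.1.2.2) a b := rfl
    rw [h3, mderiv_fiberedProd] at h2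
    refine Eq.trans ?_ h2.symm
    rw [Matrix.mul_apply, Fin.sum_univ_two, Matrix.sum_apply, Matrix.sum_apply]
    ring

/-- The rescaled fibered products `t ↦ A_m (b t)`, `|b m| ≤ 1`, have bounded derivatives. -/
theorem BoundedProds.mbdd (hA : A.BoundedProds α) (s : ℕ) {κ : Type*} (m : κ → ℤ) (b : κ → ℝ)
    (hb : ∀ k, |b k| ≤ 1) (hm : ∀ k, |b k| * |(m k : ℝ)| ≤ 1) :
    MBdd Set.univ s (fun k t => (A.fiberedProd α (m k) (b k * t)).1) := by
  have hnat : ∀ k, ((m k).natAbs : ℝ) = |(m k : ℝ)| := fun k => by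
    rw [Nat.cast_natAbs, Int.cast_abs]
  let e : κ → ℝ → Rescaling := fun k c => ⟨((m k).natAbs, b k, c), hb k, by
    simpa [hnat] using hm k⟩
  have h := hA.mbdd_rescaling s
  intro i j
  -- Negative times are covered by `A_{-n}(x) = A_n(x - n α)⁻¹`, which accounts for the shift.
  refine UBdd.of_or ((h.reindex fun k => e k 0) i j)
    ((h.reindex fun k => e k (-((m k).natAbs * α))).inv i j) fun k => ?_
  rcases Int.natAbs_eq (m k) with hk | hk
  · left
    ext t
    simp only [e, add_zero]
    rw [← hk]
  · right
    ext t
    simp only [e]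
    conv_lhs => rw [hk, fiberedProd_neg]
    simp [sub_eq_add_neg]

end SmoothLoop

/-! ### The invariant family of convex bodies of a bounded cocycle -/

open MeasureTheory

namespace SmoothLoop

variable {α : ℝ} {A : SmoothLoop}

/-- The vectors whose whole orbit under the fibered products at `θ` stays in the unit ball. -/
def body (α : ℝ) (A : SmoothLoop) (θ : ℝ) : Set (Fin 2 → ℝ) :=
  {v | ∀ n : ℤ, ‖(A.fiberedProd α n θ).1.mulVec v‖ ≤ 1}

theorem isClosed_body (θ : ℝ) : IsClosed (body α A θ) := by
  have : body α A θ = ⋂ n : ℤ, {v | ‖(A.fiberedProd α n θ).1.mulVec v‖ ≤ 1} := by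
    ext v; simp [body]
  rw [this]
  refine isClosed_iInter fun n => isClosed_le ?_ continuous_const
  fun_prop

theorem measurableSet_body (θ : ℝ) : MeasurableSet (body α A θ) :=
  (isClosed_body θ).measurableSet

theorem body_subset (θ : ℝ) : body α A θ ⊆ Metric.closedBall 0 1 := by
  intro v hv
  simpa [fiberedProd_zero] using hv 0

theorem volume_body_lt_top (θ : ℝ) : volume (body α A θ) < ⊤ :=
  (measure_mono (body_subset θ)).trans_lt measure_closedBall_lt_top

theorem mem_body_add (θ : ℝ) (v : Fin 2 → ℝ) :
    (A.toFun θ).1.mulVec v ∈ body α A (θ + α) ↔ v ∈ body α A θ := by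
  have h : ∀ n : ℤ, (A.fiberedProd α n (θ + α)).1.mulVec ((A.toFun θ).1.mulVec v)
      = (A.fiberedProd α (n + 1) θ).1.mulVec v := fun n => by
    rw [fiberedProd_add, fiberedProd_one, Matrix.SpecialLinearGroup.coe_mul,
      Matrix.mulVec_mulVec]
    simp
  constructor
  · intro hv n
    have := hv (n - 1)
    rwa [h, sub_add_cancel] at this
  · intro hv n
    rw [h]
    exact hv (n + 1)

theorem body_add_one (θ : ℝ) : body α A (θ + 1) = body α A θ := by
  ext v
  simp only [body, Set.mem_ofPred_eq, fiberedProd_periodic A _ θ]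

/-- A single iterate expels `v`, and that iterate is continuous in `θ`. This semicontinuity is the
only regularity of the bodies known beforehand. -/
theorem eventually_notMem_body {θ : ℝ} {v : Fin 2 → ℝ} (hv : v ∉ body α A θ) :
    ∀ᶠ θ' in 𝓝 θ, v ∉ body α A θ' := by
  simp only [body, Set.mem_ofPred_eq, not_forall, not_le] at hv
  obtain ⟨n, hn⟩ := hv
  have hc : Continuous fun θ => ‖(A.fiberedProd α n θ).1.mulVec v‖ := by
    refine Continuous.norm (continuous_pi fun i => ?_)
    simp only [Matrix.mulVec, dotProduct]
    exact continuous_finsetSum _ fun j _ =>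
      ((A.fiberedProd_smooth n) i j).continuous.mul continuous_const
  filter_upwards [hc.continuousAt.eventually (lt_mem_nhds hn)] with θ' h hv'
  exact absurd (hv' n) (not_le.2 h)

/-- In the sup norm a matrix with entries at most `M` expands by at most `2 M`; the added `1` keeps
the denominator positive. -/
theorem BoundedProds.exists_ball_subset (hA : A.BoundedProds α) :
    ∃ r > 0, ∀ θ, Metric.ball 0 r ⊆ body α A θ := by
  obtain ⟨M, hM⟩ := hA
  have hM0 : 0 ≤ M := (abs_nonneg _).trans (hM 0 0 0 0)
  refine ⟨1 / (2 * M + 1), by positivity, fun θ v hv n => ?_⟩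
  rw [mem_ball_zero_iff, lt_div_iff₀ (by positivity)] at hv
  refine (pi_norm_le_iff_of_nonneg zero_le_one).2 fun i => ?_
  simp only [Matrix.mulVec, dotProduct, Fin.sum_univ_two, Real.norm_eq_abs]
  have h0 := norm_le_pi_norm v 0
  have h1 := norm_le_pi_norm v 1
  rw [Real.norm_eq_abs] at h0 h1
  calc _ ≤ |(A.fiberedProd α n θ).1 i 0| * |v 0| + |(A.fiberedProd α n θ).1 i 1| * |v 1| := by
        refine (abs_add_le _ _).trans ?_
        rw [abs_mul, abs_mul]
    _ ≤ M * ‖v‖ + M * ‖v‖ := by gcongr <;> apply hM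
    _ ≤ 1 := by nlinarith [norm_nonneg v]

/-- Integrals over the invariant bodies. -/
def moment (α : ℝ) (A : SmoothLoop) (f : (Fin 2 → ℝ) → ℝ) (θ : ℝ) : ℝ :=
  ∫ v in body α A θ, f v

theorem measurePreserving_toLin (x : SL2) :
    MeasurePreserving (fun v => x.1.mulVec v) (volume : Measure (Fin 2 → ℝ)) volume := by
  refine ⟨by fun_prop, ?_⟩
  have h := Real.map_matrix_volume_pi_eq_smul_volume_pi (M := x.1) (by rw [x.2]; exact one_ne_zero)
  rw [x.2] at h
  rw [show (fun v => x.1.mulVec v) = ⇑(Matrix.toLin' x.1) from rfl, h]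
  simp

theorem measurableEmbedding_toLin (x : SL2) :
    MeasurableEmbedding (fun v : Fin 2 → ℝ => x.1.mulVec v) := by
  have h1 : ∀ x : SL2, Continuous fun v : Fin 2 → ℝ => x.1.mulVec v := fun x => by fun_prop
  have h2 : ∀ x y : SL2, x * y = 1 → ∀ v : Fin 2 → ℝ, x.1.mulVec (y.1.mulVec v) = v := by
    intro x y hxy v
    rw [Matrix.mulVec_mulVec, ← Matrix.SpecialLinearGroup.coe_mul, hxy]
    simp
  let e : (Fin 2 → ℝ) ≃ₜ (Fin 2 → ℝ) :=
    { toFun := fun v => x.1.mulVec v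
      invFun := fun v => (x⁻¹).1.mulVec v
      left_inv := h2 _ _ (by simp)
      right_inv := h2 _ _ (by simp)
      continuous_toFun := h1 x
      continuous_invFun := h1 _ }
  exact e.measurableEmbedding

/-- Change of variables: `A θ` carries the body at `θ` onto the body at `θ + α` and preserves area.
-/
theorem moment_add (f : (Fin 2 → ℝ) → ℝ) (θ : ℝ) :
    moment α A f (θ + α) = moment α A (fun v => f ((A.toFun θ).1.mulVec v)) θ := by
  have h := (measurePreserving_toLin (A.toFun θ)).setIntegral_preimage_emb
    (measurableEmbedding_toLin _) f (body α A (θ + α))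
  have hset : (fun v : Fin 2 → ℝ => (A.toFun θ).1.mulVec v) ⁻¹' body α A (θ + α) =
      body α A θ := by
    ext v
    rw [Set.mem_preimage]
    exact mem_body_add θ v
  rw [hset] at h
  exact h.symm

theorem moment_add_one (f : (Fin 2 → ℝ) → ℝ) (θ : ℝ) :
    moment α A f (θ + 1) = moment α A f θ := by
  rw [moment, moment, body_add_one]

/-- A vector outside the body at `θ` is outside the nearby bodies, so the indicators tend to zero
pointwise, and the unit ball dominates them. -/
theorem tendsto_volume_diff (θ : ℝ) :
    Tendsto (fun θ' => volume.real (body α A θ' \ body α A θ)) (𝓝 θ) (𝓝 0) := by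
  have h : ∀ θ', volume.real (body α A θ' \ body α A θ)
      = ∫ v, (body α A θ' \ body α A θ).indicator (fun _ => (1 : ℝ)) v := fun θ' => by
    rw [integral_indicator ((measurableSet_body θ').diff (measurableSet_body θ))]
    simp
  simp only [h]
  rw [show (𝓝 (0 : ℝ)) = 𝓝 (∫ _ : Fin 2 → ℝ, (0 : ℝ)) by simp]
  refine tendsto_integral_filter_of_dominated_convergence
    ((Metric.closedBall (0 : Fin 2 → ℝ) 1).indicator fun _ => (1 : ℝ)) ?_ ?_ ?_ ?_
  · refine Eventually.of_forall fun θ' => ?_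
    exact (stronglyMeasurable_const.indicator
      ((measurableSet_body θ').diff (measurableSet_body θ))).aestronglyMeasurable
  · refine Eventually.of_forall fun θ' => Eventually.of_forall fun v => ?_
    rw [Real.norm_of_nonneg (Set.indicator_nonneg (fun _ _ => zero_le_one) v)]
    exact Set.indicator_le_indicator_of_subset (Set.sdiff_subset.trans (body_subset θ'))
      (fun _ => zero_le_one) v
  · exact (integrable_indicator_iff Metric.isClosed_closedBall.measurableSet).2
      (integrableOn_const measure_closedBall_lt_top.ne)
  · refine Eventually.of_forall fun v => ?_
    refine tendsto_const_nhds.congr' ?_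
    by_cases hv : v ∈ body α A θ
    · exact Eventually.of_forall fun θ' => by simp [hv]
    · filter_upwards [eventually_notMem_body hv] with θ' h'
      simp [h']

/-- The area of the bodies. -/
theorem moment_one (θ : ℝ) : moment α A (fun _ => 1) θ = volume.real (body α A θ) := by
  simp [moment]

theorem eventually_moment_one_lt {θ c : ℝ} (h : moment α A (fun _ => 1) θ < c) :
    ∀ᶠ θ' in 𝓝 θ, moment α A (fun _ => 1) θ' < c := by
  filter_upwards [(tendsto_volume_diff θ).eventually (gt_mem_nhds (sub_pos.2 h))] with θ' h'
  have h1 : volume.real (body α A θ') ≤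
      volume.real (body α A θ' \ body α A θ) + volume.real (body α A θ) := by
    refine (measureReal_mono ?_ ?_).trans (measureReal_union_le _ _)
    · rw [Set.sdiff_union_self]; exact Set.subset_union_left
    · exact ((measure_mono (Set.union_subset_union_left _ Set.sdiff_subset)).trans_lt
        ((measure_union_le _ _).trans_lt (ENNReal.add_lt_top.2
          ⟨volume_body_lt_top θ', volume_body_lt_top θ⟩))).ne
  rw [moment_one] at *
  linarith

/-- A function on `ℝ` that is invariant under `1` and an irrational `α` and whose sublevel
sets are open is constant. -/
theorem eq_of_invariant (hα : Irrational α) {a : ℝ → ℝ}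
    (h1 : ∀ θ, a (θ + 1) = a θ) (h2 : ∀ θ, a (θ + α) = a θ)
    (ha : ∀ θ c, a θ < c → ∀ᶠ θ' in 𝓝 θ, a θ' < c) (θ₁ θ₂ : ℝ) : a θ₁ = a θ₂ := by
  have key : ∀ θ₁ θ₂, ¬ a θ₁ < a θ₂ := by
    intro θ₁ θ₂ hlt
    have hdense : Dense (AddSubgroup.closure {1, α} : Set ℝ) := by
      rw [Set.pair_comm, dense_addSubgroupClosure_pair_iff]
      simpa using hα
    have hinv : ∀ x ∈ AddSubgroup.closure {1, α}, ∀ θ, a (θ + x) = a θ := by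
      intro x hx
      refine AddSubgroup.closure_induction (p := fun x _ => ∀ θ, a (θ + x) = a θ)
        ?_ ?_ ?_ ?_ hx
      · rintro x (rfl | rfl)
        exacts [h1, h2]
      · simp
      · intro x y _ _ hx hy θ
        rw [← add_assoc, hy, hx]
      · intro x _ hx θ
        rw [← hx (θ + -x), neg_add_cancel_right]
    -- The dense orbit of `θ₂`, along which `a` is constant, enters the neighbourhood of `θ₁` where
    -- `a < a θ₂`.
    obtain ⟨ε, hε, hball⟩ := Metric.eventually_nhds_iff.1 (ha θ₁ _ hlt)
    obtain ⟨x, hx, hxd⟩ := hdense.exists_dist_lt (θ₁ - θ₂) hε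
    have := hball (y := θ₂ + x) (by
      rw [Real.dist_eq] at *
      rw [abs_sub_comm]
      convert hxd using 2
      ring)
    rw [hinv x hx] at this
    exact lt_irrefl _ this
  exact le_antisymm (not_lt.1 (key _ _)) (not_lt.1 (key _ _))

/-- The area is invariant and upper semicontinuous, hence constant. The two halves of the symmetric
difference of nearby bodies then have equal area, and the half known to vanish in the limit controls
the other. -/
theorem continuous_moment (hα : Irrational α) {f : (Fin 2 → ℝ) → ℝ} (hf : Continuous f) :
    Continuous (moment α A f) := by
  rw [continuous_iff_continuousAt]
  intro θ
  obtain ⟨C, hC⟩ := (isCompact_closedBall (0 : Fin 2 → ℝ) 1).exists_bound_of_continuousOn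
    hf.continuousOn
  have harea : ∀ θ', volume.real (body α A θ') = volume.real (body α A θ) := fun θ' => by
    rw [← moment_one, ← moment_one]
    exact eq_of_invariant hα (moment_add_one _) (fun θ => moment_add _ θ)
      (fun θ c h => eventually_moment_one_lt h) θ' θ
  have hint : ∀ θ', IntegrableOn f (body α A θ') := fun θ' =>
    (hf.continuousOn.integrableOn_compact (isCompact_closedBall (0 : Fin 2 → ℝ) 1)).mono_set
      (body_subset θ')
  have hsplit : ∀ θ₁ θ₂, moment α A f θ₁ = (∫ v in body α A θ₁ ∩ body α A θ₂, f v) +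
      ∫ v in body α A θ₁ \ body α A θ₂, f v := fun θ₁ θ₂ =>
    (integral_inter_add_sdiff (measurableSet_body θ₂) (hint θ₁)).symm
  have hvol : ∀ θ₁ θ₂, volume.real (body α A θ₁) = volume.real (body α A θ₁ ∩ body α A θ₂) +
      volume.real (body α A θ₁ \ body α A θ₂) := fun θ₁ θ₂ =>
    (measureReal_inter_add_sdiff (measurableSet_body θ₂) (volume_body_lt_top θ₁).ne).symm
  have hbd : ∀ θ₁ θ₂, |∫ v in body α A θ₁ \ body α A θ₂, f v|
      ≤ C * volume.real (body α A θ₁ \ body α A θ₂) := fun θ₁ θ₂ =>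
    norm_setIntegral_le_of_norm_le_const
      ((measure_mono Set.sdiff_subset).trans_lt (volume_body_lt_top θ₁))
      (fun v hv => hC v (body_subset θ₁ hv.1))
  have hle : ∀ θ', |moment α A f θ' - moment α A f θ|
      ≤ 2 * C * volume.real (body α A θ' \ body α A θ) := fun θ' => by
    rw [hsplit θ' θ, hsplit θ θ', Set.inter_comm (body α A θ)]
    have h1 := hvol θ' θ
    have h2 := hvol θ θ'
    rw [Set.inter_comm (body α A θ)] at h2
    have h3 : volume.real (body α A θ \ body α A θ') = volume.real (body α A θ' \ body α A θ) := by
      linarith [harea θ']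
    have h4 := hbd θ' θ
    have h5 := hbd θ θ'
    rw [h3] at h5
    calc _ = |(∫ v in body α A θ' \ body α A θ, f v) - ∫ v in body α A θ \ body α A θ', f v| := by
          congr 1; ring
      _ ≤ _ := by
          refine (abs_sub _ _).trans ?_
          linarith
  rw [ContinuousAt, tendsto_iff_norm_sub_tendsto_zero]
  refine squeeze_zero (fun _ => norm_nonneg _) hle ?_
  simpa using (tendsto_volume_diff θ).const_mul (2 * C)

/-- The matrix of second moments of the invariant bodies. -/
def secondMoment (α : ℝ) (A : SmoothLoop) (θ : ℝ) : Mat :=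
  Matrix.of fun i j => moment α A (fun v => v i * v j) θ

theorem integrableOn_body {f : (Fin 2 → ℝ) → ℝ} (hf : Continuous f) (θ : ℝ) :
    IntegrableOn f (body α A θ) :=
  (hf.continuousOn.integrableOn_compact (isCompact_closedBall (0 : Fin 2 → ℝ) 1)).mono_set
    (body_subset θ)

theorem moment_comb {f g : (Fin 2 → ℝ) → ℝ} (hf : Continuous f) (hg : Continuous g) (c d θ : ℝ) :
    moment α A (fun v => c * f v + d * g v) θ = c * moment α A f θ + d * moment α A g θ := by
  have h := integral_add ((integrableOn_body (α := α) (A := A) hf θ).const_mul c)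
    ((integrableOn_body (α := α) (A := A) hg θ).const_mul d)
  rw [integral_const_mul, integral_const_mul] at h
  exact h

theorem moment_quadratic (a b c d θ : ℝ) :
    moment α A (fun v => a * (v 0 * v 0) + b * (v 0 * v 1) + c * (v 1 * v 0) + d * (v 1 * v 1)) θ
      = a * secondMoment α A θ 0 0 + b * secondMoment α A θ 0 1 + c * secondMoment α A θ 1 0 +
        d * secondMoment α A θ 1 1 := by
  have h1 := moment_comb (α := α) (A := A) (f := fun v => v 0 * v 0) (g := fun v => v 0 * v 1)
    (by fun_prop) (by fun_prop) a b θ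
  have h2 := moment_comb (α := α) (A := A) (f := fun v => a * (v 0 * v 0) + b * (v 0 * v 1))
    (g := fun v => v 1 * v 0) (by fun_prop) (by fun_prop) 1 c θ
  have h3 := moment_comb (α := α) (A := A)
    (f := fun v => 1 * (a * (v 0 * v 0) + b * (v 0 * v 1)) + c * (v 1 * v 0))
    (g := fun v => v 1 * v 1) (by fun_prop) (by fun_prop) 1 d θ
  rw [h2, h1] at h3
  simp only [one_mul] at h3
  exact h3

theorem secondMoment_add (θ : ℝ) : secondMoment α A (θ + α) =
    (A.toFun θ).1 * secondMoment α A θ * (A.toFun θ).1.transpose := by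
  ext i j
  have h := moment_quadratic (α := α) (A := A) ((A.toFun θ).1 i 0 * (A.toFun θ).1 j 0)
    ((A.toFun θ).1 i 0 * (A.toFun θ).1 j 1) ((A.toFun θ).1 i 1 * (A.toFun θ).1 j 0)
    ((A.toFun θ).1 i 1 * (A.toFun θ).1 j 1) θ
  have h2 : secondMoment α A (θ + α) i j = moment α A (fun v =>
      (A.toFun θ).1.mulVec v i * (A.toFun θ).1.mulVec v j) θ := moment_add _ θ
  have h3 : (fun v : Fin 2 → ℝ => (A.toFun θ).1.mulVec v i * (A.toFun θ).1.mulVec v j) =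
      fun v => (A.toFun θ).1 i 0 * (A.toFun θ).1 j 0 * (v 0 * v 0) +
        (A.toFun θ).1 i 0 * (A.toFun θ).1 j 1 * (v 0 * v 1) +
        (A.toFun θ).1 i 1 * (A.toFun θ).1 j 0 * (v 1 * v 0) +
        (A.toFun θ).1 i 1 * (A.toFun θ).1 j 1 * (v 1 * v 1) := by
    funext v
    simp only [Matrix.mulVec, dotProduct, Fin.sum_univ_two]
    ring
  rw [h2, h3, h]
  simp only [Matrix.mul_apply, Fin.sum_univ_two, Matrix.transpose_apply]
  ring

theorem secondMoment_add_one (θ : ℝ) : secondMoment α A (θ + 1) = secondMoment α A θ := by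
  simp only [secondMoment, moment_add_one]

theorem secondMoment_comm (θ : ℝ) : secondMoment α A θ 1 0 = secondMoment α A θ 0 1 := by
  simp only [secondMoment, Matrix.of_apply, mul_comm]

theorem continuous_secondMoment (hα : Irrational α) (i j : Fin 2) :
    Continuous (fun θ => secondMoment α A θ i j) :=
  continuous_moment hα (by fun_prop)

/-- The quadratic form of the second moments is positive. -/
theorem BoundedProds.quadForm_pos (hA : A.BoundedProds α) (θ : ℝ) {x y : ℝ}
    (hxy : x ≠ 0 ∨ y ≠ 0) :
    0 < x ^ 2 * secondMoment α A θ 0 0 + 2 * x * y * secondMoment α A θ 0 1 +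
      y ^ 2 * secondMoment α A θ 1 1 := by
  obtain ⟨r, hr, hball⟩ := hA.exists_ball_subset
  have h : x ^ 2 * secondMoment α A θ 0 0 + 2 * x * y * secondMoment α A θ 0 1 +
      y ^ 2 * secondMoment α A θ 1 1 = ∫ v in body α A θ, (x * v 0 + y * v 1) ^ 2 := by
    have h1 := moment_quadratic (α := α) (A := A) (x ^ 2) (2 * x * y) 0 (y ^ 2) θ
    rw [zero_mul, add_zero] at h1
    rw [← h1]
    refine integral_congr_ae (Eventually.of_forall fun v => ?_)
    dsimp only
    ring
  rw [h, setIntegral_pos_iff_support_of_nonneg_ae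
    (Eventually.of_forall fun v => by positivity)
    (integrableOn_body (by fun_prop) θ)]
  -- On a nonempty open part of the body the linear form does not vanish, so its square has positive
  -- integral.
  set O : Set (Fin 2 → ℝ) := {v | x * v 0 + y * v 1 ≠ 0} ∩ Metric.ball 0 r
  have hO : IsOpen O :=
    (isOpen_ne_fun (by fun_prop) continuous_const).inter Metric.isOpen_ball
  have hne : O.Nonempty := by
    set c := r / (2 * (|x| + |y| + 1))
    have hc : 0 < c := by positivity
    have hs : 0 < x ^ 2 + y ^ 2 := by
      rcases hxy with h | h
      · have := pow_pos (abs_pos.2 h) 2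
        rw [sq_abs] at this
        positivity
      · have := pow_pos (abs_pos.2 h) 2
        rw [sq_abs] at this
        positivity
    refine ⟨![c * x, c * y], ?_, ?_⟩
    · have : x * (c * x) + y * (c * y) = c * (x ^ 2 + y ^ 2) := by ring
      simp only [Set.mem_ofPred_eq, Matrix.cons_val_zero, Matrix.cons_val_one, this]
      positivity
    · rw [mem_ball_zero_iff, pi_norm_lt_iff hr]
      have hcr : c * (|x| + |y| + 1) < r := by
        simp only [c]
        field_simp
        linarith
      have hx := mul_nonneg hc.le (abs_nonneg x)
      have hy := mul_nonneg hc.le (abs_nonneg y)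
      intro i
      fin_cases i <;> simp [abs_of_pos hc] <;> nlinarith
  refine (hO.measure_pos volume hne).trans_le (measure_mono fun v hv => ⟨?_, hball θ hv.2⟩)
  simpa using hv.1

end SmoothLoop

/-! ### Continuous conjugacy to rotations -/

/-- The rotation of angle `u`. -/
def rot (u : ℝ) : SL2 := ⟨!![Real.cos u, -Real.sin u; Real.sin u, Real.cos u], by
  rw [Matrix.det_fin_two_of]
  nlinarith [Real.sin_sq_add_cos_sq u]⟩

@[simp] theorem rot_zero_zero (u : ℝ) : (rot u).1 0 0 = Real.cos u := rfl
@[simp] theorem rot_zero_one (u : ℝ) : (rot u).1 0 1 = -Real.sin u := rfl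
@[simp] theorem rot_one_zero (u : ℝ) : (rot u).1 1 0 = Real.sin u := rfl
@[simp] theorem rot_one_one (u : ℝ) : (rot u).1 1 1 = Real.cos u := rfl

theorem SL2.ext' {x y : SL2} (h00 : x.1 0 0 = y.1 0 0) (h01 : x.1 0 1 = y.1 0 1)
    (h10 : x.1 1 0 = y.1 1 0) (h11 : x.1 1 1 = y.1 1 1) : x = y := by
  apply Subtype.ext
  ext i j
  fin_cases i <;> fin_cases j <;> assumption

theorem SL2.mul_apply (x y : SL2) (i j : Fin 2) :
    (x * y).1 i j = x.1 i 0 * y.1 0 j + x.1 i 1 * y.1 1 j := by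
  rw [Matrix.SpecialLinearGroup.coe_mul, Matrix.mul_apply, Fin.sum_univ_two]

theorem rot_add (u v : ℝ) : rot (u + v) = rot u * rot v := by
  apply SL2.ext' <;> simp only [SL2.mul_apply, rot_zero_zero, rot_zero_one, rot_one_zero,
    rot_one_one, Real.cos_add, Real.sin_add] <;> ring

theorem rot_zero : rot 0 = 1 := by
  apply SL2.ext' <;> simp

theorem rot_neg (u : ℝ) : rot (-u) = (rot u)⁻¹ := by
  rw [eq_inv_iff_mul_eq_one, ← rot_add, neg_add_cancel, rot_zero]

theorem rot_add_int_mul (u : ℝ) (n : ℤ) : rot (u + n * (2 * Real.pi)) = rot u := by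
  apply SL2.ext' <;> simp

theorem E_eq_rot (r : ℤ) (θ : ℝ) : (E r).toFun θ = rot (2 * Real.pi * r * θ) := rfl

namespace SmoothLoop

variable {α : ℝ} {A : SmoothLoop}

/-- Diagonal entry of the conjugacy that turns the second moments into a scalar matrix. -/
def cholDiag (α : ℝ) (A : SmoothLoop) (θ : ℝ) : ℝ :=
  √(√(secondMoment α A θ).det / secondMoment α A θ 0 0)

/-- Off-diagonal entry of the conjugacy that turns the second moments into a scalar matrix. -/
def cholOff (α : ℝ) (A : SmoothLoop) (θ : ℝ) : ℝ :=
  -secondMoment α A θ 0 1 / (secondMoment α A θ 0 0 * cholDiag α A θ)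

theorem secondMoment_det (θ : ℝ) : (secondMoment α A θ).det =
    secondMoment α A θ 0 0 * secondMoment α A θ 1 1 - secondMoment α A θ 0 1 ^ 2 := by
  rw [Matrix.det_fin_two, secondMoment_comm]
  ring

theorem secondMoment_det_add (θ : ℝ) :
    (secondMoment α A (θ + α)).det = (secondMoment α A θ).det := by
  rw [secondMoment_add, Matrix.det_mul, Matrix.det_mul, Matrix.det_transpose, (A.toFun θ).2]
  ring

theorem BoundedProds.secondMoment_pos (hA : A.BoundedProds α) (θ : ℝ) :
    0 < secondMoment α A θ 0 0 ∧ 0 < (secondMoment α A θ).det := by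
  have h1 : 0 < secondMoment α A θ 0 0 := by
    simpa using hA.quadForm_pos θ (x := 1) (y := 0) (by simp)
  refine ⟨h1, ?_⟩
  have h2 := hA.quadForm_pos θ (x := -secondMoment α A θ 0 1) (y := secondMoment α A θ 0 0)
    (Or.inr h1.ne')
  rw [secondMoment_det]
  refine pos_of_mul_pos_right (a := secondMoment α A θ 0 0) ?_ h1.le
  linarith

theorem BoundedProds.cholDiag_pos (hA : A.BoundedProds α) (θ : ℝ) : 0 < cholDiag α A θ := by
  obtain ⟨h1, h2⟩ := hA.secondMoment_pos θ
  exact Real.sqrt_pos.2 (div_pos (Real.sqrt_pos.2 h2) h1)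

/-- The matrix `[[x, 0], [y, x⁻¹]]`. -/
def lowerTri (x y : ℝ) (hx : x ≠ 0) : SL2 := ⟨!![x, 0; y, x⁻¹], by
  rw [Matrix.det_fin_two_of, mul_inv_cancel₀ hx]; ring⟩

/-- `h1` normalizes the first diagonal entry and `h2` makes the rows orthogonal for `P`; since `D ^
2` is the determinant of `P`, the last diagonal entry must be `D` too. -/
theorem lowerTri_conj {P : Mat} {x y D : ℝ} (hD : 0 < D) (hsym : P 1 0 = P 0 1) (hx : x ≠ 0)
    (h1 : x ^ 2 * P 0 0 = D) (h2 : y * (P 0 0 * x) = -P 0 1)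
    (h3 : D ^ 2 = P 0 0 * P 1 1 - P 0 1 ^ 2) :
    (lowerTri x y hx).1 * P * (lowerTri x y hx).1.transpose = D • (1 : Mat) := by
  obtain ⟨z, hz⟩ : ∃ z, z = x⁻¹ := ⟨_, rfl⟩
  have hxz : x * z = 1 := by rw [hz, mul_inv_cancel₀ hx]
  have h4 : P 0 0 * y + P 0 1 * z = 0 := by linear_combination z * h2 - P 0 0 * y * hxz
  have h5 : z * (P 0 1 * y + P 1 1 * z) = D := by
    refine mul_left_cancel₀ hD.ne' ?_
    linear_combination (-z * (P 0 1 * y + P 1 1 * z)) * h1 +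
      (x * P 0 0 * P 0 1 * y + P 0 0 * P 1 1 * (1 + x * z)) * hxz + P 0 1 * h2 - h3
  have e00 : (lowerTri x y hx).1 0 0 = x := rfl
  have e01 : (lowerTri x y hx).1 0 1 = 0 := rfl
  have e10 : (lowerTri x y hx).1 1 0 = y := rfl
  have e11 : (lowerTri x y hx).1 1 1 = z := hz.symm
  ext i j
  fin_cases i <;> fin_cases j <;>
    simp only [Fin.zero_eta, Fin.mk_one, Matrix.mul_apply, Fin.sum_univ_two,
      Matrix.transpose_apply, e00, e01, e10, e11, hsym, Matrix.smul_apply, smul_eq_mul,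
      Matrix.one_apply_eq, ne_eq, zero_ne_one, one_ne_zero, not_false_eq_true,
      Matrix.one_apply_ne]
  · linear_combination h1
  · linear_combination x * h4
  · linear_combination x * h4
  · linear_combination y * h4 + h5

/-- The matrix `C` preserves a scalar form, so `C Cᵀ = 1`; comparing `Cᵀ` with the explicit inverse
of an element of `SL(2,ℝ)` gives the shape of a rotation. -/
theorem orthogonal_of_conj {B B' a : SL2} {P P' : Mat} {c : ℝ} (hc : c ≠ 0)
    (hB : B.1 * P * B.1.transpose = c • (1 : Mat))
    (hB' : B'.1 * P' * B'.1.transpose = c • (1 : Mat))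
    (hP : P' = a.1 * P * a.1.transpose) :
    (B' * a * B⁻¹).1 1 1 = (B' * a * B⁻¹).1 0 0 ∧ (B' * a * B⁻¹).1 0 1 = -(B' * a * B⁻¹).1 1 0 := by
  set C := B' * a * B⁻¹ with hC
  have h1 : C.1 * B.1 = B'.1 * a.1 := by
    rw [← Matrix.SpecialLinearGroup.coe_mul, ← Matrix.SpecialLinearGroup.coe_mul, hC,
      inv_mul_cancel_right]
  have h2 : c • (C.1 * C.1.transpose) = c • (1 : Mat) := by
    calc c • (C.1 * C.1.transpose) = C.1 * (c • (1 : Mat)) * C.1.transpose := by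
          simp
      _ = (C.1 * B.1) * P * (C.1 * B.1).transpose := by
          rw [← hB, Matrix.transpose_mul]
          simp only [mul_assoc]
      _ = B'.1 * P' * B'.1.transpose := by
          rw [h1, hP, Matrix.transpose_mul]
          simp only [mul_assoc]
      _ = _ := hB'
  have h3 : C.1 * C.1.transpose = 1 := smul_right_injective _ hc h2
  have h4 : C.1.transpose = (C⁻¹).1 := by
    have h5 : (C⁻¹).1 * C.1 = 1 := by
      rw [← Matrix.SpecialLinearGroup.coe_mul, inv_mul_cancel, Matrix.SpecialLinearGroup.coe_one]
    calc C.1.transpose = ((C⁻¹).1 * C.1) * C.1.transpose := by rw [h5, one_mul]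
      _ = _ := by rw [mul_assoc, h3, mul_one]
  constructor
  · have := congrFun (congrFun h4 0) 0
    rw [SL2.inv_zero_zero] at this
    exact this.symm
  · have := congrFun (congrFun h4 1) 0
    rw [SL2.inv_one_zero] at this
    exact this

/-- A cocycle with bounded fibered products over an irrational rotation is conjugate to a
cocycle of rotations, by a continuous map with values in the lower triangular matrices. -/
theorem BoundedProds.exists_conj (hA : A.BoundedProds α) (hα : Irrational α) :
    ∃ (x y : ℝ → ℝ) (hx : ∀ θ, 0 < x θ), Continuous x ∧ Continuous y ∧
      Function.Periodic x 1 ∧ Function.Periodic y 1 ∧ ∀ θ, ∃ C : SL2,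
        C = lowerTri (x (θ + α)) (y (θ + α)) (hx _).ne' * A.toFun θ *
          (lowerTri (x θ) (y θ) (hx θ).ne')⁻¹ ∧ C.1 1 1 = C.1 0 0 ∧ C.1 0 1 = -C.1 1 0 := by
  have hpos := hA.secondMoment_pos
  have hd := hA.cholDiag_pos
  have c := fun i j => continuous_secondMoment (A := A) hα i j
  have cdet : Continuous fun θ => (secondMoment α A θ).det := by
    simp only [secondMoment_det]
    exact ((c 0 0).mul (c 1 1)).sub ((c 0 1).pow 2)
  have cd : Continuous (cholDiag α A) :=
    ((cdet.sqrt).div (c 0 0) fun θ => (hpos θ).1.ne').sqrt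
  refine ⟨cholDiag α A, cholOff α A, hd, cd,
    (c 0 1).neg.div ((c 0 0).mul cd) fun θ => (mul_pos (hpos θ).1 (hd θ)).ne',
    fun θ => by simp only [cholDiag, secondMoment_add_one],
    fun θ => by simp only [cholOff, cholDiag, secondMoment_add_one], fun θ => ⟨_, rfl, ?_⟩⟩
  have hB : ∀ θ, (lowerTri (cholDiag α A θ) (cholOff α A θ) (hd θ).ne').1 * secondMoment α A θ *
      (lowerTri (cholDiag α A θ) (cholOff α A θ) (hd θ).ne').1.transpose =
        √(secondMoment α A θ).det • (1 : Mat) := by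
    intro θ
    obtain ⟨hp, hD⟩ := hpos θ
    have hx := hd θ
    have hx2 : cholDiag α A θ ^ 2 * secondMoment α A θ 0 0 = √(secondMoment α A θ).det := by
      rw [cholDiag, Real.sq_sqrt (by positivity), div_mul_cancel₀ _ hp.ne']
    have hD2 : √(secondMoment α A θ).det ^ 2 = secondMoment α A θ 0 0 * secondMoment α A θ 1 1 -
        secondMoment α A θ 0 1 ^ 2 := by
      rw [Real.sq_sqrt hD.le, secondMoment_det]
    have hsym := secondMoment_comm (α := α) (A := A) θ
    have hy : cholOff α A θ * (secondMoment α A θ 0 0 * cholDiag α A θ) =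
        -secondMoment α A θ 0 1 := div_mul_cancel₀ _ (mul_pos hp hx).ne'
    exact lowerTri_conj (Real.sqrt_pos.2 hD) hsym hx.ne' hx2 hy hD2
  -- Both ends need the same scalar; the determinant of the second moments is invariant under the
  -- translation by `α`.
  refine orthogonal_of_conj (Real.sqrt_pos.2 (hpos θ).2).ne' (hB θ) ?_ (secondMoment_add θ)
  rw [hB, secondMoment_det_add]

end SmoothLoop

/-! ### Homotopy of loops in the punctured plane -/

/-- Two loops `ℝ/ℤ → ℂ` that differ by the exponential of a loop. -/
def LogEquiv (f g : ℝ → ℂ) : Prop :=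
  ∃ h : ℝ → ℂ, Continuous h ∧ Function.Periodic h 1 ∧ ∀ θ, f θ = g θ * Complex.exp (h θ)

theorem LogEquiv.symm {f g : ℝ → ℂ} (h : LogEquiv f g) : LogEquiv g f := by
  obtain ⟨h, hc, hp, hh⟩ := h
  refine ⟨fun θ => -h θ, hc.neg, fun θ => congrArg _ (hp θ), fun θ => ?_⟩
  rw [hh, mul_assoc, ← Complex.exp_add]
  simp

theorem LogEquiv.trans {f g k : ℝ → ℂ} (h : LogEquiv f g) (h' : LogEquiv g k) :
    LogEquiv f k := by
  obtain ⟨h, hc, hp, hh⟩ := h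
  obtain ⟨h', hc', hp', hh'⟩ := h'
  refine ⟨fun θ => h' θ + h θ, hc'.add hc, hp'.add hp, fun θ => ?_⟩
  rw [hh, hh', Complex.exp_add, mul_assoc]

/-- For nearby parameters the ratio of the loops stays near `1`, uniformly by compactness of a
period, so its principal logarithm is a continuous periodic function. Connectedness of the parameter
interval chains these local equivalences. -/
theorem logEquiv_of_homotopy {F : unitInterval × ℝ → ℂ} (hF : Continuous F)
    (hp : ∀ s θ, F (s, θ + 1) = F (s, θ)) (h0 : ∀ p, F p ≠ 0) (s s' : unitInterval) :
    LogEquiv (fun θ => F (s, θ)) (fun θ => F (s', θ)) := by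
  refine PreconnectedSpace.induction₂' (fun s s' => LogEquiv (fun θ => F (s, θ))
    (fun θ => F (s', θ))) (fun s => ?_) (⟨fun _ _ _ => LogEquiv.trans⟩) s s'
  have key : ∀ᶠ s' in 𝓝 s, ∀ θ ∈ Set.Icc (0 : ℝ) 1, F (s', θ) / F (s, θ) ∈ Complex.slitPlane := by
    refine (isCompact_Icc).eventually_forall_of_forall_eventually fun θ _ => ?_
    have hc : Continuous fun z : unitInterval × ℝ => F z / F (s, z.2) :=
      hF.div (hF.comp (by fun_prop)) fun z => h0 _
    refine hc.continuousAt.eventually (Complex.isOpen_slitPlane.mem_nhds ?_)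
    simp [div_self (h0 _)]
  filter_upwards [key] with s' hs'
  have hper : Function.Periodic (fun θ => F (s', θ) / F (s, θ)) 1 := fun θ => by
    simp only [hp]
  have hall : ∀ θ, F (s', θ) / F (s, θ) ∈ Complex.slitPlane := fun θ => by
    obtain ⟨y, hy, hxy⟩ := hper.exists_mem_Ico₀ one_pos θ
    have := hs' y ⟨hy.1, hy.2.le⟩
    rwa [← hxy] at this
  have h : LogEquiv (fun θ => F (s', θ)) (fun θ => F (s, θ)) := by
    refine ⟨fun θ => Complex.log (F (s', θ) / F (s, θ)), ?_, fun θ => by simp only [hp], fun θ => ?_⟩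
    · exact Continuous.clog ((hF.comp (by fun_prop)).div (hF.comp (by fun_prop)) fun z => h0 _) hall
    · rw [Complex.exp_log (div_ne_zero (h0 _) (h0 _)), mul_div_cancel₀ _ (h0 _)]
  exact ⟨h.symm, h⟩

/-- The first column of a matrix, as a complex number. -/
def col (x : SL2) : ℂ := ⟨x.1 0 0, x.1 1 0⟩

theorem col_ne_zero (x : SL2) : col x ≠ 0 := by
  intro h
  have h0 : x.1 0 0 = 0 := congrArg Complex.re h
  have h1 : x.1 1 0 = 0 := congrArg Complex.im h
  have := x.det_eq
  rw [h0, h1] at this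
  simp at this

theorem continuous_col : Continuous col := by
  have : col = fun x : SL2 => (x.1 0 0 : ℂ) + (x.1 1 0 : ℂ) * Complex.I := by
    funext x
    exact (Complex.mk_eq_add_mul_I _ _)
  rw [this]
  have h : ∀ i j, Continuous fun x : SL2 => x.1 i j := fun i j =>
    (continuous_subtype_val (p := fun M : Mat => M.det = 1)).matrix_elem i j
  exact (Complex.continuous_ofReal.comp (h 0 0)).add
    ((Complex.continuous_ofReal.comp (h 1 0)).mul continuous_const)

theorem SL2.continuous_of_entries {X : Type*} [TopologicalSpace X] {f : X → SL2}
    (h : ∀ i j, Continuous fun x => (f x).1 i j) : Continuous f :=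
  Continuous.subtype_mk (continuous_matrix h) _

theorem col_rot (u : ℝ) : col (rot u) = Complex.exp (u * Complex.I) := by
  apply Complex.ext
  · simp [col, Complex.exp_ofReal_mul_I_re]
  · simp [col, Complex.exp_ofReal_mul_I_im]

namespace SmoothLoop

variable {α : ℝ} {A : SmoothLoop}

/-- A cocycle of degree `d` with bounded fibered products over an irrational rotation is
continuously conjugate to the rotation of angle `2π d θ + φ(θ)`, `φ` periodic. -/
theorem BoundedProds.exists_conj_rot (hA : A.BoundedProds α) (hα : Irrational α) {d : ℤ}
    (hd : A.HasDegree d) :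
    ∃ (B : ℝ → SL2) (φ : ℝ → ℝ), Continuous B ∧ Function.Periodic B 1 ∧ Continuous φ ∧
      Function.Periodic φ 1 ∧
      ∀ θ, B (θ + α) * A.toFun θ * (B θ)⁻¹ = rot (2 * Real.pi * d * θ + φ θ) := by
  obtain ⟨x, y, hx, cx, cy, px, py, hC⟩ := hA.exists_conj hα
  -- Lower triangular matrices with positive diagonal contract to the identity, so conjugating by
  -- this path deforms `A` into its rotational form without changing the degree.
  set B : unitInterval × ℝ → SL2 := fun p =>
    lowerTri (p.1 * x p.2 + (1 - p.1)) (p.1 * y p.2) (by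
      have h0 := p.1.2.1
      have h1 := p.1.2.2
      rcases h0.eq_or_lt with h | h
      · rw [← h]; simp
      · have := mul_pos h (hx p.2)
        exact ne_of_gt (by linarith)) with hBdef
  have hBc : Continuous B := by
    have hxc : Continuous fun p : unitInterval × ℝ => (p.1 : ℝ) * x p.2 + (1 - p.1) := by fun_prop
    refine SL2.continuous_of_entries fun i j => ?_
    fin_cases i <;> fin_cases j
    · exact hxc
    · exact continuous_const
    · exact (continuous_subtype_val.comp continuous_fst).mul (cy.comp continuous_snd)
    · refine hxc.inv₀ fun p => ?_
      have h0 := p.1.2.1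
      have h1 := p.1.2.2
      rcases h0.eq_or_lt with h | h
      · rw [← h]; simp
      · have := mul_pos h (hx p.2)
        exact ne_of_gt (by linarith)
  have hBp : ∀ s θ, B (s, θ + 1) = B (s, θ) := fun s θ => by
    simp only [hBdef, px θ, py θ]
  have hAc : Continuous A.toFun := SL2.continuous_of_entries fun i j => (A.smooth i j).continuous
  have hB1 : ∀ θ, B (1, θ) = lowerTri (x θ) (y θ) (hx θ).ne' := fun θ => by
    simp [hBdef]
  have hB0 : ∀ θ, B (0, θ) = 1 := fun θ => by
    apply SL2.ext' <;> simp [hBdef, lowerTri]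
  set C : unitInterval × ℝ → SL2 := fun p => B (p.1, p.2 + α) * A.toFun p.2 * (B p)⁻¹ with hCdef
  have hCc : Continuous C :=
    ((hBc.comp (by fun_prop)).mul (hAc.comp continuous_snd)).mul hBc.inv
  have e1 := logEquiv_of_homotopy (F := fun p => col (C p)) (continuous_col.comp hCc)
    (fun s θ => by
      simp only [hCdef]
      rw [show θ + 1 + α = θ + α + 1 by ring, hBp, hBp, A.periodic θ]) (fun p => col_ne_zero _) 1 0
  obtain ⟨H, hHc, hHp, hH0, hH1⟩ := hd
  have e2 := logEquiv_of_homotopy (F := fun p => col (H p)) (continuous_col.comp hHc)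
    (fun s θ => by simp only [hHp]) (fun p => col_ne_zero _) 0 1
  have e3 : (fun θ => col (C (0, θ))) = fun θ => col (H (0, θ)) := by
    funext θ
    simp only [hCdef, hB0, hH0]
    simp
  simp only [e3] at e1
  obtain ⟨h, hhc, hhp, hh⟩ := e1.trans e2
  refine ⟨fun θ => B (1, θ), fun θ => (h θ).im, hBc.comp (by fun_prop), fun θ => hBp 1 θ,
    Complex.continuous_im.comp hhc, fun θ => congrArg Complex.im (hhp θ), fun θ => ?_⟩
  obtain ⟨C', hC', h11, h01⟩ := hC θ
  have hCC : C (1, θ) = C' := by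
    simp only [hCdef, hB1, hC']
  have hdet := C'.det_eq
  have hθ : col (C (1, θ)) = col (H (1, θ)) * Complex.exp (h θ) := hh θ
  rw [hCC, hH1, E_eq_rot, col_rot] at hθ
  have hnorm : ‖col C'‖ = 1 := by
    have : ‖col C'‖ ^ 2 = 1 := by
      rw [Complex.sq_norm, Complex.normSq_apply]
      simp only [col]
      rw [h11, h01] at hdet
      linarith
    nlinarith [norm_nonneg (col C')]
  -- The first column of a rotation has norm one, so the logarithm is purely imaginary and its
  -- imaginary part is the periodic angle `φ`.
  have hre : (h θ).re = 0 := by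
    rw [hθ, norm_mul, Complex.norm_exp_ofReal_mul_I, one_mul, Complex.norm_exp] at hnorm
    exact Real.exp_eq_one_iff _ |>.1 hnorm
  have hcol : col C' = col (rot (2 * Real.pi * d * θ + (h θ).im)) := by
    rw [hθ, col_rot, ← Complex.exp_add]
    congr 1
    apply Complex.ext <;> simp [hre]
  have hr0 : C'.1 0 0 = _ := congrArg Complex.re hcol
  have hr1 : C'.1 1 0 = _ := congrArg Complex.im hcol
  have : B (1, θ + α) * A.toFun θ * (B (1, θ))⁻¹ = C' := hCC
  refine this.trans ?_
  apply SL2.ext'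
  · exact hr0
  · rw [h01, hr1]; rfl
  · exact hr1
  · rw [h11, hr0]; rfl

end SmoothLoop

/-! ### Continued fractions -/

theorem alphaIter_succ (α : ℝ) (k : ℕ) :
    alphaIter α (k + 1) = (alphaIter α k)⁻¹ - ⌊(alphaIter α k)⁻¹⌋ := by
  rw [alphaIter, Function.iterate_succ_apply']
  rfl

/-- Taking the denominator for `k` and the numerator for `l` makes the left side of the Diophantine
inequality vanish. -/
theorem not_rat_of_mem_CD {g σ : ℝ} (hg : 0 < g) {q : ℚ} : (q : ℝ) ∉ CD g σ := by
  intro h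
  have h1 := h q.den (by exact_mod_cast q.den_nz) q.num
  have h2 : ((q.den : ℤ) : ℝ) * (q : ℝ) - q.num = 0 := by
    have : (q : ℝ) = q.num / q.den := by exact_mod_cast (Rat.num_div_den q).symm
    rw [this]
    have : (q.den : ℝ) ≠ 0 := by exact_mod_cast q.den_nz
    push_cast
    field_simp
    ring
  rw [h2, abs_zero] at h1
  have h3 : (0 : ℝ) < |((q.den : ℤ) : ℝ)| := abs_pos.2 (by exact_mod_cast q.den_nz)
  have : 0 < g⁻¹ / |((q.den : ℤ) : ℝ)| ^ σ := by positivity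
  linarith

section

variable {g σ α : ℝ}

theorem irrational_of_mem_SigmaSet (hg : 0 < g) (hα : α ∈ SigmaSet g σ) : Irrational α := by
  rintro ⟨q, hq⟩
  have key : ∀ k, ∃ q : ℚ, (q : ℝ) = alphaIter α k := by
    intro k
    induction k with
    | zero => exact ⟨q, hq⟩
    | succ k ih =>
      obtain ⟨p, hp⟩ := ih
      exact ⟨p⁻¹ - ⌊(alphaIter α k)⁻¹⌋, by rw [alphaIter_succ]; push_cast; rw [hp]⟩
  obtain ⟨k, -, hk⟩ := hα.2 0
  obtain ⟨p, hp⟩ := key k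
  have := hk.1.1
  rw [← hp] at this
  exact not_rat_of_mem_CD hg this

theorem alphaIter_mem_Ioo (hα : α ∈ SigmaSet g σ) (k : ℕ) : alphaIter α k ∈ Set.Ioo (0 : ℝ) 1 := by
  cases k with
  | zero => exact hα.1
  | succ k =>
    have h := alphaIter_ne_zero hα (k + 1)
    have h1 : alphaIter α (k + 1) = Int.fract (alphaIter α k)⁻¹ := by
      rw [alphaIter, Function.iterate_succ_apply']; rfl
    rw [h1] at h ⊢
    exact ⟨lt_of_le_of_ne (Int.fract_nonneg _) h.symm, Int.fract_lt_one _⟩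

theorem betaPred_succ (α : ℝ) (k : ℕ) :
    betaPred α (k + 1) = betaPred α k * alphaIter α k := Finset.prod_range_succ _ _

theorem betaPred_pos (hα : α ∈ SigmaSet g σ) (k : ℕ) : 0 < betaPred α k :=
  Finset.prod_pos fun j _ => (alphaIter_mem_Ioo hα j).1

theorem betaPred_le_one (hα : α ∈ SigmaSet g σ) (k : ℕ) : betaPred α k ≤ 1 :=
  Finset.prod_le_one (fun j _ => (alphaIter_mem_Ioo hα j).1.le)
    fun j _ => (alphaIter_mem_Ioo hα j).2.le

theorem betaPred_antitone (hα : α ∈ SigmaSet g σ) : Antitone (betaPred α) :=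
  antitone_nat_of_succ_le fun k => by
    rw [betaPred_succ]
    exact mul_le_of_le_one_right (betaPred_pos hα k).le (alphaIter_mem_Ioo hα k).2.le

theorem one_le_floor_inv (hα : α ∈ SigmaSet g σ) (k : ℕ) :
    (1 : ℝ) ≤ (⌊(alphaIter α k)⁻¹⌋ : ℝ) := by
  obtain ⟨h0, h1⟩ := alphaIter_mem_Ioo hα k
  have : (1 : ℤ) ≤ ⌊(alphaIter α k)⁻¹⌋ := Int.le_floor.2 (by
    push_cast
    exact (one_lt_inv₀ h0).2 h1 |>.le)
  exact_mod_cast this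

/-- The product equals `1 - α_k a_{k+1}`, at most `1 - α_k`, and it is also at most `α_k`. Two steps
therefore halve `betaPred`. -/
theorem alphaIter_mul_succ_le (hα : α ∈ SigmaSet g σ) (k : ℕ) :
    alphaIter α k * alphaIter α (k + 1) ≤ 1 / 2 := by
  obtain ⟨h0, h1⟩ := alphaIter_mem_Ioo hα k
  obtain ⟨h2, h3⟩ := alphaIter_mem_Ioo hα (k + 1)
  have ha := one_le_floor_inv hα k
  have hs := alphaIter_succ α k
  have h4 : alphaIter α k * (alphaIter α k)⁻¹ = 1 := mul_inv_cancel₀ h0.ne'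
  have h5 : alphaIter α k * alphaIter α (k + 1) =
      1 - alphaIter α k * ⌊(alphaIter α k)⁻¹⌋ := by
    rw [hs]; linear_combination h4
  nlinarith

theorem tendsto_betaPred (hα : α ∈ SigmaSet g σ) :
    Tendsto (betaPred α) atTop (𝓝 0) := by
  have h2 : ∀ n, betaPred α (2 * n) ≤ (1 / 2) ^ n := by
    intro n
    induction n with
    | zero => simp [betaPred]
    | succ n ih =>
      rw [show 2 * (n + 1) = 2 * n + 1 + 1 by ring, betaPred_succ, betaPred_succ, mul_assoc,
        pow_succ]
      exact mul_le_mul ih (alphaIter_mul_succ_le hα _)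
        (mul_pos (alphaIter_mem_Ioo hα _).1 (alphaIter_mem_Ioo hα _).1).le (by positivity)
  rw [Metric.tendsto_atTop]
  intro ε hε
  obtain ⟨n, hn⟩ := exists_pow_lt_of_lt_one hε (show (1 / 2 : ℝ) < 1 by norm_num)
  refine ⟨2 * n, fun k hk => ?_⟩
  rw [Real.dist_eq, sub_zero, abs_of_pos (betaPred_pos hα k)]
  exact ((betaPred_antitone hα hk).trans (h2 n)).trans_lt hn

/-- The first vector of the `k`-th continued fraction basis. -/
def cfFst (α : ℝ) (k : ℕ) : ℤ × ℤ := cfBasis α k (1, 0)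

/-- The second vector of the `k`-th continued fraction basis. -/
def cfSnd (α : ℝ) (k : ℕ) : ℤ × ℤ := cfBasis α k (0, 1)

theorem cfFst_succ (α : ℝ) (k : ℕ) : cfFst α (k + 1) = cfSnd α k := by
  simp [cfFst, cfSnd, cfBasis, gaussStep]

theorem cfSnd_succ (α : ℝ) (k : ℕ) :
    cfSnd α (k + 1) = cfFst α k - ⌊(alphaIter α k)⁻¹⌋ • cfSnd α k := by
  rw [cfFst, cfSnd, cfSnd, ← map_zsmul, ← map_sub]
  simp [cfBasis, gaussStep]

/-- The basis vectors translate by `β_{k-1}` and `β_k`, so after dilatation the generators have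
frequencies `1` and `α_k`. -/
theorem cf_freq (hα : α ∈ SigmaSet g σ) (k : ℕ) :
    ((cfFst α k).1 + (cfFst α k).2 * α : ℝ) = betaPred α k ∧
      ((cfSnd α k).1 + (cfSnd α k).2 * α : ℝ) = betaPred α k * alphaIter α k := by
  induction k with
  | zero => simp [cfFst, cfSnd, cfBasis, betaPred, alphaIter]
  | succ k ih =>
    obtain ⟨h1, h2⟩ := ih
    rw [cfFst_succ, cfSnd_succ, betaPred_succ]
    refine ⟨h2, ?_⟩
    simp only [Prod.fst_sub, Prod.snd_sub, Prod.smul_fst, Prod.smul_snd, smul_eq_mul,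
      Int.cast_sub, Int.cast_mul]
    rw [alphaIter_succ]
    have h4 : alphaIter α k * (alphaIter α k)⁻¹ = 1 :=
      mul_inv_cancel₀ (alphaIter_ne_zero hα k)
    linear_combination h1 - ⌊(alphaIter α k)⁻¹⌋ * h2 - betaPred α k * h4

/-- Each change of basis has determinant `-1`. This is the origin of the sign in `r_k = (-1)^k d`.
-/
theorem cf_det (α : ℝ) (k : ℕ) :
    (cfFst α k).1 * (cfSnd α k).2 - (cfSnd α k).1 * (cfFst α k).2 = (-1) ^ k := by
  induction k with
  | zero => simp [cfFst, cfSnd, cfBasis]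
  | succ k ih =>
    rw [cfFst_succ, cfSnd_succ, pow_succ, ← ih]
    simp only [Prod.fst_sub, Prod.snd_sub, Prod.smul_fst, Prod.smul_snd, smul_eq_mul]
    ring

/-- The second coordinates are, up to sign, the denominators of consecutive convergents. Their signs
alternate, so no cancellation occurs in the recursion, and the last identity is the classical `q_k
β_{k-1} + q_{k-1} β_k = 1`. It yields the bound on (iteration time) × (scale) required by
`SmoothLoop.BoundedProds.mbdd`. -/
theorem cf_bounds (hα : α ∈ SigmaSet g σ) (k : ℕ) :
    ((cfFst α k).2 : ℝ) * (cfSnd α k).2 ≤ 0 ∧ |((cfFst α k).2 : ℝ)| ≤ |((cfSnd α k).2 : ℝ)| ∧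
      |((cfSnd α k).2 : ℝ)| * betaPred α k + |((cfFst α k).2 : ℝ)| * betaPred α (k + 1) = 1 := by
  induction k with
  | zero => simp [cfFst, cfSnd, cfBasis, betaPred]
  | succ k ih =>
    obtain ⟨h1, h2, h3⟩ := ih
    have ha := one_le_floor_inv hα k
    have hs := alphaIter_succ α k
    have h4 : alphaIter α k * (alphaIter α k)⁻¹ = 1 :=
      mul_inv_cancel₀ (alphaIter_ne_zero hα k)
    rw [cfFst_succ, cfSnd_succ, betaPred_succ α (k + 1), betaPred_succ α k, hs]
    rw [betaPred_succ α k] at h3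
    simp only [Prod.snd_sub, Prod.smul_snd, smul_eq_mul, Int.cast_sub, Int.cast_mul]
    generalize ((cfFst α k).2 : ℝ) = x at *
    generalize ((cfSnd α k).2 : ℝ) = y at *
    generalize (⌊(alphaIter α k)⁻¹⌋ : ℝ) = a at *
    have habs : |x - a * y| = |x| + a * |y| := by
      rcases le_total 0 y with hy | hy
      · rcases hy.eq_or_lt with rfl | hy'
        · simp
        · have hx : x ≤ 0 := by nlinarith
          rw [abs_of_nonpos hx, abs_of_nonneg hy, abs_of_nonpos (by nlinarith)]
          ring
      · rcases hy.eq_or_lt with rfl | hy'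
        · simp
        · have hx : 0 ≤ x := by nlinarith
          rw [abs_of_nonneg hx, abs_of_nonpos hy, abs_of_nonneg (by nlinarith)]
          ring
    refine ⟨by nlinarith [sq_nonneg y], ?_, ?_⟩
    · rw [habs]
      nlinarith [abs_nonneg x, abs_nonneg y]
    · rw [habs]
      linear_combination h3 + |y| * betaPred α k * h4

theorem cfSnd_bound (hα : α ∈ SigmaSet g σ) (k : ℕ) :
    |betaPred α k| * |((cfSnd α k).2 : ℝ)| ≤ 1 := by
  obtain ⟨-, -, h⟩ := cf_bounds hα k
  have := mul_nonneg (abs_nonneg ((cfFst α k).2 : ℝ)) (betaPred_pos hα (k + 1)).le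
  rw [abs_of_pos (betaPred_pos hα k)]
  linarith

theorem cfFst_bound (hα : α ∈ SigmaSet g σ) (k : ℕ) :
    |betaPred α k| * |((cfFst α k).2 : ℝ)| ≤ 1 :=
  (mul_le_mul_of_nonneg_left (cf_bounds hα k).2.1 (abs_nonneg _)).trans (cfSnd_bound hα k)

end

/-! ### The renormalized actions -/

theorem unitShift_zpow (n : ℤ) : (unitShift ^ n).freq = n ∧ ∀ t, (unitShift ^ n).fib t = 1 := by
  induction n with
  | zero => simp
  | succ n ih =>
    rw [zpow_add_one]
    refine ⟨?_, fun t => ?_⟩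
    · rw [FiberedMap.freq_mul, ih.1]
      simp [unitShift]
    · rw [FiberedMap.fib_mul, ih.2]
      simp [unitShift]
  | pred n ih =>
    rw [zpow_sub_one]
    refine ⟨?_, fun t => ?_⟩
    · rw [FiberedMap.freq_mul, ih.1]
      simp only [unitShift, FiberedMap.freq_inv]
      push_cast
      ring
    · rw [FiberedMap.fib_mul, ih.2]
      simp [unitShift]

theorem SmoothLoop.action_apply (α : ℝ) (A : SmoothLoop) (v : ℤ × ℤ) :
    (A.action α (Multiplicative.ofAdd v)).freq = v.1 + v.2 * α ∧
      (A.action α (Multiplicative.ofAdd v)).fib = A.fiberedProd α v.2 := by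
  have h : A.action α (Multiplicative.ofAdd v) = unitShift ^ v.1 * A.cocycle α ^ v.2 := rfl
  rw [h]
  refine ⟨?_, ?_⟩
  · rw [FiberedMap.freq_mul, (unitShift_zpow v.1).1, SmoothLoop.freq_pow]
  · funext t
    rw [FiberedMap.fib_mul, (unitShift_zpow v.1).2, one_mul]
    rfl

/-- An action is conjugate to the action of a cocycle as soon as its generators are. -/
theorem FiberedAction.fConj_of_generators {𝒜 : FiberedAction} {W : ℝ → SL2} (hW : Smooth W)
    {a : ℝ} {U : SmoothLoop}
    (f1 : (𝒜 (Multiplicative.ofAdd (1, 0))).freq = 1)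
    (f2 : (𝒜 (Multiplicative.ofAdd (0, 1))).freq = a)
    (h1 : ∀ t, W (t + 1) * (𝒜 (Multiplicative.ofAdd (1, 0))).fib t = W t)
    (h2 : ∀ t, U.toFun t = W (t + a) * (𝒜 (Multiplicative.ofAdd (0, 1))).fib t * (W t)⁻¹) :
    𝒜.FConj (U.action a) := by
  refine ⟨W, hW, fun v => ?_⟩
  set x := FiberedMap.vert W hW
  have e1 : x * 𝒜 (Multiplicative.ofAdd (1, 0)) * x⁻¹ = unitShift := by
    ext1
    · simp [x, FiberedMap.vert, f1, unitShift]
    · funext t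
      simp [x, FiberedMap.vert, f1, h1, unitShift]
  have e2 : x * 𝒜 (Multiplicative.ofAdd (0, 1)) * x⁻¹ = U.cocycle a := by
    ext1
    · simp [x, FiberedMap.vert, f2, SmoothLoop.cocycle]
    · funext t
      simp [x, FiberedMap.vert, f2, h2, SmoothLoop.cocycle]
  have hv : v = Multiplicative.ofAdd ((1, 0) : ℤ × ℤ) ^ (Multiplicative.toAdd v).1 *
      Multiplicative.ofAdd ((0, 1) : ℤ × ℤ) ^ (Multiplicative.toAdd v).2 := by
    rw [← ofAdd_zsmul, ← ofAdd_zsmul, ← ofAdd_add]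
    apply Multiplicative.toAdd.injective
    ext <;> simp
  have h3 : U.action a v = unitShift ^ (Multiplicative.toAdd v).1 *
    U.cocycle a ^ (Multiplicative.toAdd v).2 := rfl
  rw [h3, ← e1, ← e2]
  conv_rhs => rw [hv]
  rw [conj_zpow, conj_zpow, map_mul, map_zpow, map_zpow]
  group

/-- The renormalized action. -/
abbrev renorm {g σ α : ℝ} (hα : α ∈ SigmaSet g σ) (A : SmoothLoop) (k : ℕ) : FiberedAction :=
  FiberedAction.dilate (betaPred α k) (betaPred_ne_zero hα k)
    (FiberedAction.translate 0 (FiberedAction.baseChange (cfBasis α k) (A.action α)))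

theorem renorm_fst {g σ α : ℝ} (hα : α ∈ SigmaSet g σ) (A : SmoothLoop) (k : ℕ) :
    (renorm hα A k (Multiplicative.ofAdd (1, 0))).freq = 1 ∧
      ∀ t, (renorm hα A k (Multiplicative.ofAdd (1, 0))).fib t =
        A.fiberedProd α (cfFst α k).2 (betaPred α k * t) := by
  obtain ⟨h1, h2⟩ := A.action_apply α (cfFst α k)
  constructor
  · have : (renorm hα A k (Multiplicative.ofAdd (1, 0))).freq =
        (betaPred α k)⁻¹ * (A.action α (Multiplicative.ofAdd (cfFst α k))).freq := rfl
    rw [this, h1, (cf_freq hα k).1, inv_mul_cancel₀ (betaPred_ne_zero hα k)]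
  · intro t
    have : (renorm hα A k (Multiplicative.ofAdd (1, 0))).fib t =
        (A.action α (Multiplicative.ofAdd (cfFst α k))).fib (betaPred α k * t - 0) := rfl
    rw [this, h2, sub_zero]

theorem renorm_snd {g σ α : ℝ} (hα : α ∈ SigmaSet g σ) (A : SmoothLoop) (k : ℕ) :
    (renorm hα A k (Multiplicative.ofAdd (0, 1))).freq = alphaIter α k ∧
      ∀ t, (renorm hα A k (Multiplicative.ofAdd (0, 1))).fib t =
        A.fiberedProd α (cfSnd α k).2 (betaPred α k * t) := by
  obtain ⟨h1, h2⟩ := A.action_apply α (cfSnd α k)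
  constructor
  · have : (renorm hα A k (Multiplicative.ofAdd (0, 1))).freq =
        (betaPred α k)⁻¹ * (A.action α (Multiplicative.ofAdd (cfSnd α k))).freq := rfl
    rw [this, h1, (cf_freq hα k).2, inv_mul_cancel_left₀ (betaPred_ne_zero hα k)]
  · intro t
    have : (renorm hα A k (Multiplicative.ofAdd (0, 1))).fib t =
        (A.action α (Multiplicative.ofAdd (cfSnd α k))).fib (betaPred α k * t - 0) := rfl
    rw [this, h2, sub_zero]

theorem renorm_commute {g σ α : ℝ} (hα : α ∈ SigmaSet g σ) (A : SmoothLoop) (k : ℕ) (t : ℝ) :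
    A.fiberedProd α (cfSnd α k).2 (betaPred α k * (t + 1)) *
        A.fiberedProd α (cfFst α k).2 (betaPred α k * t) =
      A.fiberedProd α (cfFst α k).2 (betaPred α k * (t + alphaIter α k)) *
        A.fiberedProd α (cfSnd α k).2 (betaPred α k * t) := by
  obtain ⟨h1, h2⟩ := renorm_fst hα A k
  obtain ⟨h3, h4⟩ := renorm_snd hα A k
  have h : renorm hα A k (Multiplicative.ofAdd (0, 1)) *
      renorm hα A k (Multiplicative.ofAdd (1, 0)) = renorm hα A k (Multiplicative.ofAdd (1, 0)) *
        renorm hα A k (Multiplicative.ofAdd (0, 1)) := by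
    rw [← map_mul, mul_comm, map_mul]
  have := congrArg (fun x => x.fib t) h
  simpa only [FiberedMap.fib_mul, h1, h2, h3, h4] using this

/-! ### Birkhoff sums -/

/-- The Birkhoff sums of `φ` over the translation by `α`, for integer times. -/
def birkhoff (α : ℝ) (φ : ℝ → ℝ) : ℤ → ℝ → ℝ
  | Int.ofNat n, θ => ∑ j ∈ Finset.range n, φ (θ + j * α)
  | Int.negSucc n, θ => -∑ j ∈ Finset.range (n + 1), φ (θ - (j + 1) * α)

theorem birkhoff_add_one (α : ℝ) (φ : ℝ → ℝ) (m : ℤ) (θ : ℝ) :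
    birkhoff α φ (m + 1) θ = birkhoff α φ m θ + φ (θ + m * α) := by
  match m with
  | Int.ofNat n => exact Finset.sum_range_succ _ _
  | Int.negSucc 0 =>
    simp only [birkhoff, zero_add, Finset.sum_range_one, Int.cast_negSucc,
      show Int.negSucc 0 + 1 = Int.ofNat 0 from rfl, Finset.sum_range_zero]
    rw [show θ + -((0 + 1 : ℕ) : ℝ) * α = θ - ((0 : ℕ) + 1) * α by push_cast; ring]
    ring
  | Int.negSucc (n + 1) =>
    have : Int.negSucc (n + 1) + 1 = Int.negSucc n := rfl
    rw [this]
    simp only [birkhoff, Int.cast_negSucc]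
    rw [Finset.sum_range_succ _ (n + 1)]
    rw [show θ + -((n + 1 + 1 : ℕ) : ℝ) * α = θ - ((n + 1 : ℕ) + 1) * α by push_cast; ring]
    ring

theorem birkhoff_zero (α : ℝ) (φ : ℝ → ℝ) (θ : ℝ) : birkhoff α φ 0 θ = 0 :=
  Finset.sum_range_zero _

theorem birkhoff_add (α : ℝ) (φ : ℝ → ℝ) (m n : ℤ) (θ : ℝ) :
    birkhoff α φ (m + n) θ = birkhoff α φ m (θ + n * α) + birkhoff α φ n θ := by
  induction m with
  | zero => rw [zero_add, birkhoff_zero, zero_add]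
  | succ m ih =>
    rw [show (m : ℤ) + 1 + n = m + n + 1 by ring, birkhoff_add_one, birkhoff_add_one, ih]
    rw [show θ + ((m + n : ℤ) : ℝ) * α = θ + n * α + (m : ℤ) * α by push_cast; ring]
    ring
  | pred m ih =>
    have h1 := birkhoff_add_one α φ (-m - 1 + n) θ
    have h2 := birkhoff_add_one α φ (-m - 1) (θ + n * α)
    rw [show -(m : ℤ) - 1 + n + 1 = -m + n by ring, ih] at h1
    rw [sub_add_cancel] at h2
    rw [show θ + ((-m - 1 + n : ℤ) : ℝ) * α = θ + n * α + ((-m - 1 : ℤ) : ℝ) * α by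
      push_cast; ring] at h1
    linarith

theorem continuous_birkhoff (α : ℝ) {φ : ℝ → ℝ} (hφ : Continuous φ) (m : ℤ) :
    Continuous (birkhoff α φ m) := by
  match m with
  | Int.ofNat n => exact continuous_finsetSum _ fun j _ => by fun_prop
  | Int.negSucc n => exact (continuous_finsetSum _ fun j _ => by fun_prop).neg

theorem birkhoff_periodic (α : ℝ) {φ : ℝ → ℝ} (hφ : Function.Periodic φ 1) (m n : ℤ) (θ : ℝ) :
    birkhoff α φ m (θ + n) = birkhoff α φ m θ := by
  have h : ∀ x, φ (x + n) = φ x := fun x => by simpa using hφ.int_mul n x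
  match m with
  | Int.ofNat k =>
    refine Finset.sum_congr rfl fun j _ => ?_
    rw [← h (θ + j * α)]
    ring_nf
  | Int.negSucc k =>
    refine congrArg Neg.neg (Finset.sum_congr rfl fun j _ => ?_)
    rw [← h (θ - (j + 1) * α)]
    ring_nf

/-- The rotation angle of the fibered products, in rotation coordinates. -/
def angleSum (α : ℝ) (φ : ℝ → ℝ) (d m : ℤ) (θ : ℝ) : ℝ :=
  2 * Real.pi * d * (m * θ + α * (m * (m - 1) / 2)) + birkhoff α φ m θ

/-- Rotations commute, so the angles add along the orbit; summing `2π d (θ + j α)` produces the term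
`m (m - 1) / 2` of `angleSum`. -/
theorem conj_fiberedProd {α : ℝ} {A : SmoothLoop} {B : ℝ → SL2} {φ : ℝ → ℝ} {d : ℤ}
    (h : ∀ θ, B (θ + α) * A.toFun θ * (B θ)⁻¹ = rot (2 * Real.pi * d * θ + φ θ)) (m : ℤ) (θ : ℝ) :
    B (θ + m * α) * A.fiberedProd α m θ * (B θ)⁻¹ = rot (angleSum α φ d m θ) := by
  have hstep : ∀ m : ℤ, B (θ + (m + 1 : ℤ) * α) * A.fiberedProd α (m + 1) θ * (B θ)⁻¹ =
      rot (2 * Real.pi * d * (θ + m * α) + φ (θ + m * α)) *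
        (B (θ + m * α) * A.fiberedProd α m θ * (B θ)⁻¹) := fun m => by
    rw [← h, add_comm m 1, SmoothLoop.fiberedProd_add, SmoothLoop.fiberedProd_one]
    rw [show θ + ((1 + m : ℤ) : ℝ) * α = θ + m * α + α by push_cast; ring]
    group
  have hsum : ∀ m : ℤ, angleSum α φ d (m + 1) θ =
      2 * Real.pi * d * (θ + m * α) + φ (θ + m * α) + angleSum α φ d m θ := fun m => by
    simp only [angleSum, birkhoff_add_one]
    push_cast
    ring
  induction m with
  | zero =>
    have : angleSum α φ d 0 θ = 0 := by
      simp [angleSum, birkhoff_zero]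
    rw [this, rot_zero, SmoothLoop.fiberedProd_zero]
    simp
  | succ m ih => rw [hstep, ih, ← rot_add, hsum]
  | pred m ih =>
    have h1 := hstep (-m - 1)
    have h2 := hsum (-m - 1)
    rw [sub_add_cancel] at h1 h2
    rw [ih, h2, rot_add] at h1
    exact (mul_left_cancel h1).symm

/-- The renormalized action in rotation coordinates. -/
theorem exists_renorm_angles {g σ α : ℝ} (hα : α ∈ SigmaSet g σ) {A : SmoothLoop} {B : ℝ → SL2}
    {φ : ℝ → ℝ} {d : ℤ} (hBp : Function.Periodic B 1)
    (hφ : Continuous φ) (hφp : Function.Periodic φ 1)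
    (h : ∀ θ, B (θ + α) * A.toFun θ * (B θ)⁻¹ = rot (2 * Real.pi * d * θ + φ θ)) (k : ℕ) :
    ∃ w₁ w₂ : ℝ → ℝ, Continuous w₁ ∧ Continuous w₂ ∧
      (∀ t, B (betaPred α k * (t + 1)) * A.fiberedProd α (cfFst α k).2 (betaPred α k * t) *
        (B (betaPred α k * t))⁻¹ = rot (w₁ t)) ∧
      (∀ t, B (betaPred α k * (t + alphaIter α k)) *
        A.fiberedProd α (cfSnd α k).2 (betaPred α k * t) * (B (betaPred α k * t))⁻¹ =
          rot (w₂ t)) ∧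
      ∀ t, w₂ (t + 1) - w₂ t - (w₁ (t + alphaIter α k) - w₁ t) =
        2 * Real.pi * ((-1) ^ k * d : ℤ) := by
  obtain ⟨hf1, hf2⟩ := cf_freq hα k
  have hdet := cf_det α k
  have hc : ∀ m, Continuous (angleSum α φ d m) := fun m => by
    have := continuous_birkhoff α hφ m
    unfold angleSum
    fun_prop
  have hBn : ∀ (n : ℤ) x, B (x + n) = B x := fun n x => by simpa using hBp.int_mul n x
  refine ⟨fun t => angleSum α φ d (cfFst α k).2 (betaPred α k * t),
    fun t => angleSum α φ d (cfSnd α k).2 (betaPred α k * t), (hc _).comp (by fun_prop),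
    (hc _).comp (by fun_prop), fun t => ?_, fun t => ?_, fun t => ?_⟩
  · rw [← conj_fiberedProd h, ← hBn (cfFst α k).1 (betaPred α k * t + _)]
    congr 3
    rw [← hf1]; ring
  · rw [← conj_fiberedProd h, ← hBn (cfSnd α k).1 (betaPred α k * t + _)]
    congr 3
    rw [mul_add, ← hf2]; ring
  -- The Birkhoff sums cancel by additivity and periodicity. The linear parts leave `2π d` times the
  -- determinant of the basis.
  · simp only [angleSum]
    set θ := betaPred α k * t
    have e1 : betaPred α k * (t + 1) = θ + (cfFst α k).2 * α + (cfFst α k).1 := by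
      simp only [θ]; linear_combination -hf1
    have e2 : betaPred α k * (t + alphaIter α k) = θ + (cfSnd α k).2 * α + (cfSnd α k).1 := by
      simp only [θ]; linear_combination -hf2
    rw [e1, e2, birkhoff_periodic α hφp, birkhoff_periodic α hφp]
    have b1 := birkhoff_add α φ (cfSnd α k).2 (cfFst α k).2 θ
    have b2 := birkhoff_add α φ (cfFst α k).2 (cfSnd α k).2 θ
    rw [add_comm (cfFst α k).2] at b2
    have hdet' : ((cfFst α k).1 * (cfSnd α k).2 - (cfSnd α k).1 * (cfFst α k).2 : ℝ) =
        ((-1) ^ k : ℤ) := by rw [← hdet]; push_cast; ring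
    push_cast at hdet' ⊢
    linear_combination b2 - b1 + 2 * Real.pi * d * hdet'

/-! ### Smooth angle of the first column -/

/-- The matrix is upper triangular with positive diagonal. -/
def IsPosUpper (x : SL2) : Prop := 0 < x.1 0 0 ∧ x.1 1 0 = 0

/-- The derivative of the angle of the first column. -/
def angularSpeed (F : ℝ → SL2) (t : ℝ) : ℝ :=
  ((F t).1 0 0 * deriv (fun t => (F t).1 1 0) t - (F t).1 1 0 * deriv (fun t => (F t).1 0 0) t) *
    ((F t).1 0 0 ^ 2 + (F t).1 1 0 ^ 2)⁻¹

theorem SL2.col_sq_pos (x : SL2) : 0 < x.1 0 0 ^ 2 + x.1 1 0 ^ 2 := by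
  have h := x.det_eq
  by_contra hn
  have h0 : x.1 0 0 = 0 := by nlinarith [sq_nonneg (x.1 0 0), sq_nonneg (x.1 1 0)]
  have h1 : x.1 1 0 = 0 := by nlinarith [sq_nonneg (x.1 0 0), sq_nonneg (x.1 1 0)]
  rw [h0, h1] at h
  simp at h

theorem contDiff_angularSpeed {F : ℝ → SL2} (hF : Smooth F) : ContDiff ℝ ∞ (angularSpeed F) :=
  (((hF 0 0).mul (contDiff_deriv (hF 1 0))).sub ((hF 1 0).mul (contDiff_deriv (hF 0 0)))).mul
    ((((hF 0 0).pow 2).add ((hF 1 0).pow 2)).inv fun _ => (SL2.col_sq_pos _).ne')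

/-- The angle is the integral of the angular speed, started at the argument of the column at `0`.
With `r` the norm of the column, its coordinates `p` and `q` in the frame rotated by `η` satisfy `(p
/ r)' = (q / r)' = 0`, so they keep their initial values `1` and `0`. -/
theorem exists_angle {F : ℝ → SL2} (hF : Smooth F) :
    ∃ η : ℝ → ℝ, ContDiff ℝ ∞ η ∧ |η 0| ≤ Real.pi ∧ (∀ t, deriv η t = angularSpeed F t) ∧
      ∀ t, IsPosUpper (rot (-η t) * F t) := by
  have hs := contDiff_angularSpeed hF
  set c : ℂ := col (F 0)
  set η : ℝ → ℝ := fun t => Complex.arg c + ∫ s in (0 : ℝ)..t, angularSpeed F s with hη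
  have hd : ∀ t, HasDerivAt η (angularSpeed F t) t := fun t =>
    ((hs.continuous.integral_hasStrictDerivAt 0 t).hasDerivAt).const_add _
  have hη0 : η 0 = Complex.arg c := by simp [hη]
  have hηs : ContDiff ℝ ∞ η := contDiff_infty_iff_deriv.2
    ⟨fun t => (hd t).differentiableAt, by rw [funext fun t => (hd t).deriv]; exact hs⟩
  refine ⟨η, hηs, by rw [hη0]; exact Complex.abs_arg_le_pi _, fun t => (hd t).deriv, ?_⟩
  set x := fun t => (F t).1 0 0 with hx
  set y := fun t => (F t).1 1 0 with hy
  have hdx : ∀ t, HasDerivAt x (deriv x t) t := fun t => (hF.differentiableAt t 0 0).hasDerivAt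
  have hdy : ∀ t, HasDerivAt y (deriv y t) t := fun t => (hF.differentiableAt t 1 0).hasDerivAt
  have hN : ∀ t, 0 < x t ^ 2 + y t ^ 2 := fun t => SL2.col_sq_pos _
  set r := fun t => √(x t ^ 2 + y t ^ 2) with hr
  have hr0 : ∀ t, 0 < r t := fun t => Real.sqrt_pos.2 (hN t)
  have hr2 : ∀ t, r t ^ 2 = x t ^ 2 + y t ^ 2 := fun t => Real.sq_sqrt (hN t).le
  have hdr : ∀ t, HasDerivAt r ((x t * deriv x t + y t * deriv y t) / r t) t := fun t => by
    have h := (((hdx t).pow 2).add ((hdy t).pow 2)).sqrt (hN t).ne'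
    refine h.congr_deriv ?_
    have := (hr0 t).ne'
    rw [show √((x ^ 2 + y ^ 2) t) = r t from rfl]
    push_cast
    field_simp
  have hω : ∀ t, angularSpeed F t * r t ^ 2 = x t * deriv y t - y t * deriv x t := fun t => by
    rw [hr2]
    exact inv_mul_cancel_right₀ (hN t).ne' _
  set p := fun t => x t * Real.cos (η t) + y t * Real.sin (η t) with hp
  set q := fun t => -x t * Real.sin (η t) + y t * Real.cos (η t) with hq
  have hdp : ∀ t, HasDerivAt (fun t => p t / r t) 0 t := fun t => by
    have h := (((hdx t).mul (hd t).cos).add ((hdy t).mul (hd t).sin)).div (hdr t) (hr0 t).ne'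
    refine h.congr_deriv ?_
    have h1 := (hr0 t).ne'
    have h2 := hω t
    have h3 := hr2 t
    simp only [Pi.add_apply, Pi.mul_apply]
    generalize r t = R at *
    generalize angularSpeed F t = W at *
    field_simp
    linear_combination (Real.sin (η t) * x t - Real.cos (η t) * y t) * h2 * (-1) +
      (Real.cos (η t) * deriv x t + Real.sin (η t) * deriv y t) * h3
  have hdq : ∀ t, HasDerivAt (fun t => q t / r t) 0 t := fun t => by
    have h := (((hdx t).neg.mul (hd t).sin).add ((hdy t).mul (hd t).cos)).div (hdr t) (hr0 t).ne'
    refine h.congr_deriv ?_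
    have h1 := (hr0 t).ne'
    have h2 := hω t
    have h3 := hr2 t
    simp only [Pi.add_apply, Pi.mul_apply, Pi.neg_apply]
    generalize r t = R at *
    generalize angularSpeed F t = W at *
    field_simp
    linear_combination (Real.cos (η t) * x t + Real.sin (η t) * y t) * h2 * (-1) +
      (-Real.sin (η t) * deriv x t + Real.cos (η t) * deriv y t) * h3
  have hx0 : x 0 = r 0 * Real.cos (η 0) ∧ y 0 = r 0 * Real.sin (η 0) := by
    have hc : ‖c‖ = r 0 := by
      rw [Complex.norm_def, Complex.normSq_apply]
      simp only [hr, sq]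
      rfl
    rw [hη0, ← hc, Complex.norm_mul_cos_arg, Complex.norm_mul_sin_arg]
    exact ⟨rfl, rfl⟩
  have hcs := Real.sin_sq_add_cos_sq (η 0)
  intro t
  have h1 : p t / r t = p 0 / r 0 :=
    is_const_of_deriv_eq_zero (fun t => (hdp t).differentiableAt) (fun t => (hdp t).deriv) t 0
  have h2 : q t / r t = q 0 / r 0 :=
    is_const_of_deriv_eq_zero (fun t => (hdq t).differentiableAt) (fun t => (hdq t).deriv) t 0
  have h3 : p 0 = r 0 := by
    simp only [hp, hx0.1, hx0.2]
    linear_combination r 0 * hcs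
  have h4 : q 0 = 0 := by
    simp only [hq, hx0.1, hx0.2]
    ring
  rw [h3, div_self (hr0 0).ne', div_eq_one_iff_eq (hr0 t).ne'] at h1
  rw [h4, zero_div, div_eq_zero_iff, or_iff_left (hr0 t).ne'] at h2
  have hp' : (rot (-η t) * F t).1 0 0 = p t := by
    simp only [SL2.mul_apply, hp, rot_zero_zero, rot_zero_one, Real.cos_neg, Real.sin_neg]
    ring
  have hq' : (rot (-η t) * F t).1 1 0 = q t := by
    simp only [SL2.mul_apply, hq, rot_one_zero, rot_one_one, Real.cos_neg, Real.sin_neg]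
    ring
  exact ⟨by rw [hp', h1]; exact hr0 t, by rw [hq', h2]⟩

/-! ### A path from the identity to a given map -/

/-- A smooth step from `0` on `t ≤ 1/3` to `1` on `t ≥ 2/3`. -/
def step (t : ℝ) : ℝ := Real.smoothTransition (3 * t - 1)

theorem contDiff_step : ContDiff ℝ ∞ step := Real.smoothTransition.contDiff.comp (by fun_prop)

theorem step_eq_zero {t : ℝ} (h : t ≤ 1 / 3) : step t = 0 :=
  Real.smoothTransition.zero_of_nonpos (by linarith)

theorem step_eq_one {t : ℝ} (h : 2 / 3 ≤ t) : step t = 1 :=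
  Real.smoothTransition.one_of_one_le (by linarith)

theorem step_nonneg (t : ℝ) : 0 ≤ step t := Real.smoothTransition.nonneg _

theorem step_le_one (t : ℝ) : step t ≤ 1 := Real.smoothTransition.le_one _

theorem pathDiag_pos {p : ℝ} (hp : 0 < p) (t : ℝ) : 0 < 1 - step t + step t * p := by
  have h0 := step_nonneg t
  have h1 := step_le_one t
  rcases h0.eq_or_lt with h | h
  · rw [← h]; simp
  · have := mul_pos h hp
    linarith

/-- The matrix `[[p, q], [0, p⁻¹]]`. -/
def upperTri (p q : ℝ) (hp : p ≠ 0) : SL2 := ⟨!![p, q; 0, p⁻¹], by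
  rw [Matrix.det_fin_two_of, mul_inv_cancel₀ hp]; ring⟩

/-- The path from the identity to `Y`, where `η` is the angle of the first column of `Y`. -/
def path (Y : ℝ → SL2) (η : ℝ → ℝ) (h : ∀ t, IsPosUpper (rot (-η t) * Y t)) (t : ℝ) : SL2 :=
  rot (step t * η t) * upperTri (1 - step t + step t * (rot (-η t) * Y t).1 0 0)
    (step t * (rot (-η t) * Y t).1 0 1) (pathDiag_pos (h t).1 t).ne'

theorem path_eq_one {Y : ℝ → SL2} {η : ℝ → ℝ} (h : ∀ t, IsPosUpper (rot (-η t) * Y t)) {t : ℝ}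
    (ht : t ≤ 1 / 3) : path Y η h t = 1 := by
  have h1 : upperTri (1 - step t + step t * (rot (-η t) * Y t).1 0 0)
    (step t * (rot (-η t) * Y t).1 0 1) (pathDiag_pos (h t).1 t).ne' = 1 := by
    apply SL2.ext' <;> simp [upperTri, step_eq_zero ht]
  rw [path, h1, step_eq_zero ht, zero_mul, rot_zero, one_mul]

theorem path_eq {Y : ℝ → SL2} {η : ℝ → ℝ} (h : ∀ t, IsPosUpper (rot (-η t) * Y t)) {t : ℝ}
    (ht : 2 / 3 ≤ t) : path Y η h t = Y t := by
  have h1 : upperTri (1 - step t + step t * (rot (-η t) * Y t).1 0 0)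
    (step t * (rot (-η t) * Y t).1 0 1) (pathDiag_pos (h t).1 t).ne' = rot (-η t) * Y t := by
    have hdet := (rot (-η t) * Y t).det_eq
    obtain ⟨hp, hz⟩ := h t
    rw [hz, mul_zero, sub_zero] at hdet
    apply SL2.ext'
    · simp [upperTri, step_eq_one ht]
    · simp [upperTri, step_eq_one ht]
    · exact hz.symm
    · rw [eq_comm, eq_inv_of_mul_eq_one_right hdet]
      simp [upperTri, step_eq_one ht]
  rw [path, h1, step_eq_one ht, one_mul, ← mul_assoc, ← rot_add, add_neg_cancel, rot_zero, one_mul]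

/-! ### Normalizing the first generator -/

/-- A path from the identity to `X(· - 1)⁻¹` extends to a solution of `W(t + 1) X(t) = W(t)`. -/
theorem exists_normalization {X W₀ : ℝ → SL2} (hX : Smooth X) (hW : Smooth W₀)
    (h0 : ∀ t ≤ 1 / 3, W₀ t = 1) (h1 : ∀ t, 2 / 3 ≤ t → W₀ t = (X (t - 1))⁻¹) :
    ∃ W : ℝ → SL2, Smooth W ∧ (∀ t, W (t + 1) * X t = W t) ∧
      ∀ t ∈ Set.Ioo (-1 / 3 : ℝ) 2, W t = W₀ (t - 1) * W₀ t := by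
  set x : FiberedMap := ⟨1, X, hX⟩ with hx
  have hfreq : ∀ n : ℤ, (x ^ n).freq = n := fun n => by
    induction n with
    | zero => simp
    | succ n ih => rw [zpow_add_one, FiberedMap.freq_mul, ih]; simp [hx]
    | pred n ih => rw [zpow_sub_one, FiberedMap.freq_mul, ih]; simp [hx]; ring
  have hP1 : ∀ (n : ℤ) t, (x ^ (n + 1)).fib t = (x ^ n).fib (t + 1) * X t := fun n t => by
    rw [zpow_add_one, FiberedMap.fib_mul]
  have hP2 : ∀ (n : ℤ) t, (x ^ (n + 1)).fib t = X (t + n) * (x ^ n).fib t := fun n t => by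
    rw [add_comm, zpow_one_add, FiberedMap.fib_mul, hfreq]
  -- The functional equation determines `W` from its values `W₀` on `[0, 1)`, through the iterates
  -- of `(1, X)`.
  set W : ℝ → SL2 := fun t => W₀ (Int.fract t) * ((x ^ ⌊t⌋).fib (Int.fract t))⁻¹ with hWdef
  -- The formula on `[n, n + 1)` persists on the third of a unit to the left of `n`: there `W₀ = X(·
  -- - 1)⁻¹` at the end of one period matches `W₀ = 1` at the start of the next. This overlap gives
  -- smoothness at the integers.
  have hloc : ∀ (n : ℤ), ∀ t ∈ Set.Ioo (n - 1 / 3 : ℝ) (n + 1),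
      W t = W₀ (t - n) * ((x ^ n).fib (t - n))⁻¹ := by
    intro n t ht
    rcases le_or_gt (n : ℝ) t with h | h
    · have hfl : ⌊t⌋ = n := Int.floor_eq_iff.2 ⟨h, ht.2⟩
      simp only [hWdef, Int.fract, hfl]
    · have hfl : ⌊t⌋ = n - 1 := Int.floor_eq_iff.2 ⟨by push_cast; linarith [ht.1], by
        push_cast; linarith⟩
      have hfr : Int.fract t = t - n + 1 := by rw [Int.fract, hfl]; push_cast; ring
      simp only [hWdef, hfr, hfl]
      rw [h1 _ (by linarith [ht.1]), h0 (t - n) (by linarith)]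
      have := hP1 (n - 1) (t - n)
      rw [sub_add_cancel] at this
      rw [this, add_sub_cancel_right]
      group
  refine ⟨W, fun i j => contDiff_iff_contDiffAt.2 fun t => ?_, fun t => ?_, fun t ht => ?_⟩
  · have hmem : t ∈ Set.Ioo (⌊t⌋ - 1 / 3 : ℝ) (⌊t⌋ + 1) :=
      ⟨by linarith [Int.floor_le t], Int.lt_floor_add_one t⟩
    have hsm : Smooth fun s => W₀ (s - ⌊t⌋) * ((x ^ ⌊t⌋).fib (s - ⌊t⌋))⁻¹ :=
      (hW.comp (f := fun s => s - ⌊t⌋) (by fun_prop)).mul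
        (((x ^ ⌊t⌋).smooth.comp (f := fun s => s - ⌊t⌋) (by fun_prop)).inv)
    refine (hsm i j).contDiffAt.congr_of_eventuallyEq ?_
    filter_upwards [isOpen_Ioo.mem_nhds hmem] with s hs
    rw [hloc ⌊t⌋ s hs]
  · simp only [hWdef, Int.fract_add_one, Int.floor_add_one]
    rw [hP2, Int.fract_add_floor]
    group
  -- Before `1` the first factor is the identity; after `1` the second is `X(t - 1)⁻¹`. The product
  -- is thus one formula over the window `(-1/3, 2)`, free of integer parts.
  · rcases lt_or_ge t 1 with h | h
    · have := hloc 0 t ⟨by push_cast; linarith [ht.1], by push_cast; linarith⟩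
      rw [this, h0 (t - 1) (by linarith)]
      simp
    · have := hloc 1 t ⟨by push_cast; linarith, by push_cast; linarith [ht.2]⟩
      rw [this, h1 t (by linarith)]
      simp [hx]

/-! ### Bounds for the normalization -/

section

variable {ι : Type*} {S : Set ℝ}

theorem MBdd.bound {s : ℕ} {F : ι → ℝ → Mat} (h : MBdd S s F) :
    ∃ K, 0 < K ∧ ∀ i, ∀ t ∈ S, ∀ a b, |F i t a b| ≤ K := by
  choose K hK0 hK using fun a b => (h a b).bound
  refine ⟨∑ a, ∑ b, K a b, Finset.sum_pos (fun a _ => Finset.sum_pos (fun b _ => hK0 a b) ⟨0, by simp⟩)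
    ⟨0, by simp⟩, fun i t ht a b => ?_⟩
  refine (hK a b i t ht).trans ?_
  refine (Finset.single_le_sum (f := fun b => K a b) (fun b _ => (hK0 a b).le)
    (Finset.mem_univ b)).trans ?_
  exact Finset.single_le_sum (f := fun a => ∑ b, K a b)
    (fun a _ => Finset.sum_nonneg fun b _ => (hK0 a b).le) (Finset.mem_univ a)

theorem MBdd.smooth {s : ℕ} {F : ι → ℝ → SL2} (h : MBdd S s (fun i t => (F i t).1)) (i : ι) :
    Smooth (F i) := fun a b => (h a b).1 i

/-- The only danger is a small first column. Determinant one and the bound `K` on the second column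
force its squared norm to be at least `1 / (2 K ^ 2)`. -/
theorem UBdd.angularSpeed {F : ι → ℝ → SL2} (hF : ∀ s, MBdd S s (fun i t => (F i t).1)) (s : ℕ) :
    UBdd S s (fun i => angularSpeed (F i)) := by
  obtain ⟨K, hK0, hK⟩ := (hF 0).bound
  have hd : ∀ a b, UBdd S s (fun i => deriv (fun t => (F i t).1 a b)) := fun a b =>
    (UBdd.succ_iff.1 (hF (s + 1) a b)).2
  have hN : UBdd S s (fun i t => (F i t).1 0 0 ^ 2 + (F i t).1 1 0 ^ 2) :=
    (((hF s 0 0).mul (hF s 0 0)).add ((hF s 1 0).mul (hF s 1 0))).congr fun i t => by ring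
  refine (((hF s 0 0).mul (hd 1 0)).sub ((hF s 1 0).mul (hd 0 0))).mul
    (hN.inv (fun i t => (SL2.col_sq_pos _).ne') (c := 1 / (2 * K ^ 2)) (by positivity)
      fun i t ht => ?_)
  have hdet := (F i t).det_eq
  rw [abs_of_pos (SL2.col_sq_pos _), div_le_iff₀ (by positivity)]
  have h11 := hK i t ht 1 1
  have h01 := hK i t ht 0 1
  generalize (F i t).1 0 0 = x at *
  generalize (F i t).1 1 0 = y at *
  generalize (F i t).1 0 1 = z at *
  generalize (F i t).1 1 1 = w at *
  have hz : z ^ 2 ≤ K ^ 2 := sq_le_sq' (abs_le.1 h01).1 (abs_le.1 h01).2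
  have hw : w ^ 2 ≤ K ^ 2 := sq_le_sq' (abs_le.1 h11).1 (abs_le.1 h11).2
  have h1 : 1 ≤ (x ^ 2 + y ^ 2) * (w ^ 2 + z ^ 2) := by
    have : (x ^ 2 + y ^ 2) * (w ^ 2 + z ^ 2) = (x * w - z * y) ^ 2 + (x * z + y * w) ^ 2 := by ring
    rw [this, hdet]
    nlinarith [sq_nonneg (x * z + y * w)]
  nlinarith [sq_nonneg x, sq_nonneg y]

theorem MBdd.rot {s : ℕ} {u : ι → ℝ → ℝ} (hu : ∀ i, ContDiff ℝ ∞ (u i))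
    (h : UBdd S s (fun i => deriv (u i))) : MBdd S s (fun i t => (rot (u i t)).1) := by
  obtain ⟨hc, hs⟩ := UBdd.cos_sin hu h
  intro a b
  fin_cases a <;> fin_cases b
  exacts [hc, hs.neg, hs, hc]

theorem isPosUpper_lower_bound {x : SL2} (hx : IsPosUpper x) {K : ℝ} (hK0 : 0 < K)
    (hK : |x.1 1 1| ≤ K) : 1 / K ≤ x.1 0 0 := by
  have hdet := x.det_eq
  rw [hx.2, mul_zero, sub_zero] at hdet
  rw [div_le_iff₀ hK0]
  exact hdet.ge.trans (mul_le_mul_of_nonneg_left ((le_abs_self _).trans hK) hx.1.le)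

theorem upperTri_mbdd {s : ℕ} {p q : ι → ℝ → ℝ} {hp : ∀ i t, p i t ≠ 0} (h1 : UBdd S s p)
    (h2 : UBdd S s (fun i t => (p i t)⁻¹)) (h3 : UBdd S s q) :
    MBdd S s (fun i t => (upperTri (p i t) (q i t) (hp i t)).1) := by
  intro a b
  fin_cases a <;> fin_cases b
  exacts [h1, h3, UBdd.const (c := fun _ => 0) (K := 0) (by simp), h2]

variable {a b : ℝ} {Y : ι → ℝ → SL2} {η : ι → ℝ → ℝ}

/-- An angle is bounded only after its `2π` ambiguity is fixed, which `|η i 0| ≤ π` does; the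
angular speed controls the rest. -/
theorem angle_ubdd (hab : (0 : ℝ) ∈ Set.Icc a b)
    (hY : ∀ s, MBdd (Set.Icc a b) s (fun i t => (Y i t).1)) (hη : ∀ i, ContDiff ℝ ∞ (η i))
    (h0 : ∀ i, |η i 0| ≤ Real.pi) (hd : ∀ i t, deriv (η i) t = QPCocycle.angularSpeed (Y i) t)
    (s : ℕ) : UBdd (Set.Icc a b) s η :=
  UBdd.of_deriv hab hη h0 ((UBdd.angularSpeed hY s).congr fun i t => (hd i t).symm)

/-- The diagonal of the path is a convex combination of `1` and an entry that is at least `1 / K`,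
because the opposite diagonal entry is its inverse and is at most `K`. -/
theorem path_diag_inv_ubdd (hη : ∀ s, UBdd S s η)
    (hY : ∀ s, MBdd S s (fun i t => (Y i t).1)) (hS : IsCompact S)
    (h : ∀ i t, IsPosUpper (rot (-η i t) * Y i t)) (s : ℕ) :
    MBdd S s (fun i t => (rot (-η i t) * Y i t).1) ∧
      UBdd S s (fun i t => 1 - step t + step t * (rot (-η i t) * Y i t).1 0 0) ∧
      UBdd S s (fun i t => (1 - step t + step t * (rot (-η i t) * Y i t).1 0 0)⁻¹) := by
  have hM : ∀ s, MBdd S s (fun i t => (rot (-η i t) * Y i t).1) := fun s =>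
    MBdd.mul' (MBdd.rot (fun i => (hη 0).neg.1 i) (UBdd.succ_iff.1 (hη (s + 1)).neg).2) (hY s)
  obtain ⟨K, hK0, hK⟩ := (hM 0).bound
  have hst : UBdd S s (fun _ : ι => step) := UBdd.of_isCompact contDiff_step hS
  have hp : UBdd S s (fun i t => 1 - step t + step t * (rot (-η i t) * Y i t).1 0 0) :=
    ((UBdd.const (c := fun _ => 1) (K := 1) (by simp)).sub hst).add (hst.mul (hM s 0 0))
  refine ⟨hM s, hp, hp.inv (fun i t => (pathDiag_pos (h i t).1 t).ne')
    (c := min 1 (1 / K)) (by positivity) fun i t ht => ?_⟩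
  rw [abs_of_pos (pathDiag_pos (h i t).1 t)]
  have h1 := isPosUpper_lower_bound (h i t) hK0 (hK i t ht 1 1)
  have h2 := min_le_left 1 (1 / K)
  have h3 := min_le_right 1 (1 / K)
  nlinarith [step_nonneg t, step_le_one t]

theorem path_mbdd (hη : ∀ s, UBdd S s η)
    (hY : ∀ s, MBdd S s (fun i t => (Y i t).1)) (hS : IsCompact S)
    (h : ∀ i t, IsPosUpper (rot (-η i t) * Y i t)) (s : ℕ) :
    MBdd S s (fun i t => (path (Y i) (η i) (h i) t).1) := by
  have hst : ∀ s, UBdd S s (fun _ : ι => step) := fun s => UBdd.of_isCompact contDiff_step hS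
  obtain ⟨h1, h2, h3⟩ := path_diag_inv_ubdd hη hY hS h s
  have h4 : ∀ s, UBdd S s (fun i t => step t * η i t) := fun s => (hst s).mul (hη s)
  exact MBdd.mul' (MBdd.rot (fun i => (h4 0).1 i) (UBdd.succ_iff.1 (h4 (s + 1))).2)
    (upperTri_mbdd h2 h3 ((hst s).mul (h1 0 1)))

end

/-! ### Uniformly small families -/

section

variable {κ : Type*} {l : Filter κ} {S S' : Set ℝ}

/-- The family tends to zero uniformly on `S`. -/
def Small (l : Filter κ) (S : Set ℝ) (f : κ → ℝ → ℝ) : Prop :=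
  ∀ ε > 0, ∀ᶠ k in l, ∀ t ∈ S, |f k t| ≤ ε

theorem Small.of_abs_le {f g : κ → ℝ → ℝ} (hf : Small l S f) {C : ℝ}
    (h : ∀ k, ∀ t ∈ S, |g k t| ≤ C * |f k t|) : Small l S g := by
  intro ε hε
  have hC : 0 < |C| + 1 := by positivity
  filter_upwards [hf (ε / (|C| + 1)) (by positivity)] with k hk t ht
  calc |g k t| ≤ C * |f k t| := h k t ht
    _ ≤ (|C| + 1) * (ε / (|C| + 1)) := by
        refine mul_le_mul ?_ (hk t ht) (abs_nonneg _) hC.le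
        linarith [le_abs_self C]
    _ = ε := mul_div_cancel₀ _ hC.ne'

theorem Small.add {f g : κ → ℝ → ℝ} (hf : Small l S f) (hg : Small l S g) :
    Small l S (fun k t => f k t + g k t) := by
  intro ε hε
  filter_upwards [hf (ε / 2) (by positivity), hg (ε / 2) (by positivity)] with k h1 h2 t ht
  have := abs_add_le (f k t) (g k t)
  linarith [h1 t ht, h2 t ht]

theorem Small.congr {f g : κ → ℝ → ℝ} (hf : Small l S f) (h : ∀ k, ∀ t ∈ S, f k t = g k t) :
    Small l S g :=
  hf.of_abs_le (C := 1) fun k t ht => by rw [one_mul, h k t ht]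

theorem Small.mul_bdd {f g : κ → ℝ → ℝ} (hf : Small l S f) {K : ℝ}
    (hg : ∀ k, ∀ t ∈ S, |g k t| ≤ K) : Small l S (fun k t => f k t * g k t) :=
  hf.of_abs_le (C := K) fun k t ht => by
    rw [abs_mul, mul_comm]
    exact mul_le_mul_of_nonneg_right (hg k t ht) (abs_nonneg _)

/-- Entrywise boundedness. -/
def EBdd (S : Set ℝ) (F : κ → ℝ → SL2) : Prop :=
  ∃ K, ∀ k, ∀ t ∈ S, ∀ a b, |(F k t).1 a b| ≤ K

theorem EBdd.rot (u : κ → ℝ → ℝ) : EBdd S (fun k t => rot (u k t)) := by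
  refine ⟨1, fun k t _ a b => ?_⟩
  fin_cases a <;> fin_cases b
  · exact Real.abs_cos_le_one _
  · exact (abs_neg _).trans_le (Real.abs_sin_le_one _)
  · exact Real.abs_sin_le_one _
  · exact Real.abs_cos_le_one _

theorem EBdd.one : EBdd S (fun (_ : κ) _ => 1) :=
  (EBdd.rot (S := S) fun (_ : κ) _ => 0).imp fun K h k t ht a b => by
    simpa only [rot_zero] using h k t ht a b

theorem EBdd.mul {F G : κ → ℝ → SL2} (hF : EBdd S F) (hG : EBdd S G) :
    EBdd S (fun k t => F k t * G k t) := by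
  obtain ⟨K, hK⟩ := hF
  obtain ⟨K', hK'⟩ := hG
  refine ⟨K * K' + K * K', fun k t ht a b => ?_⟩
  rw [SL2.mul_apply]
  refine (abs_add_le _ _).trans ?_
  have h0 : 0 ≤ K := (abs_nonneg _).trans (hK k t ht 0 0)
  rw [abs_mul, abs_mul]
  gcongr <;> first | exact hK k t ht _ _ | exact hK' k t ht _ _

theorem EBdd.inv {F : κ → ℝ → SL2} (hF : EBdd S F) : EBdd S (fun k t => (F k t)⁻¹) := by
  obtain ⟨K, hK⟩ := hF
  refine ⟨K, fun k t ht a b => ?_⟩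
  fin_cases a <;> fin_cases b
  · exact (congrArg _ (SL2.inv_zero_zero _)).trans_le (hK k t ht 1 1)
  · exact ((congrArg _ (SL2.inv_zero_one _)).trans (abs_neg _)).trans_le (hK k t ht 0 1)
  · exact ((congrArg _ (SL2.inv_one_zero _)).trans (abs_neg _)).trans_le (hK k t ht 1 0)
  · exact (congrArg _ (SL2.inv_one_one _)).trans_le (hK k t ht 0 0)

theorem MBdd.ebdd {s : ℕ} {F : κ → ℝ → SL2} (h : MBdd S s (fun k t => (F k t).1)) : EBdd S F := by
  obtain ⟨K, -, hK⟩ := h.bound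
  exact ⟨K, hK⟩

/-- Two families of matrices are uniformly close on `S`. -/
def Close (l : Filter κ) (S : Set ℝ) (F G : κ → ℝ → SL2) : Prop :=
  ∀ a b, Small l S (fun k t => (F k t).1 a b - (G k t).1 a b)

theorem Close.mono {F G : κ → ℝ → SL2} (h : Close l S F G) (hS : S' ⊆ S) : Close l S' F G :=
  fun a b ε hε => (h a b ε hε).mono fun _ hk t ht => hk t (hS ht)

theorem Close.refl (F : κ → ℝ → SL2) : Close l S F F :=
  fun a b ε hε => Eventually.of_forall fun k t _ => by simpa using hε.le

theorem Close.congr {F G F' G' : κ → ℝ → SL2} (h : Close l S F G)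
    (hF : ∀ k, ∀ t ∈ S, F k t = F' k t) (hG : ∀ k, ∀ t ∈ S, G k t = G' k t) :
    Close l S F' G' :=
  fun a b => (h a b).congr fun k t ht => by rw [hF k t ht, hG k t ht]

theorem Close.comp_add {F G : κ → ℝ → SL2} (h : Close l S F G) (c : κ → ℝ)
    (hS : ∀ k, ∀ t ∈ S', t + c k ∈ S) :
    Close l S' (fun k t => F k (t + c k)) (fun k t => G k (t + c k)) :=
  fun a b ε hε => (h a b ε hε).mono fun k hk t ht => hk _ (hS k t ht)

theorem Close.mul {F G F' G' : κ → ℝ → SL2} (h : Close l S F G) (h' : Close l S F' G')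
    (hF' : EBdd S F') (hG : EBdd S G) :
    Close l S (fun k t => F k t * F' k t) (fun k t => G k t * G' k t) := by
  obtain ⟨K, hK⟩ := hF'
  obtain ⟨K', hK'⟩ := hG
  intro a b
  refine ((((h a 0).mul_bdd (g := fun k t => (F' k t).1 0 b) fun k t ht => hK k t ht 0 b).add
    ((h a 1).mul_bdd (g := fun k t => (F' k t).1 1 b) fun k t ht => hK k t ht 1 b)).add
    (((h' 0 b).mul_bdd (g := fun k t => (G k t).1 a 0) fun k t ht => hK' k t ht a 0).add
    ((h' 1 b).mul_bdd (g := fun k t => (G k t).1 a 1) fun k t ht => hK' k t ht a 1))).congr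
    fun k t _ => ?_
  simp only [SL2.mul_apply]
  ring

theorem Close.inv {F G : κ → ℝ → SL2} (h : Close l S F G) :
    Close l S (fun k t => (F k t)⁻¹) (fun k t => (G k t)⁻¹) := by
  intro a b
  fin_cases a <;> fin_cases b
  · exact (h 1 1).congr fun k t _ => by
      rw [← SL2.inv_zero_zero, ← SL2.inv_zero_zero]; rfl
  · refine (h 0 1).of_abs_le (C := 1) fun k t _ => ?_
    change |((F k t)⁻¹).1 0 1 - ((G k t)⁻¹).1 0 1| ≤ _
    rw [SL2.inv_zero_one, SL2.inv_zero_one, one_mul, neg_sub_neg, abs_sub_comm]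
  · refine (h 1 0).of_abs_le (C := 1) fun k t _ => ?_
    change |((F k t)⁻¹).1 1 0 - ((G k t)⁻¹).1 1 0| ≤ _
    rw [SL2.inv_one_zero, SL2.inv_one_zero, one_mul, neg_sub_neg, abs_sub_comm]
  · exact (h 0 0).congr fun k t _ => by
      rw [← SL2.inv_one_one, ← SL2.inv_one_one]; rfl

theorem abs_cos_sub_cos_le (x y : ℝ) : |Real.cos x - Real.cos y| ≤ |x - y| := by
  have h := (convex_univ (𝕜 := ℝ) (E := ℝ)).norm_image_sub_le_of_norm_deriv_le (f := Real.cos)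
    (C := 1) (fun t _ => Real.differentiableAt_cos) (fun t _ => by
      rw [Real.deriv_cos, norm_neg]; exact Real.abs_sin_le_one t) (Set.mem_univ y) (Set.mem_univ x)
  simpa using h

theorem abs_sin_sub_sin_le (x y : ℝ) : |Real.sin x - Real.sin y| ≤ |x - y| := by
  have h := (convex_univ (𝕜 := ℝ) (E := ℝ)).norm_image_sub_le_of_norm_deriv_le (f := Real.sin)
    (C := 1) (fun t _ => Real.differentiableAt_sin) (fun t _ => by
      rw [Real.deriv_sin]; exact Real.abs_cos_le_one t) (Set.mem_univ y) (Set.mem_univ x)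
  simpa using h

theorem abs_rot_sub_rot_le (x y : ℝ) (a b : Fin 2) :
    |(rot x).1 a b - (rot y).1 a b| ≤ |x - y| := by
  fin_cases a <;> fin_cases b
  · exact abs_cos_sub_cos_le x y
  · change |-Real.sin x - -Real.sin y| ≤ _
    rw [neg_sub_neg, abs_sub_comm]
    exact abs_sin_sub_sin_le x y
  · exact abs_sin_sub_sin_le x y
  · exact abs_cos_sub_cos_le x y

theorem Close.rot {u v : κ → ℝ → ℝ} (h : Small l S (fun k t => u k t - v k t)) :
    Close l S (fun k t => rot (u k t)) (fun k t => rot (v k t)) :=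
  fun a b => h.of_abs_le (C := 1) fun k t _ => by
    rw [one_mul]; exact abs_rot_sub_rot_le _ _ a b

/-! ### Angles of nearby maps -/

/-- A continuous angle close to zero modulo `2π` and in `[-π, π]` at one point is close to zero. -/
theorem abs_le_of_rot_close {δ p : ℝ → ℝ} {a b ε : ℝ} (hδ : Continuous δ) (h0 : (0 : ℝ) ∈ Set.Icc a b)
    (hδ0 : |δ 0| ≤ Real.pi) (hε : ε ≤ 1 / 2) (hp : ∀ t ∈ Set.Icc a b, 0 < p t)
    (hc : ∀ t ∈ Set.Icc a b, |p t * Real.cos (δ t) - 1| ≤ ε)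
    (hs : ∀ t ∈ Set.Icc a b, |p t * Real.sin (δ t)| ≤ ε) :
    ∀ t ∈ Set.Icc a b, |δ t| ≤ Real.pi * ε := by
  have hpi := Real.pi_pos
  have hcos : ∀ t ∈ Set.Icc a b, 0 < Real.cos (δ t) := fun t ht => by
    have := (abs_le.1 (hc t ht)).1
    exact pos_of_mul_pos_right (a := p t) (by linarith) (hp t ht).le
  have h1 : |δ 0| < Real.pi / 2 := by
    by_contra h
    have := Real.cos_nonpos_of_pi_div_two_le_of_le (not_lt.1 h) (by linarith)
    rw [Real.cos_abs] at this
    linarith [hcos 0 h0]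
  have h2 : ∀ t ∈ Set.Icc a b, |δ t| < Real.pi / 2 := by
    intro t ht
    by_contra h
    -- To leave `(-π/2, π/2)` the angle would have to reach modulus `π/2`, where the cosine
    -- vanishes. Inside, Jordan's inequality bounds the angle by its sine.
    have hI := isPreconnected_Icc.intermediate_value h0 ht (f := fun t => |δ t|)
      hδ.abs.continuousOn
    obtain ⟨x, hx, hx'⟩ := hI ⟨h1.le, not_lt.1 h⟩
    have h3 := hcos x hx
    rw [← Real.cos_abs, show |δ x| = Real.pi / 2 from hx', Real.cos_pi_div_two] at h3
    exact lt_irrefl _ h3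
  intro t ht
  have h3 := Real.mul_abs_le_abs_sin (h2 t ht).le
  have h4 : 1 / 2 ≤ p t := by
    have := (abs_le.1 (hc t ht)).1
    nlinarith [Real.cos_le_one (δ t), hp t ht]
  have h5 : |Real.sin (δ t)| ≤ 2 * ε := by
    have := hs t ht
    rw [abs_mul, abs_of_pos (hp t ht)] at this
    nlinarith [abs_nonneg (Real.sin (δ t))]
  have h6 : |δ t| = Real.pi / 2 * (2 / Real.pi * |δ t|) := by field_simp
  rw [h6]
  nlinarith

theorem exists_int_abs_sub_le (x : ℝ) : ∃ j : ℤ, |x - j * (2 * Real.pi)| ≤ Real.pi := by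
  have hpi := Real.pi_pos
  refine ⟨round (x / (2 * Real.pi)), ?_⟩
  have h := abs_sub_round (x / (2 * Real.pi))
  have : x - round (x / (2 * Real.pi)) * (2 * Real.pi) =
      (x / (2 * Real.pi) - round (x / (2 * Real.pi))) * (2 * Real.pi) := by
    field_simp
  rw [this, abs_mul, abs_of_pos (by positivity : 0 < 2 * Real.pi)]
  nlinarith

/-- Closeness of matrices determines the angle only modulo `2π`. The integer `j k` is fixed at the
base point `0`, and continuity propagates the choice over the interval. The triangular factor is
then close to the identity. -/
theorem angle_close {F : κ → ℝ → SL2} {η ζ : κ → ℝ → ℝ} {a b : ℝ} (h0 : (0 : ℝ) ∈ Set.Icc a b)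
    (hF : Close l (Set.Icc a b) F (fun k t => rot (ζ k t))) (hFb : EBdd (Set.Icc a b) F)
    (hη : ∀ k, Continuous (η k)) (hζ : ∀ k, Continuous (ζ k))
    (h : ∀ k t, IsPosUpper (rot (-η k t) * F k t)) :
    ∃ j : κ → ℤ, Small l (Set.Icc a b) (fun k t => η k t - (ζ k t + j k * (2 * Real.pi))) ∧
      Close l (Set.Icc a b) (fun k t => rot (-η k t) * F k t) (fun _ _ => 1) := by
  have hpi := Real.pi_pos
  choose j hj using fun k => exists_int_abs_sub_le (η k 0 - ζ k 0)
  have hF1 : Close l (Set.Icc a b) (fun k t => rot (-ζ k t) * F k t) (fun _ _ => 1) :=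
    ((Close.refl fun k t => rot (-ζ k t)).mul hF hFb (EBdd.rot _)).congr (fun _ _ _ => rfl)
      fun k t _ => by rw [← rot_add, neg_add_cancel, rot_zero]
  have hrot : ∀ k t, rot (-ζ k t) * F k t =
      rot (η k t - (ζ k t + j k * (2 * Real.pi))) * (rot (-η k t) * F k t) := fun k t => by
    rw [← mul_assoc, ← rot_add, ← rot_add_int_mul (-ζ k t) (-j k)]
    congr 2
    push_cast
    ring
  have hsmall : Small l (Set.Icc a b) (fun k t => η k t - (ζ k t + j k * (2 * Real.pi))) := by
    intro ε hε
    have hε' : 0 < min (1 / 2) (ε / Real.pi) := by positivity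
    filter_upwards [hF1 0 0 _ hε', hF1 1 0 _ hε'] with k hk0 hk1 t ht
    have hp := fun t => (h k t).1
    have hz := fun t => (h k t).2
    have key := abs_le_of_rot_close (δ := fun t => η k t - (ζ k t + j k * (2 * Real.pi)))
      (p := fun t => (rot (-η k t) * F k t).1 0 0) (by have := hη k; have := hζ k; fun_prop) h0
      (by rw [← sub_sub]; exact hj k) (min_le_left (1 / 2) (ε / Real.pi)) (fun t _ => hp t)
      (fun t ht => by
        have := hk0 t ht
        rw [hrot, SL2.mul_apply, hz] at this
        simpa [mul_comm] using this)
      (fun t ht => by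
        have := hk1 t ht
        rw [hrot, SL2.mul_apply, hz] at this
        simpa [mul_comm] using this) t ht
    refine key.trans ?_
    calc Real.pi * min (1 / 2) (ε / Real.pi) ≤ Real.pi * (ε / Real.pi) := by
          gcongr; exact min_le_right _ _
      _ = ε := mul_div_cancel₀ _ hpi.ne'
  refine ⟨j, hsmall, ?_⟩
  have h1 : Close l (Set.Icc a b) (fun k t => rot (-(η k t - (ζ k t + j k * (2 * Real.pi)))))
      (fun _ _ => rot 0) :=
    Close.rot (hsmall.of_abs_le (C := 1) fun k t _ => by rw [sub_zero, abs_neg, one_mul])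
  refine (h1.mul hF1 ((EBdd.rot _).mul hFb) (EBdd.rot _)).congr (fun k t _ => ?_)
    fun k t _ => by rw [rot_zero, one_mul]
  rw [hrot, ← mul_assoc, ← rot_add, neg_add_cancel, rot_zero, one_mul]

/-- Angle and triangular part are interpolated linearly with a weight in `[0, 1]`, so the path
inherits the errors at its end; the lower diagonal entry costs the bound `K` on the inverse. -/
theorem path_close {Y : κ → ℝ → SL2} {η ζ : κ → ℝ → ℝ} (hη : ∀ s, UBdd S s η)
    (hY : ∀ s, MBdd S s (fun i t => (Y i t).1)) (hS : IsCompact S)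
    (h : ∀ i t, IsPosUpper (rot (-η i t) * Y i t))
    (h1 : Small l S (fun k t => η k t - ζ k t))
    (h2 : Close l S (fun k t => rot (-η k t) * Y k t) (fun _ _ => 1)) :
    Close l S (fun k t => path (Y k) (η k) (h k) t) (fun k t => rot (step t * ζ k t)) := by
  have hst : ∀ t, |step t| ≤ 1 := fun t => by
    rw [abs_of_nonneg (step_nonneg t)]; exact step_le_one t
  obtain ⟨b1, b2, b3⟩ := path_diag_inv_ubdd hη hY hS h 0
  obtain ⟨K, hK0, hK⟩ := b3.bound
  have hT := upperTri_mbdd (hp := fun k t => (pathDiag_pos (h k t).1 t).ne') b2 b3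
    ((UBdd.of_isCompact contDiff_step hS).mul (b1 0 1))
  have c1 : Close l S (fun k t => rot (step t * η k t)) (fun k t => rot (step t * ζ k t)) :=
    Close.rot (h1.of_abs_le (C := 1) fun k t _ => by
      rw [← mul_sub, abs_mul]
      exact mul_le_mul_of_nonneg_right (hst t) (abs_nonneg _))
  have c2 : Close l S (fun k t => upperTri (1 - step t + step t * (rot (-η k t) * Y k t).1 0 0)
      (step t * (rot (-η k t) * Y k t).1 0 1) (pathDiag_pos (h k t).1 t).ne') (fun _ _ => 1) := by
    intro a b
    fin_cases a <;> fin_cases b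
    · refine (h2 0 0).of_abs_le (C := 1) fun k t _ => ?_
      change |1 - step t + step t * (rot (-η k t) * Y k t).1 0 0 - 1| ≤
        1 * |(rot (-η k t) * Y k t).1 0 0 - 1|
      rw [show 1 - step t + step t * (rot (-η k t) * Y k t).1 0 0 - 1 =
        step t * ((rot (-η k t) * Y k t).1 0 0 - 1) by ring, abs_mul]
      exact mul_le_mul_of_nonneg_right (hst t) (abs_nonneg _)
    · refine (h2 0 1).of_abs_le (C := 1) fun k t _ => ?_
      change |step t * (rot (-η k t) * Y k t).1 0 1 - 0| ≤
        1 * |(rot (-η k t) * Y k t).1 0 1 - 0|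
      rw [sub_zero, sub_zero, abs_mul]
      exact mul_le_mul_of_nonneg_right (hst t) (abs_nonneg _)
    · intro ε hε
      refine Eventually.of_forall fun k t _ => ?_
      change |(0 : ℝ) - 0| ≤ ε
      simpa using hε.le
    · refine (h2 0 0).of_abs_le (C := K) fun k t ht => ?_
      change |(1 - step t + step t * (rot (-η k t) * Y k t).1 0 0)⁻¹ - 1| ≤
        K * |(rot (-η k t) * Y k t).1 0 0 - 1|
      have hpos := pathDiag_pos (h k t).1 t
      have hKt := hK k t ht
      generalize (rot (-η k t) * Y k t).1 0 0 = p at *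
      have e : (1 - step t + step t * p)⁻¹ - 1 =
          (1 - step t + step t * p)⁻¹ * (-(step t * (p - 1))) := by
        field_simp
        ring
      rw [e, abs_mul, abs_neg, abs_mul]
      have := mul_le_mul_of_nonneg_right (hst t) (abs_nonneg (p - 1))
      exact mul_le_mul hKt (by linarith) (by positivity) hK0.le
  refine (c1.mul c2 hT.ebdd (EBdd.rot _)).congr (fun _ _ _ => rfl) fun k t _ => by rw [mul_one]

end

/-! ### Normal form of a family of nearly rotational actions -/

/-- The column of a matrix fixes its angle modulo `2π`: the relative rotation has zero sine and
positive cosine. -/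
theorem IsPosUpper.exists_angle_int {x y : SL2} {u v : ℝ} (hx : IsPosUpper (rot (-u) * x))
    (hy : IsPosUpper (rot (-v) * y)) (hxy : x = y) : ∃ m : ℤ, v - u = m * (2 * Real.pi) := by
  subst hxy
  have h : rot (-v) * x = rot (u - v) * (rot (-u) * x) := by
    rw [← mul_assoc, ← rot_add]
    congr 2
    ring
  obtain ⟨p0, z0⟩ := hx
  obtain ⟨p1, z1⟩ := hy
  rw [h, SL2.mul_apply, z0, rot_zero_zero, mul_zero, add_zero] at p1
  rw [h, SL2.mul_apply, z0, rot_one_zero, mul_zero, add_zero] at z1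
  have hs : Real.sin (u - v) = 0 := (mul_eq_zero.1 z1).resolve_right p0.ne'
  have hc : 0 < Real.cos (u - v) := pos_of_mul_pos_left p1 p0.le
  have hc1 : Real.cos (u - v) = 1 := by
    rcases Real.sin_eq_zero_iff_cos_eq.1 hs with h | h
    · exact h
    · linarith
  obtain ⟨n, hn⟩ := (Real.cos_eq_one_iff _).1 hc1
  refine ⟨-n, ?_⟩
  push_cast
  linarith

theorem angularSpeed_periodic {F : ℝ → SL2} (h : Function.Periodic F 1) :
    Function.Periodic (angularSpeed F) 1 := by
  intro t
  have hd : ∀ a b, deriv (fun t => (F t).1 a b) (t + 1) = deriv (fun t => (F t).1 a b) t := by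
    intro a b
    rw [← deriv_comp_add_const]
    simp only [h _]
  simp only [angularSpeed, hd, h t]

theorem add_one_sub_eq_const {u : ℝ → ℝ} (hu : ContDiff ℝ ∞ u)
    (hd : Function.Periodic (deriv u) 1) (t : ℝ) : u (t + 1) - u t = u 1 - u 0 := by
  have hd' : ∀ t, HasDerivAt (fun t => u (t + 1) - u t) 0 t := fun t => by
    have h1 := (hu.differentiable_infty (t + 1)).hasDerivAt.comp_add_const t 1
    refine (h1.sub (hu.differentiable_infty t).hasDerivAt).congr_deriv ?_
    rw [hd t, sub_self]
  have := is_const_of_deriv_eq_zero (fun t => (hd' t).differentiableAt)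
    (fun t => (hd' t).deriv) t 0
  simpa using this

/-- Every object on a fixed window is a finite product of controlled pieces, so the derivative
bounds survive the normalization of the first generator, and periodicity spreads them to the line.
The same construction performed on the angles `w₁`, `w₂` gives a nearby rotation whose angle gains
exactly `2π r k` over a period; two integers at distance less than one coincide, so the degree of `U
k` is eventually `r k`. -/
theorem exists_normal_form {l : Filter ℕ} {X₁ X₂ : ℕ → ℝ → SL2} {a : ℕ → ℝ} {w₁ w₂ : ℕ → ℝ → ℝ}
    {r : ℕ → ℤ} (ha : ∀ k, a k ∈ Set.Ioo (0 : ℝ) 1)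
    (hX₁ : ∀ s, MBdd Set.univ s (fun k t => (X₁ k t).1))
    (hX₂ : ∀ s, MBdd Set.univ s (fun k t => (X₂ k t).1))
    (hw₁ : ∀ k, Continuous (w₁ k)) (hw₂ : ∀ k, Continuous (w₂ k))
    (c₁ : Close l (Set.Icc (-2) 2) X₁ (fun k t => rot (w₁ k t)))
    (c₂ : Close l (Set.Icc (-2) 2) X₂ (fun k t => rot (w₂ k t)))
    (hcomm : ∀ k t, X₂ k (t + 1) * X₁ k t = X₁ k (t + a k) * X₂ k t)
    (hrel : ∀ k t, w₂ k (t + 1) - w₂ k t - (w₁ k (t + a k) - w₁ k t) = 2 * Real.pi * r k) :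
    ∃ (W : ℕ → ℝ → SL2) (U : ℕ → SmoothLoop) (u : ℕ → ℝ → ℝ) (m : ℕ → ℤ),
      (∀ k, Smooth (W k)) ∧ (∀ k t, W k (t + 1) * X₁ k t = W k t) ∧
      (∀ k t, (U k).toFun t = W k (t + a k) * X₂ k t * (W k t)⁻¹) ∧
      (∀ k, ContDiff ℝ ∞ (u k)) ∧ (∀ k t, u k (t + 1) = u k t + m k * (2 * Real.pi)) ∧
      (∀ k, |u k 0| ≤ Real.pi) ∧ (∀ s, UBdd Set.univ s (fun k => deriv (u k))) ∧
      (∀ s, MBdd Set.univ s (fun k t => ((U k).toFun t).1)) ∧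
      Close l Set.univ (fun k => (U k).toFun) (fun k t => rot (u k t)) ∧
      ∀ᶠ k in l, m k = r k := by
  -- the path that normalizes the first generator
  set Y : ℕ → ℝ → SL2 := fun k t => (X₁ k (t + -1))⁻¹ with hYdef
  have hY : ∀ s, MBdd Set.univ s (fun k t => (Y k t).1) := fun s =>
    ((hX₁ s).comp_add fun _ => -1).inv
  have hYS : ∀ s, MBdd (Set.Icc (-1) 2) s (fun k t => (Y k t).1) := fun s =>
    (hY s).mono (Set.subset_univ _)
  choose η hηs hη0 hηd hηp using fun k => exists_angle ((hY 0).smooth k)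
  have hmem : (0 : ℝ) ∈ Set.Icc (-1 : ℝ) 2 := by norm_num
  have hηb := angle_ubdd hmem hYS hηs hη0 hηd
  have cY : Close l (Set.Icc (-1) 2) Y (fun k t => rot (-w₁ k (t + -1))) :=
    ((c₁.comp_add (S' := Set.Icc (-1) 2) (fun _ => -1) fun k t ht =>
      ⟨by linarith [ht.1], by linarith [ht.2]⟩).inv).congr (fun _ _ _ => rfl)
      fun k t _ => by rw [rot_neg]
  obtain ⟨j, hj, hjM⟩ := angle_close hmem cY (hYS 0).ebdd (fun k => (hηs k).continuous)
    (fun k => ((hw₁ k).comp (by fun_prop : Continuous fun t : ℝ => t + -1)).neg) hηp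
  set ζ : ℕ → ℝ → ℝ := fun k t => -w₁ k (t + -1) + j k * (2 * Real.pi) with hζ
  have hζc : ∀ k, Continuous (ζ k) := fun k => by
    have := hw₁ k
    fun_prop
  have cW₀ := path_close hηb hYS isCompact_Icc hηp hj hjM
  have bW₀ := path_mbdd hηb hYS isCompact_Icc hηp
  choose W hW hWX hWloc using fun k => exists_normalization ((hX₁ 0).smooth k)
    ((bW₀ 0).smooth k) (fun t ht => path_eq_one (hηp k) ht)
    (fun t ht => by rw [path_eq (hηp k) ht, hYdef, sub_eq_add_neg])
  set W₀ : ℕ → ℝ → SL2 := fun k t => path (Y k) (η k) (hηp k) t with hW₀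
  set V : ℕ → ℝ → SL2 := fun k t => W₀ k (t + -1) * W₀ k t with hV
  have hsub : Set.Icc (0 : ℝ) 2 ⊆ Set.Icc (-1) 2 := Set.Icc_subset_Icc_left (by norm_num)
  have hsh : ∀ k : ℕ, ∀ t ∈ Set.Icc (0 : ℝ) 2, t + -1 ∈ Set.Icc (-1 : ℝ) 2 := fun k t ht =>
    ⟨by linarith [ht.1], by linarith [ht.2]⟩
  have bV : ∀ s, MBdd (Set.Icc 0 2) s (fun k t => (V k t).1) := fun s =>
    MBdd.mul' (fun i j => (bW₀ s i j).comp_add_fixed (fun _ => -1) hsh) ((bW₀ s).mono hsub)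
  -- The angle of `V`: each path factor is close to the rotation by `step` times its final angle.
  set y : ℕ → ℝ → ℝ := fun k t => step (t + -1) * ζ k (t + -1) + step t * ζ k t with hy
  have cV : Close l (Set.Icc 0 2) V (fun k t => rot (y k t)) :=
    ((cW₀.comp_add (fun _ => -1) hsh).mul (cW₀.mono hsub) ((bW₀ 0).mono hsub).ebdd
      (EBdd.rot fun k t => step (t + -1) * ζ k (t + -1))).congr (fun _ _ _ => rfl)
      fun k t _ => by rw [← rot_add]
  -- the second generator
  have hstep : Continuous step := contDiff_step.continuous
  have hyc : ∀ k, Continuous (y k) := fun k => by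
    have := hζc k
    fun_prop
  have hWs : ∀ k, Smooth (fun t => W k (t + a k) * X₂ k t * (W k t)⁻¹) := fun k =>
    (((hW k).comp (f := fun t => t + a k) (by fun_prop)).mul ((hX₂ 0).smooth k)).mul (hW k).inv
  -- The commutation relation, rewritten once the first generator has become `(1, Id)`.
  have hWper : ∀ k, Function.Periodic (fun t => W k (t + a k) * X₂ k t * (W k t)⁻¹) 1 := by
    intro k t
    have h1 : W k (t + 1) = W k t * (X₁ k t)⁻¹ := eq_mul_inv_of_mul_eq (hWX k t)
    have h2 : W k (t + 1 + a k) = W k (t + a k) * (X₁ k (t + a k))⁻¹ := by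
      rw [show t + 1 + a k = t + a k + 1 by ring]
      exact eq_mul_inv_of_mul_eq (hWX k _)
    have h3 : X₂ k (t + 1) = X₁ k (t + a k) * X₂ k t * (X₁ k t)⁻¹ :=
      eq_mul_inv_of_mul_eq (hcomm k t)
    simp only [h1, h2, h3]
    group
  set U : ℕ → SmoothLoop := fun k => ⟨_, hWs k, hWper k⟩ with hU
  have hUper : ∀ k, Function.Periodic (U k).toFun 1 := fun k => (U k).periodic
  have hsh' : ∀ k : ℕ, ∀ t ∈ Set.Icc (0 : ℝ) 1, t + a k ∈ Set.Icc (0 : ℝ) 2 := fun k t ht =>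
    ⟨by linarith [ht.1, (ha k).1], by linarith [ht.2, (ha k).2]⟩
  have hsub' : Set.Icc (0 : ℝ) 1 ⊆ Set.Icc 0 2 := Set.Icc_subset_Icc_right (by norm_num)
  have hsub'' : Set.Icc (0 : ℝ) 1 ⊆ Set.Icc (-2) 2 :=
    Set.Icc_subset_Icc (by norm_num) (by norm_num)
  have bU1 : ∀ s, MBdd (Set.Icc 0 1) s
      (fun k t => (V k (t + a k) * X₂ k t * (V k t)⁻¹).1) := fun s =>
    MBdd.mul' (MBdd.mul' (fun i j => (bV s i j).comp_add_fixed a hsh')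
      ((hX₂ s).mono (Set.subset_univ _))) ((bV s).mono hsub').inv
  have hUV : ∀ k, ∀ t ∈ Set.Ioo (-1 / 3 : ℝ) (2 - a k),
      (U k).toFun t = V k (t + a k) * X₂ k t * (V k t)⁻¹ := by
    intro k t ht
    have h0 := (ha k).1
    simp only [hU, hV]
    rw [hWloc k t ⟨ht.1, by linarith [ht.2]⟩,
      hWloc k (t + a k) ⟨by linarith [ht.1], by linarith [ht.2]⟩, sub_eq_add_neg, sub_eq_add_neg]
  have hO : ∀ k, Set.Icc (0 : ℝ) 1 ⊆ Set.Ioo (-1 / 3 : ℝ) (2 - a k) := fun k t ht =>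
    ⟨by linarith [ht.1], by linarith [ht.2, (ha k).2]⟩
  have bU : ∀ s, MBdd Set.univ s (fun k t => ((U k).toFun t).1) := fun s i j =>
    ((bU1 s i j).congr_of_eqOn (fun k => (U k).smooth i j) (fun k => Set.Ioo (-1 / 3) (2 - a k))
      (fun k => isOpen_Ioo) hO fun k t ht => by rw [hUV k t ht]).of_periodic
      fun k t => congrArg (fun x : SL2 => x.1 i j) (hUper k t)
  set v : ℕ → ℝ → ℝ := fun k t => y k (t + a k) + w₂ k t + -y k t with hv
  have hvc : ∀ k, Continuous (v k) := fun k => by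
    have := hyc k
    have := hw₂ k
    fun_prop
  have cU : Close l (Set.Icc 0 1) (fun k => (U k).toFun) (fun k t => rot (v k t)) := by
    have e1 := cV.comp_add a hsh'
    have e2 := e1.mul (c₂.mono hsub'') ((hX₂ 0).mono (Set.subset_univ _)).ebdd (EBdd.rot _)
    have e3 := e2.mul (cV.mono hsub').inv ((bV 0).mono hsub').ebdd.inv
      ((EBdd.rot _).mul (EBdd.rot _))
    exact e3.congr (fun k t ht => (hUV k t (hO k ht)).symm)
      fun k t _ => by rw [← rot_neg, ← rot_add, ← rot_add]
  -- its angle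
  choose u hus hu0 hud hup using fun k => exists_angle (U k).smooth
  have hmem' : (0 : ℝ) ∈ Set.Icc (0 : ℝ) 1 := by norm_num
  obtain ⟨j', hj', hj'M⟩ := angle_close hmem' cU ((bU 0).mono (Set.subset_univ _)).ebdd
    (fun k => (hus k).continuous) hvc hup
  choose m hm using fun k => (hup k 0).exists_angle_int (hup k 1)
    (by simpa using ((hUper k) 0).symm)
  have hum : ∀ k t, u k (t + 1) = u k t + m k * (2 * Real.pi) := fun k t => by
    have h := add_one_sub_eq_const (hus k) (by
      rw [funext (hud k)]
      exact angularSpeed_periodic (hUper k)) t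
    rw [← hm k, ← h]
    ring
  refine ⟨W, U, u, m, hW, hWX, fun k t => rfl, hus, hum, hu0, fun s =>
    (UBdd.angularSpeed bU s).congr fun k t => (hud k t).symm, bU, ?_, ?_⟩
  · have e : Close l (Set.Icc 0 1) (fun k => (U k).toFun) (fun k t => rot (u k t)) :=
      ((Close.refl fun k t => rot (u k t)).mul hj'M
        ((EBdd.rot _).mul ((bU 0).mono (Set.subset_univ _)).ebdd) (EBdd.rot _)).congr
        (fun k t _ => by rw [← mul_assoc, ← rot_add, add_neg_cancel, rot_zero, one_mul])
        fun k t _ => by rw [mul_one]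
    intro i i' ε hε
    filter_upwards [e i i' ε hε] with k hk t _
    have hper : Function.Periodic
        (fun t => ((U k).toFun t).1 i i' - (rot (u k t)).1 i i') 1 := fun t => by
      simp only [hUper k t, hum k t, rot_add_int_mul]
    obtain ⟨t', ht', htt'⟩ := hper.exists_mem_Ico₀ one_pos t
    rw [show ((U k).toFun t).1 i i' - (rot (u k t)).1 i i' = _ from htt']
    exact hk t' ⟨ht'.1, ht'.2.le⟩
  · filter_upwards [hj' 1 one_pos] with k hk
    have h1 := hk 1 (by norm_num)
    have h0 := hk 0 (by norm_num)
    have hs1 : step (a k + 1) = 1 := step_eq_one (by linarith [(ha k).1])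
    have hs2 : step 1 = 1 := step_eq_one (by norm_num)
    have hs3 : step 0 = 0 := step_eq_zero (by norm_num)
    have hs4 : step (a k + -1) = 0 := step_eq_zero (by linarith [(ha k).2])
    have hs5 : step (-1) = 0 := step_eq_zero (by norm_num)
    -- As `0 < a k < 1`, each value of `step` involved is `0` or `1`, except `step (a k)`, whose
    -- contributions at the two ends cancel. What remains is the commutation defect at `0`.
    have hv1 : v k 1 - v k 0 = 2 * Real.pi * r k := by
      simp only [hv, hy, zero_add, add_comm (1 : ℝ) (a k), add_neg_cancel_right, hs1, hs2, hs3,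
        hs4, hs5, add_neg_cancel, hζ]
      have := hrel k 0
      simp only [zero_add] at this
      linear_combination this
    have hmk := hm k
    -- The lifted angles differ from the model by at most `1` at each end, and `2 < 2π`.
    have hlt : |((m k - r k : ℤ) : ℝ) * (2 * Real.pi)| < 2 * Real.pi := by
      have e : ((m k - r k : ℤ) : ℝ) * (2 * Real.pi) =
          (u k 1 - (v k 1 + j' k * (2 * Real.pi))) - (u k 0 - (v k 0 + j' k * (2 * Real.pi))) := by
        push_cast
        linear_combination hv1 - hmk
      rw [e]
      refine (abs_sub _ _).trans_lt ?_
      linarith [Real.pi_gt_three]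
    rw [abs_mul, abs_of_pos Real.two_pi_pos] at hlt
    have h2 : |((m k - r k : ℤ) : ℝ)| < 1 := by
      by_contra h
      nlinarith [Real.pi_pos, not_lt.1 h]
    rw [← Int.cast_abs] at h2
    have h3 : |m k - r k| < 1 := by exact_mod_cast h2
    have := Int.abs_lt_one_iff.1 h3
    omega

/-! ### Uniform density of the orbits of Diophantine rotations -/

/-- Dirichlet provides a time `k ≤ M` at which the orbit moves by at most `δ`, while the Diophantine
condition makes this move at least `c`, the same for all `α` in the class. Repeating it at most `c⁻¹
+ 1` times reaches within `δ` of any point of the circle. -/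
theorem exists_uniform_density {g σ : ℝ} (hg : 0 < g) (hσ : 0 ≤ σ) {δ : ℝ} (hδ : 0 < δ) :
    ∃ Q : ℕ, ∀ α ∈ CD g σ, ∀ x : ℝ, ∃ n l : ℤ, |n| ≤ Q ∧ |x - n * α - l| ≤ δ := by
  obtain ⟨N, hN⟩ := exists_nat_one_div_lt hδ
  set M : ℕ := N + 1 with hM
  have hM0 : (0 : ℝ) < M := by rw [hM]; positivity
  set c : ℝ := g⁻¹ / (M : ℝ) ^ σ with hc
  have hc0 : 0 < c := by positivity
  refine ⟨⌈(c⁻¹ + 1) * M⌉₊, fun α hα x => ?_⟩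
  obtain ⟨j, k, hk0, hkM, hjk⟩ := Real.exists_int_int_abs_mul_sub_le α (n := M) (by omega)
  have hkR : (0 : ℝ) < k := by exact_mod_cast hk0
  have hkM' : (k : ℝ) ≤ M := by exact_mod_cast hkM
  set s : ℝ := k * α - j with hs
  have hcs : c ≤ |s| := by
    refine le_trans ?_ (hα k hk0.ne' j)
    rw [abs_of_pos hkR]
    exact div_le_div_of_nonneg_left (by positivity) (by positivity)
      (Real.rpow_le_rpow hkR.le hkM' hσ)
  have hs0 : s ≠ 0 := fun h => by rw [h, abs_zero] at hcs; linarith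
  have hsδ : |s| ≤ δ := hjk.trans (le_trans (by
    rw [hM]
    push_cast
    exact one_div_le_one_div_of_le (by positivity) (by linarith)) hN.le)
  set y := Int.fract x
  set p : ℤ := ⌊y / s⌋ with hp
  refine ⟨p * k, ⌊x⌋ - p * j, ?_, ?_⟩
  · have h1 : |(p : ℝ)| ≤ c⁻¹ + 1 := by
      have h2 : |y / s| ≤ c⁻¹ := by
        rw [abs_div, abs_of_nonneg (Int.fract_nonneg x), inv_eq_one_div]
        exact div_le_div₀ zero_le_one (Int.fract_lt_one x).le hc0 hcs
      have h3 := Int.floor_le (y / s)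
      have h4 := Int.lt_floor_add_one (y / s)
      rw [abs_le] at h2 ⊢
      constructor <;> linarith [h2.1, h2.2]
    have h2 : |((p * k : ℤ) : ℝ)| ≤ (c⁻¹ + 1) * M := by
      rw [Int.cast_mul, abs_mul, abs_of_pos hkR]
      gcongr
    have h3 := h2.trans (Nat.le_ceil _)
    rw [← Int.cast_abs] at h3
    exact_mod_cast h3
  · have h1 : x - ((p * k : ℤ) : ℝ) * α - ((⌊x⌋ - p * j : ℤ) : ℝ) = Int.fract (y / s) * s := by
      have h2 : y = x - ⌊x⌋ := rfl
      have h3 : Int.fract (y / s) = y / s - p := rfl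
      rw [h3, sub_mul, div_mul_cancel₀ _ hs0, h2, hs]
      push_cast
      ring
    rw [h1, abs_mul, abs_of_nonneg (Int.fract_nonneg _)]
    exact (mul_le_of_le_one_left (abs_nonneg _) (Int.fract_lt_one _).le).trans hsδ

/-! ### Birkhoff averages and their transfer functions. -/

/-- The Birkhoff average. -/
def average (α : ℝ) (f : ℝ → ℝ) (N : ℕ) (t : ℝ) : ℝ :=
  (N : ℝ)⁻¹ * ∑ j ∈ Finset.range N, f (t + j * α)

/-- The transfer function of the Birkhoff average. -/
def transfer (α : ℝ) (f : ℝ → ℝ) (N : ℕ) (t : ℝ) : ℝ :=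
  (N : ℝ)⁻¹ * ∑ n ∈ Finset.range N, 1 * ∑ j ∈ Finset.range n, f (t + j * α)

theorem sum_range_shift (α : ℝ) (f : ℝ → ℝ) (n : ℕ) (t : ℝ) :
    ∑ j ∈ Finset.range n, f (t + α + j * α) =
      (∑ j ∈ Finset.range n, f (t + j * α)) + f (t + n * α) - f t := by
  induction n with
  | zero => simp
  | succ n ih =>
    rw [Finset.sum_range_succ, ih, Finset.sum_range_succ]
    rw [show t + α + n * α = t + (n + 1 : ℕ) * α by push_cast; ring]
    ring

/-- A function is cohomologous to its average over `N` points. The transfer function is an explicit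
finite sum, so for fixed `N` no small divisors appear. -/
theorem transfer_spec (α : ℝ) (f : ℝ → ℝ) {N : ℕ} (hN : N ≠ 0) (t : ℝ) :
    f t + transfer α f N (t + α) - transfer α f N t = average α f N t := by
  have h : ∑ n ∈ Finset.range N, 1 * ∑ j ∈ Finset.range n, f (t + α + j * α) =
      (∑ n ∈ Finset.range N, 1 * ∑ j ∈ Finset.range n, f (t + j * α)) +
        (∑ n ∈ Finset.range N, f (t + n * α)) - N * f t := by
    simp only [sum_range_shift, one_mul, Finset.sum_sub_distrib, Finset.sum_add_distrib]
    simp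
  have hN' : (N : ℝ) ≠ 0 := by exact_mod_cast hN
  simp only [transfer, average, h]
  generalize ∑ n ∈ Finset.range N, 1 * ∑ j ∈ Finset.range n, f (t + j * α) = X
  generalize ∑ n ∈ Finset.range N, f (t + n * α) = Y
  field_simp
  ring

theorem average_periodic (α : ℝ) {f : ℝ → ℝ} (hf : Function.Periodic f 1) (N : ℕ) :
    Function.Periodic (average α f N) 1 := fun t => by
  simp only [average]
  congr 1
  refine Finset.sum_congr rfl fun j _ => ?_
  rw [← hf (t + j * α)]
  ring_nf

theorem transfer_periodic (α : ℝ) {f : ℝ → ℝ} (hf : Function.Periodic f 1) (N : ℕ) :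
    Function.Periodic (transfer α f N) 1 := fun t => by
  simp only [transfer]
  congr 1
  refine Finset.sum_congr rfl fun n _ => ?_
  congr 1
  refine Finset.sum_congr rfl fun j _ => ?_
  rw [← hf (t + j * α)]
  ring_nf

/-- A shift by `α` changes only the two end terms of the sum, a change of at most `2 M / N`. At most
`Q` shifts bring `0` within `δ` of `t` modulo `1`, and the Lipschitz bound covers the remainder.
Everything is uniform in `α`, given `Q`. -/
theorem abs_average_sub_le {α K M δ : ℝ} {Q : ℕ} {f : ℝ → ℝ} (hf : Function.Periodic f 1)
    (hK : ∀ x y, |f x - f y| ≤ K * |x - y|) (hM : ∀ x, |f x| ≤ M) (hK0 : 0 ≤ K)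
    (hQ : ∀ x : ℝ, ∃ n l : ℤ, |n| ≤ Q ∧ |x - n * α - l| ≤ δ) {N : ℕ} (hN : N ≠ 0) (t : ℝ) :
    |average α f N t - average α f N 0| ≤ K * δ + (N : ℝ)⁻¹ * (2 * M) * Q := by
  have hN0 : (0 : ℝ) < N := by exact_mod_cast Nat.pos_of_ne_zero hN
  have hM0 : 0 ≤ M := (abs_nonneg _).trans (hM 0)
  have hlip : ∀ x y, |average α f N x - average α f N y| ≤ K * |x - y| := by
    intro x y
    have h1 : |∑ j ∈ Finset.range N, (f (x + j * α) - f (y + j * α))| ≤ N * (K * |x - y|) := by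
      refine (Finset.abs_sum_le_sum_abs _ _).trans ?_
      refine (Finset.sum_le_sum (g := fun _ => K * |x - y|) fun j _ => ?_).trans (by simp)
      simpa using hK (x + j * α) (y + j * α)
    simp only [average]
    rw [← mul_sub, ← Finset.sum_sub_distrib, abs_mul, abs_of_pos (by positivity),
      inv_mul_le_iff₀ hN0]
    exact h1
  have hstep : ∀ x, |average α f N (x + α) - average α f N x| ≤ (N : ℝ)⁻¹ * (2 * M) := by
    intro x
    simp only [average]
    rw [sum_range_shift, ← mul_sub, abs_mul, abs_of_pos (by positivity : 0 < (N : ℝ)⁻¹)]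
    gcongr
    rw [add_sub_assoc, add_sub_cancel_left]
    exact (abs_sub _ _).trans (by linarith [hM (x + N * α), hM x])
  have hmany : ∀ (n : ℕ) x, |average α f N (x + n * α) - average α f N x| ≤
      (N : ℝ)⁻¹ * (2 * M) * n := by
    intro n x
    induction n with
    | zero => simp
    | succ n ih =>
      have h1 := hstep (x + n * α)
      rw [show x + n * α + α = x + (n + 1 : ℕ) * α by push_cast; ring] at h1
      have h2 := abs_sub_le (average α f N (x + (n + 1 : ℕ) * α)) (average α f N (x + n * α))
        (average α f N x)
      push_cast at *
      linarith
  have hint : ∀ (n : ℤ) x, |average α f N (x + n * α) - average α f N x| ≤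
      (N : ℝ)⁻¹ * (2 * M) * |(n : ℝ)| := by
    intro n x
    rcases Int.natAbs_eq n with h | h
    · rw [h]
      simpa using hmany n.natAbs x
    · have := hmany n.natAbs (x + n * α)
      rw [h]
      rw [abs_sub_comm]
      have e : x + n * α + (n.natAbs : ℝ) * α = x := by
        have : (n : ℝ) = -(n.natAbs : ℝ) := by exact_mod_cast congrArg (Int.cast : ℤ → ℝ) h
        rw [this]; ring
      rw [e, h] at this
      simpa using this
  obtain ⟨n, l, hn, hl⟩ := hQ t
  have hn' : |(n : ℝ)| ≤ Q := by
    rw [← Int.cast_abs]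
    exact_mod_cast hn
  have h1 := hlip t (0 + n * α + l)
  have h2 := hint n 0
  have h3 : average α f N (0 + n * α + l) = average α f N (0 + n * α) := by
    simpa using (average_periodic α hf N).int_mul l (0 + n * α)
  rw [h3, show t - (0 + n * α + l) = t - n * α - l by ring] at h1
  have h4 := abs_sub_le (average α f N t) (average α f N (0 + n * α)) (average α f N 0)
  have h5 : K * |t - n * α - l| ≤ K * δ := by gcongr
  have h6 : (N : ℝ)⁻¹ * (2 * M) * |(n : ℝ)| ≤ (N : ℝ)⁻¹ * (2 * M) * Q := by gcongr
  linarith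

/-! ### Small derivatives -/

/-- Interpolation with the common bounds of the family makes `δ` independent of the index; this
converts `C^0` smallness into `C^{s₀}` smallness. -/
theorem UBdd.exists_small {ι : Type*} {f : ι → ℝ → ℝ} (h : ∀ s, UBdd Set.univ s f) (s₀ : ℕ)
    {ε : ℝ} (hε : 0 < ε) : ∃ δ > 0, ∀ i, (∀ t, |f i t| ≤ δ) →
      ∀ m ≤ s₀, ∀ t, |iteratedDeriv m (f i) t| ≤ ε := by
  choose K hK using fun s => (h s).2 s le_rfl
  have key : ∀ m, ∃ δ > 0, ∀ i, (∀ t, |f i t| ≤ δ) → ∀ t, |iteratedDeriv m (f i) t| ≤ ε := by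
    intro m
    obtain ⟨δ, hδ, H⟩ := exists_small_iteratedDeriv m K hε
    exact ⟨δ, hδ, fun i hi => H (f i) ((h 0).1 i) (fun m' _ t => hK m' i t trivial) hi⟩
  choose δ hδ H using key
  refine ⟨(Finset.range (s₀ + 1)).inf' ⟨0, by simp⟩ δ, ?_, fun i hi m hm => H m i fun t => ?_⟩
  · exact (Finset.lt_inf'_iff _).2 fun m _ => hδ m
  · exact (hi t).trans (Finset.inf'_le _ (Finset.mem_range.2 (by omega)))

theorem MBdd.exists_small {ι : Type*} {F : ι → ℝ → Mat} (h : ∀ s, MBdd Set.univ s F) (s₀ : ℕ)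
    {ε : ℝ} (hε : 0 < ε) : ∃ δ > 0, ∀ i, (∀ t a b, |F i t a b| ≤ δ) →
      ∀ m ≤ s₀, ∀ t a b, |iteratedDeriv m (fun t => F i t a b) t| ≤ ε := by
  choose δ hδ H using fun a b => UBdd.exists_small (fun s => h s a b) s₀ hε
  refine ⟨min (min (δ 0 0) (δ 0 1)) (min (δ 1 0) (δ 1 1)),
    lt_min (lt_min (hδ _ _) (hδ _ _)) (lt_min (hδ _ _) (hδ _ _)), fun i hi m hm t a b =>
    H a b i (fun t => (hi t a b).trans ?_) m hm t⟩
  fin_cases a <;> fin_cases b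
  exacts [(min_le_left _ _).trans (min_le_left _ _), (min_le_left _ _).trans (min_le_right _ _),
    (min_le_right _ _).trans (min_le_left _ _), (min_le_right _ _).trans (min_le_right _ _)]

theorem abs_mul_mul_entry_le {P D P' : Mat} {ε : ℝ} (hP : ∀ a b, |P a b| ≤ 1)
    (hP' : ∀ a b, |P' a b| ≤ 1) (hD : ∀ a b, |D a b| ≤ ε) (a b : Fin 2) :
    |(P * D * P') a b| ≤ 4 * ε := by
  have h1 : ∀ (P D : Mat) (ε : ℝ), (∀ a b, |P a b| ≤ 1) → (∀ a b, |D a b| ≤ ε) → ∀ a b,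
      |(P * D) a b| ≤ 2 * ε := by
    intro P D ε hP hD a b
    rw [Matrix.mul_apply, Fin.sum_univ_two]
    refine (abs_add_le _ _).trans ?_
    rw [abs_mul, abs_mul]
    have e0 := mul_le_mul (hP a 0) (hD 0 b) (abs_nonneg _) zero_le_one
    have e1 := mul_le_mul (hP a 1) (hD 1 b) (abs_nonneg _) zero_le_one
    linarith
  have h2 := h1 P D ε hP hD
  rw [Matrix.mul_apply, Fin.sum_univ_two]
  refine (abs_add_le _ _).trans ?_
  rw [abs_mul, abs_mul]
  have hε : 0 ≤ 2 * ε := (abs_nonneg _).trans (h2 0 0)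
  have e0 := mul_le_mul (h2 a 0) (hP' 0 b) (abs_nonneg _) hε
  have e1 := mul_le_mul (h2 a 1) (hP' 1 b) (abs_nonneg _) hε
  linarith

theorem abs_rot_le (x : ℝ) (a b : Fin 2) : |(rot x).1 a b| ≤ 1 := by
  fin_cases a <;> fin_cases b
  · exact Real.abs_cos_le_one _
  · exact (abs_neg _).trans_le (Real.abs_sin_le_one _)
  · exact Real.abs_sin_le_one _
  · exact Real.abs_cos_le_one _

/-! ### Conjugation to the model -/

/-- Conjugation of a cocycle over the translation by `a`. -/
def SmoothLoop.conj (T U : SmoothLoop) (a : ℝ) : SmoothLoop where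
  toFun t := T.toFun (t + a) * U.toFun t * (T.toFun t)⁻¹
  smooth := ((T.smooth.comp (f := fun t => t + a) (by fun_prop)).mul U.smooth).mul T.smooth.inv
  periodic t := by
    change T.toFun (t + 1 + a) * U.toFun (t + 1) * (T.toFun (t + 1))⁻¹ = _
    rw [show t + 1 + a = t + a + 1 by ring, T.periodic, T.periodic, U.periodic]

theorem SmoothLoop.csDist_le {s : ℕ} {A A' : SmoothLoop} {ε : ℝ}
    (h : ∀ m ≤ s, ∀ θ i j,
      |iteratedDeriv m (fun t => (A.toFun t).1 i j - (A'.toFun t).1 i j) θ| ≤ ε) :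
    A.csDist s A' ≤ ENNReal.ofReal ε := by
  refine iSup_le fun m => iSup_le fun hm => iSup_le fun θ => iSup_le fun i => iSup_le fun j => ?_
  rw [Real.enorm_eq_ofReal_abs]
  exact ENNReal.ofReal_le_ofReal (h m hm θ i j)

/-- The weight `1 / N` compensates the `N` terms, so the bounds do not depend on the length of the
average. This allows `N` to be chosen afterwards. -/
theorem average_ubdd {ι : Type*} {f : ι → ℝ → ℝ} (hf : ∀ s, UBdd Set.univ s f) (a : ι → ℝ)
    (N : ι → ℕ) (s : ℕ) : UBdd Set.univ s (fun i => average (a i) (f i) (N i)) := by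
  refine UBdd.weighted_sum (C := 1) (n := N) (b := fun i => (N i : ℝ)⁻¹)
    (F := fun i j t => f i (t + j * a i)) (fun i => ?_) ?_
  · rw [abs_of_nonneg (by positivity)]
    exact inv_mul_le_one
  · exact ((hf s).reindex fun p : {p : ι × ℕ // p.2 < N p.1} => p.1.1).comp_add
      fun p => p.1.2 * a p.1.1

/-- The bounds here may grow with `N`, which is fixed beforehand. The factor `1` in `transfer` gives
the inner sum the weighted form treated by `UBdd.weighted_sum`. -/
theorem transfer_ubdd {ι : Type*} {f : ι → ℝ → ℝ} (hf : ∀ s, UBdd Set.univ s f) (a : ι → ℝ)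
    (N : ℕ) (s : ℕ) : UBdd Set.univ s (fun i => transfer (a i) (f i) N) := by
  refine UBdd.weighted_sum (C := 1) (n := fun _ => N) (b := fun _ => (N : ℝ)⁻¹)
    (F := fun i n t => 1 * ∑ j ∈ Finset.range n, f i (t + j * a i)) (fun i => ?_) ?_
  · rw [abs_of_nonneg (by positivity)]
    exact inv_mul_le_one
  · refine UBdd.weighted_sum (C := N) (n := fun p : {p : ι × ℕ // p.2 < N} => p.1.2)
      (b := fun _ => 1) (F := fun p j t => f p.1.1 (t + j * a p.1.1)) (fun p => ?_) ?_
    · rw [abs_one, one_mul]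
      exact_mod_cast p.2.le
    · exact ((hf s).reindex fun q : {q : {p : ι × ℕ // p.2 < N} × ℕ // q.2 < q.1.1.2} =>
        q.1.1.1.1).comp_add fun q => q.1.2 * a q.1.1.1.1

/-- Only derivatives of the angle matter, so the constants `e i` are arbitrary; a bound on the
slopes suffices. -/
theorem rot_linear_add_mbdd {ι : Type*} {f : ι → ℝ → ℝ} (hf : ∀ s, UBdd Set.univ s f)
    {c e : ι → ℝ} {K : ℝ} (hc : ∀ i, |c i| ≤ K) (s : ℕ) :
    MBdd Set.univ s (fun i t => (rot (c i * t + f i t + e i)).1) := by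
  have hsm : ∀ i, ContDiff ℝ ∞ (fun t => c i * t + f i t + e i) := fun i => by
    have := (hf 0).1 i
    fun_prop
  refine MBdd.rot hsm (((UBdd.const hc).add (UBdd.succ_iff.1 (hf (s + 1))).2).congr fun i t => ?_)
  have h1 : HasDerivAt (fun t => c i * t) (c i) t := by
    simpa using (hasDerivAt_id t).const_mul (c i)
  exact ((h1.add (((hf 0).1 i).differentiable_infty t).hasDerivAt).add_const (e i)).deriv.symm

theorem MBdd.conj_add {ι : Type*} {X : ι → ℝ → SL2} {Y : ι → ℝ → Mat}
    (hX : ∀ s, MBdd Set.univ s (fun i t => (X i t).1)) (b : ι → ℝ)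
    (hY : ∀ s, MBdd Set.univ s Y) (s : ℕ) :
    MBdd Set.univ s (fun i t => (X i (t + b i)).1 * Y i t * ((X i t)⁻¹).1) :=
  (((hX s).comp_add b).mul (hY s)).mul (hX s).inv

/-- The conjugacy is `E n` times the rotation by the transfer function. It leaves a model error, the
rotation by the averaged angle against `E (m k)`, and the conjugate of `U k - rot (u k)`. The order
of the choices is the point: `δ` serves all `N` and all constants, then come `Q₁`, `Q₂` and `N`, and
only then `δ'`, which may depend on them and is met for large `k`. -/
theorem exists_conj_close {g σ : ℝ} (hg : 0 < g) (hσ : 0 ≤ σ) {l : Filter ℕ}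
    {U : ℕ → SmoothLoop} {u : ℕ → ℝ → ℝ} {m : ℕ → ℤ} {a : ℕ → ℝ}
    (ha : ∀ᶠ k in l, a k ∈ CD g σ)
    (hus : ∀ k, ContDiff ℝ ∞ (u k)) (hum : ∀ k t, u k (t + 1) = u k t + m k * (2 * Real.pi))
    (hu0 : ∀ k, |u k 0| ≤ Real.pi) (hud : ∀ s, UBdd Set.univ s (fun k => deriv (u k)))
    (hU : ∀ s, MBdd Set.univ s (fun k t => ((U k).toFun t).1))
    (hclose : Close l Set.univ (fun k => (U k).toFun) (fun k t => rot (u k t)))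
    (s₀ : ℕ) {ε : ℝ} (hε : 0 < ε) :
    ∀ᶠ k in l, ∃ T : SmoothLoop,
      ((T.conj (U k) (a k)).csDist s₀ (E (m k))) ≤ ENNReal.ofReal ε := by
  have hpi := Real.pi_pos
  -- the periodic part of the angle
  set φ : ℕ → ℝ → ℝ := fun k t => u k t - 2 * Real.pi * m k * t with hφ
  have hφp : ∀ k, Function.Periodic (φ k) 1 := fun k t => by
    simp only [hφ, hum]
    ring
  have hφs : ∀ k, ContDiff ℝ ∞ (φ k) := fun k => by
    have := hus k
    fun_prop
  have hmb : ∃ K, ∀ k, |2 * Real.pi * m k| ≤ K := by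
    obtain ⟨K, hK0, hK⟩ := (hud 0).bound
    refine ⟨K, fun k => ?_⟩
    have h1 := (convex_univ (𝕜 := ℝ) (E := ℝ)).norm_image_sub_le_of_norm_deriv_le (f := u k)
      (fun x _ => (hus k).differentiable_infty x) (fun x _ => hK k x trivial)
      (Set.mem_univ 0) (Set.mem_univ 1)
    have h2 := hum k 0
    rw [zero_add] at h2
    rw [h2] at h1
    simpa [mul_comm, mul_assoc, mul_left_comm] using h1
  obtain ⟨Km, hKm⟩ := hmb
  have hφd : ∀ s, UBdd Set.univ s (fun k => deriv (φ k)) := fun s => by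
    refine ((hud s).sub (UBdd.const hKm)).congr fun k t => ?_
    have h1 : HasDerivAt (fun t => 2 * Real.pi * m k * t) (2 * Real.pi * m k) t := by
      simpa using (hasDerivAt_id t).const_mul (2 * Real.pi * m k)
    exact ((((hus k).differentiable_infty t).hasDerivAt).sub h1).deriv.symm
  have hφb : ∀ s, UBdd Set.univ s φ := fun s =>
    (UBdd.of_deriv (x₀ := 0) (K₀ := Real.pi) (by norm_num) hφs (fun k => by simpa [hφ] using hu0 k)
      ((hφd s).mono (Set.subset_univ _))).of_periodic hφp
  obtain ⟨M, hM0, hM⟩ := (hφb 0).bound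
  obtain ⟨K, hK0, hK⟩ := (hφd 0).bound
  have hlip : ∀ k x y, |φ k x - φ k y| ≤ K * |x - y| := fun k x y => by
    simpa using (convex_univ (𝕜 := ℝ) (E := ℝ)).norm_image_sub_le_of_norm_deriv_le (f := φ k)
      (fun x _ => (hφs k).differentiable_infty x) (fun x _ => hK k x trivial)
      (Set.mem_univ y) (Set.mem_univ x)
  -- the model part of the error
  have hmodel : ∀ s, MBdd Set.univ s (fun (p : ℕ × ℕ × ℝ) t =>
      (rot (2 * Real.pi * m p.1 * t + average (a p.1) (φ p.1) p.2.1 t + p.2.2)).1 -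
        ((E (m p.1)).toFun t).1) := fun s => by
    refine (rot_linear_add_mbdd (c := fun p : ℕ × ℕ × ℝ => 2 * Real.pi * m p.1)
      (e := fun p => p.2.2)
      (fun s => average_ubdd (fun s => (hφb s).reindex fun p : ℕ × ℕ × ℝ => p.1)
        (fun p => a p.1) (fun p => p.2.1) s) (fun p => hKm p.1) s).sub
      ((rot_linear_add_mbdd (c := fun p : ℕ × ℕ × ℝ => 2 * Real.pi * m p.1)
        (f := fun _ _ => 0) (e := fun _ => 0)
        (fun s => UBdd.const (c := fun _ => 0) (K := 0) (by simp)) (fun p => hKm p.1) s).congr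
        fun p t => by rw [E_eq_rot, add_zero, add_zero])
  obtain ⟨δ, hδ, Hδ⟩ := MBdd.exists_small hmodel s₀ (half_pos hε)
  -- The budget `δ` is shared out as `δ / 4` for the Lipschitz error, `δ / 4` for the almost
  -- invariance of the average and `δ / 2` for the leftover constant.
  obtain ⟨Q₁, hQ₁⟩ := exists_uniform_density hg hσ (δ := δ / (4 * K)) (by positivity)
  obtain ⟨Q₂, hQ₂⟩ := exists_uniform_density hg hσ (δ := δ / (4 * Real.pi)) (by positivity)
  obtain ⟨N, hN⟩ := exists_nat_gt (8 * M * Q₁ / δ)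
  have hN0 : (0 : ℝ) < N := lt_of_le_of_lt (by positivity) hN
  have hN0' : N ≠ 0 := by
    rintro rfl
    simp at hN0
  -- the remaining part of the error
  set τ : ℕ × {n : ℤ // |n| ≤ (Q₂ : ℤ)} → ℝ → ℝ := fun p t =>
    2 * Real.pi * p.2.1 * t + transfer (a p.1) (φ p.1) N t + 0 with hτ
  have hT : ∀ s, MBdd Set.univ s (fun p t => (rot (τ p t)).1) := fun s =>
    rot_linear_add_mbdd (c := fun p : ℕ × {n : ℤ // |n| ≤ (Q₂ : ℤ)} => 2 * Real.pi * p.2.1)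
      (e := fun _ => 0)
      (fun s => transfer_ubdd
        (fun s => (hφb s).reindex fun p : ℕ × {n : ℤ // |n| ≤ (Q₂ : ℤ)} => p.1)
        (fun p => a p.1) N s)
      (K := 2 * Real.pi * Q₂) (fun p => by
        rw [abs_mul, abs_of_pos (by positivity : 0 < 2 * Real.pi), ← Int.cast_abs]
        have : ((|p.2.1| : ℤ) : ℝ) ≤ Q₂ := by exact_mod_cast p.2.2
        gcongr) s
  have hD : ∀ s, MBdd Set.univ s (fun (p : ℕ × {n : ℤ // |n| ≤ (Q₂ : ℤ)}) t =>
      ((U p.1).toFun t).1 - (rot (u p.1 t)).1) := fun s =>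
    ((hU s).sub (MBdd.rot hus (hud s))).reindex Prod.fst
  have hrest : ∀ s, MBdd Set.univ s (fun (p : ℕ × {n : ℤ // |n| ≤ (Q₂ : ℤ)}) t =>
      (rot (τ p (t + a p.1))).1 * (((U p.1).toFun t).1 - (rot (u p.1 t)).1) *
        ((rot (τ p t))⁻¹).1) := fun s =>
    MBdd.conj_add hT (fun p => a p.1) hD s
  obtain ⟨δ', hδ', Hδ'⟩ := MBdd.exists_small hrest s₀ (half_pos hε)
  have hev : ∀ᶠ k in l, ∀ i j, ∀ t ∈ Set.univ,
      |((U k).toFun t).1 i j - (rot (u k t)).1 i j| ≤ δ' / 4 :=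
    eventually_all.2 fun i => eventually_all.2 fun j => hclose i j _ (by positivity)
  filter_upwards [ha, hev] with k hk hkδ
  -- Conjugation by `E n` adds `2π n (a k)` to the angle, so `n` is chosen to cancel the constant
  -- part of the average modulo `2π`; the `q` full turns are invisible to `rot`.
  obtain ⟨n, q, hn, hq⟩ := hQ₂ (a k) hk (-average (a k) (φ k) N 0 / (2 * Real.pi))
  set p : ℕ × {n : ℤ // |n| ≤ (Q₂ : ℤ)} := (k, ⟨n, hn⟩) with hp
  have hτs : Smooth fun t => rot (τ p t) := (hT 0).smooth p
  have hτp : Function.Periodic (fun t => rot (τ p t)) 1 := fun t => by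
    simp only [hτ, transfer_periodic (a p.1) (hφp p.1) N t]
    rw [← rot_add_int_mul (2 * Real.pi * p.2.1 * t + transfer (a p.1) (φ p.1) N t + 0) n]
    congr 1
    simp only [hp]
    ring
  refine ⟨⟨fun t => rot (τ p t), hτs, hτp⟩, SmoothLoop.csDist_le fun s hs θ i j => ?_⟩
  set c : ℝ := 2 * Real.pi * (n * a k + q) with hc
  have hangle : ∀ t, rot (τ p (t + a k)) * rot (u k t) * (rot (τ p t))⁻¹ =
      rot (2 * Real.pi * m k * t + average (a k) (φ k) N t + c) := fun t => by
    rw [← rot_neg, ← rot_add, ← rot_add, ← rot_add_int_mul _ q, ← transfer_spec _ _ hN0']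
    congr 1
    simp only [hτ, hp, hc, hφ]
    ring
  have hdecomp : ∀ t, ((SmoothLoop.conj ⟨fun t => rot (τ p t), hτs, hτp⟩ (U k) (a k)).toFun t).1 i j
      - ((E (m k)).toFun t).1 i j =
      ((rot (τ p (t + a p.1))).1 * (((U p.1).toFun t).1 - (rot (u p.1 t)).1) *
        ((rot (τ p t))⁻¹).1) i j +
      ((rot (2 * Real.pi * m k * t + average (a k) (φ k) N t + c)).1 -
        ((E (m k)).toFun t).1) i j := fun t => by
    rw [← hangle]
    simp only [SmoothLoop.conj, hp, Matrix.SpecialLinearGroup.coe_mul, mul_sub, sub_mul,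
      Matrix.sub_apply]
    ring
  simp only [hdecomp]
  have hs1 := ((hrest 0) i j).1 p
  have hs2 := ((hmodel 0) i j).1 (k, N, c)
  rw [iteratedDeriv_fun_add (hs1.contDiffAt.of_le (by exact_mod_cast le_top))
    (hs2.contDiffAt.of_le (by exact_mod_cast le_top))]
  refine (abs_add_le _ _).trans ((add_le_add (Hδ' p (fun t i j => ?_) s hs θ i j)
    (Hδ (k, N, c) (fun t i j => ?_) s hs θ i j)).trans (add_halves ε).le)
  · have := abs_mul_mul_entry_le (P := (rot (τ p (t + a p.1))).1)
      (D := ((U p.1).toFun t).1 - (rot (u p.1 t)).1) (P' := ((rot (τ p t))⁻¹).1) (ε := δ' / 4)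
      (abs_rot_le _) (by rw [← rot_neg]; exact abs_rot_le _) (fun i j => hkδ i j t trivial) i j
    linarith
  · simp only [Matrix.sub_apply, E_eq_rot]
    refine (abs_rot_sub_rot_le _ _ i j).trans ?_
    have h1 := abs_average_sub_le (hφp k) (hlip k) (fun x => hM k x trivial) hK0.le (hQ₁ (a k) hk)
      hN0' t
    have h2 : K * (δ / (4 * K)) = δ / 4 := by field_simp
    have h3 : (N : ℝ)⁻¹ * (2 * M) * Q₁ ≤ δ / 4 := by
      rw [div_lt_iff₀ hδ] at hN
      rw [mul_assoc, inv_mul_le_iff₀ hN0]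
      linarith
    have h4 : |average (a k) (φ k) N 0 + c| ≤ δ / 2 := by
      have e : average (a k) (φ k) N 0 + c =
          -(2 * Real.pi) * (-average (a k) (φ k) N 0 / (2 * Real.pi) - n * a k - q) := by
        simp only [hc]
        field_simp
        ring
      rw [e, abs_mul, abs_neg, abs_of_pos (by positivity : 0 < 2 * Real.pi)]
      calc 2 * Real.pi * |-average (a k) (φ k) N 0 / (2 * Real.pi) - n * a k - q|
          ≤ 2 * Real.pi * (δ / (4 * Real.pi)) := by gcongr
        _ = δ / 2 := by field_simp; ring
    have e : 2 * Real.pi * m k * t + average (a k) (φ k) N t + c - 2 * Real.pi * m k * t =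
        (average (a k) (φ k) N t - average (a k) (φ k) N 0) + (average (a k) (φ k) N 0 + c) := by
      ring
    rw [e]
    refine (abs_add_le _ _).trans ?_
    linarith

/-- Diagonal choice of nearly optimal elements. -/
theorem exists_tendsto_of_forall_eventually {β : Type*} [Nonempty β] {l : Filter ℕ}
    (hl : l ≤ atTop) {P : ℕ → β → Prop} {D : ℕ → β → ℝ≥0∞}
    (h : ∀ ε : ℝ, 0 < ε → ∀ᶠ k in l, ∃ U, P k U ∧ D k U ≤ ENNReal.ofReal ε) :
    ∃ U : ℕ → β, (∀ᶠ k in l, P k (U k)) ∧ Tendsto (fun k => D k (U k)) l (𝓝 0) := by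
  classical
  -- The infimum need not be attained; a slack `1 / (k + 1)` tends to zero along `l`. Indices with
  -- infinite infimum get an arbitrary choice and do not occur eventually.
  set I : ℕ → ℝ≥0∞ := fun k => ⨅ (U : β) (_ : P k U), D k U with hI
  have hIle : ∀ k U, P k U → I k ≤ D k U := fun k U hU => iInf₂_le U hU
  have hex : ∀ k, I k < ⊤ → ∃ U, P k U ∧ D k U ≤ I k + ENNReal.ofReal (1 / (k + 1)) := by
    intro k hk
    have hlt : I k < I k + ENNReal.ofReal (1 / (k + 1)) :=
      ENNReal.lt_add_right hk.ne (by rw [Ne, ENNReal.ofReal_eq_zero, not_le]; positivity)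
    obtain ⟨U, hU⟩ := iInf_lt_iff.1 hlt
    obtain ⟨hP, hD⟩ := iInf_lt_iff.1 hU
    exact ⟨U, hP, hD.le⟩
  choose! U hU using hex
  refine ⟨U, ?_, ?_⟩
  · filter_upwards [h 1 one_pos] with k ⟨V, hV, hD⟩
    exact (hU k ((hIle k V hV).trans_lt (hD.trans_lt ENNReal.ofReal_lt_top))).1
  · rw [ENNReal.tendsto_nhds_zero]
    intro ε hε
    rcases eq_or_ne ε ⊤ with rfl | hε'
    · exact Eventually.of_forall fun _ => le_top
    have hε0 : 0 < ε.toReal := ENNReal.toReal_pos hε.ne' hε'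
    have h2 : ∀ᶠ k : ℕ in l, (1 : ℝ) / (k + 1) ≤ ε.toReal / 2 := hl
      ((tendsto_one_div_add_atTop_nhds_zero_nat (𝕜 := ℝ)).eventually (ge_mem_nhds (half_pos hε0)))
    filter_upwards [h (ε.toReal / 2) (half_pos hε0), h2] with k ⟨V, hV, hD⟩ hk
    have hlt := (hIle k V hV).trans_lt (hD.trans_lt ENNReal.ofReal_lt_top)
    calc D k (U k) ≤ I k + ENNReal.ofReal (1 / (k + 1)) := (hU k hlt).2
      _ ≤ ENNReal.ofReal (ε.toReal / 2) + ENNReal.ofReal (ε.toReal / 2) :=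
          add_le_add ((hIle k V hV).trans hD) (ENNReal.ofReal_le_ofReal hk)
      _ = ε := by
          rw [← ENNReal.ofReal_add (by positivity) (by positivity), add_halves,
            ENNReal.ofReal_toReal hε']

/-! ### Blow-up at the origin -/

/-- Only continuity of `B` at `0` is used: on a bounded window the argument `β k * t` shrinks to
`0`. -/
theorem close_blowup {B : ℝ → SL2} (hB : Continuous B) {l : Filter ℕ} {β : ℕ → ℝ}
    (hβ : Tendsto β l (𝓝 0)) (hβ0 : ∀ k, 0 < β k) (R : ℝ) :
    Close l (Set.Icc (-R) R) (fun k t => B 0 * (B (β k * t))⁻¹) (fun _ _ => 1) := by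
  have hc : ∀ i j, Continuous fun x => (B 0 * (B x)⁻¹).1 i j := fun i j =>
    (continuous_subtype_val (p := fun M : Mat => M.det = 1)).matrix_elem i j |>.comp
      (continuous_const.mul hB.inv)
  intro i j ε hε
  obtain ⟨δ, hδ, H⟩ := Metric.continuousAt_iff.1 (hc i j).continuousAt ε hε
  have h1 : ∀ᶠ k in l, β k * (|R| + 1) < δ := by
    have := hβ.mul_const (|R| + 1)
    rw [zero_mul] at this
    exact this.eventually (gt_mem_nhds hδ)
  filter_upwards [h1] with k hk t ht
  have hx : dist (β k * t) 0 < δ := by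
    rw [Real.dist_eq, sub_zero, abs_mul, abs_of_pos (hβ0 k)]
    refine lt_of_le_of_lt ?_ hk
    have : |t| ≤ R := abs_le.2 ht
    have := le_abs_self R
    have := hβ0 k
    gcongr
    linarith
  have := (H hx).le
  rwa [Real.dist_eq, mul_inv_cancel] at this

theorem ebdd_blowup {B : ℝ → SL2} (hB : Continuous B) (hBp : Function.Periodic B 1) {κ : Type*}
    (S : Set ℝ) (b : κ → ℝ → ℝ) : EBdd S (fun k t => B 0 * (B (b k t))⁻¹) := by
  have hc : ∀ i j, Continuous fun x => (B 0 * (B x)⁻¹).1 i j := fun i j =>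
    (continuous_subtype_val (p := fun M : Mat => M.det = 1)).matrix_elem i j |>.comp
      (continuous_const.mul hB.inv)
  choose K hK using fun i j => (isCompact_Icc (a := (0 : ℝ)) (b := 1)).exists_bound_of_continuousOn
    (hc i j).continuousOn
  refine ⟨max (max (K 0 0) (K 0 1)) (max (K 1 0) (K 1 1)), fun k t _ i j => ?_⟩
  obtain ⟨y, hy, hxy⟩ := hBp.exists_mem_Ico₀ one_pos (b k t)
  change |(B 0 * (B (b k t))⁻¹).1 i j| ≤ _
  rw [hxy]
  refine (hK i j y ⟨hy.1, hy.2.le⟩).trans ?_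
  fin_cases i <;> fin_cases j
  exacts [(le_max_left _ _).trans (le_max_left _ _), (le_max_right _ _).trans (le_max_left _ _),
    (le_max_left _ _).trans (le_max_right _ _), (le_max_right _ _).trans (le_max_right _ _)]

instance : Nonempty SmoothLoop := ⟨E 0⟩

end QPCocycle

end

/-! ### Assembly of the main theorem. -/

theorem mainTheorem8 (g σ : ℝ) (hg : 0 < g) (hσ : 1 < σ)
    (α : ℝ) (hα : α ∈ QPCocycle.SigmaSet g σ)
    (A : QPCocycle.SmoothLoop) (hA : A.BoundedProds α)
    (d : ℤ) (hd : A.HasDegree d) :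
    (QPCocycle.goodTimes g σ α).Infinite ∧
    ∀ s₀ : ℕ, ∃ U : ℕ → QPCocycle.SmoothLoop,
      (∀ᶠ k in atTop ⊓ 𝓟 (QPCocycle.goodTimes g σ α), ∃ μ : ℝ,
        QPCocycle.FiberedAction.FConj
          (QPCocycle.FiberedAction.dilate (QPCocycle.betaPred α k)
            (QPCocycle.betaPred_ne_zero hα k)
            (QPCocycle.FiberedAction.translate μ
              (QPCocycle.FiberedAction.baseChange (QPCocycle.cfBasis α k) (A.action α))))
          ((U k).action (QPCocycle.alphaIter α k))) ∧
      Tendsto (fun k => QPCocycle.SmoothLoop.csDist s₀ (U k) (QPCocycle.E ((-1) ^ k * d)))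
        (atTop ⊓ 𝓟 (QPCocycle.goodTimes g σ α)) (𝓝 0) := by
  open QPCocycle in
  refine ⟨Set.infinite_of_forall_exists_gt fun N => ?_, fun s₀ => ?_⟩
  · obtain ⟨k, hk, hk'⟩ := hα.2 (N + 1)
    exact ⟨k, hk', by omega⟩
  set l := atTop ⊓ 𝓟 (goodTimes g σ α)
  have hl : l ≤ atTop := inf_le_left
  obtain ⟨B, φ, hB, hBp, hφ, hφp, hconj⟩ :=
    hA.exists_conj_rot (irrational_of_mem_SigmaSet hg hα) hd
  choose w₁ w₂ hw₁ hw₂ h₁ h₂ hrel using fun k => exists_renorm_angles hα hBp hφ hφp hconj k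
  set β := betaPred α
  set a := alphaIter α
  have hβ0 : ∀ k, 0 < β k := betaPred_pos hα
  have hβ1 : ∀ k, |β k| ≤ 1 := fun k => by
    rw [abs_of_pos (hβ0 k)]; exact betaPred_le_one hα k
  have ha : ∀ k, a k ∈ Set.Ioo (0 : ℝ) 1 := alphaIter_mem_Ioo hα
  set V₁ : ℕ → ℝ → SL2 := fun k t => A.fiberedProd α (cfFst α k).2 (β k * t)
  set V₂ : ℕ → ℝ → SL2 := fun k t => A.fiberedProd α (cfSnd α k).2 (β k * t)
  have hconst : ∀ (x : SL2) s, MBdd Set.univ s (fun (_ : ℕ) (_ : ℝ) => x.1) := fun x s i j =>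
    UBdd.const (c := fun _ => x.1 i j) (fun _ => le_rfl)
  -- Conjugating by the constant `B 0` instead of `B (β k * t)` preserves the derivative bounds,
  -- which the merely continuous `B` would destroy.
  have hX : ∀ {m : ℕ → ℤ}, (∀ k, |β k| * |(m k : ℝ)| ≤ 1) → ∀ s, MBdd Set.univ s
      (fun k t => (B 0 * A.fiberedProd α (m k) (β k * t) * (B 0)⁻¹).1) := fun {m} hm s =>
    MBdd.mul' (MBdd.mul' (hconst (B 0) s) (hA.mbdd s m β hβ1 hm)) (hconst (B 0)⁻¹ s)
  have cG : ∀ R, Close l (Set.Icc (-R) R) (fun k t => B 0 * (B (β k * t))⁻¹) (fun _ _ => 1) :=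
    close_blowup hB ((tendsto_betaPred hα).mono_left hl) hβ0
  have hclose : ∀ {c : ℕ → ℝ} {V : ℕ → ℝ → SL2} {w : ℕ → ℝ → ℝ},
      (∀ k, c k ∈ Set.Icc (0 : ℝ) 1) →
      (∀ k t, B (β k * (t + c k)) * V k t * (B (β k * t))⁻¹ = rot (w k t)) →
      Close l (Set.Icc (-2) 2) (fun k t => B 0 * V k t * (B 0)⁻¹) (fun k t => rot (w k t)) := by
    intro c V w hc hV
    -- With `G t = B 0 * (B (β k * t))⁻¹`, the conjugated map is `G (t + c) * rot (w t) * (G t)⁻¹`,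
    -- and `G` tends to `1`. The radius `3` accommodates `t + c` for `t ≤ 2` and `c ≤ 1`.
    have e1 := (cG 3).comp_add (S' := Set.Icc (-2) 2) c fun k t ht =>
      ⟨by linarith [ht.1, (hc k).1], by linarith [ht.2, (hc k).2]⟩
    refine ((e1.mul (Close.refl fun k t => rot (w k t)) (EBdd.rot _) EBdd.one).mul (cG 2).inv
      (ebdd_blowup hB hBp _ fun k t => β k * t).inv (EBdd.one.mul (EBdd.rot _))).congr
      (fun k t _ => ?_) fun k t _ => by rw [one_mul, inv_one, mul_one]
    rw [← hV]
    group
  obtain ⟨W, U, u, m, hW, hW1, hWU, hus, hum, hu0, hud, hU, hUc, hmr⟩ := exists_normal_form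
    (l := l) (a := a) (X₁ := fun k t => B 0 * V₁ k t * (B 0)⁻¹)
    (X₂ := fun k t => B 0 * V₂ k t * (B 0)⁻¹) ha
    (hX (cfFst_bound hα)) (hX (cfSnd_bound hα)) hw₁ hw₂
    (hclose (c := fun _ => 1) (fun _ => by norm_num) h₁)
    (hclose (c := a) (fun k => ⟨(ha k).1.le, (ha k).2.le⟩) h₂)
    (fun k t => by
      have := renorm_commute hα A k t
      calc B 0 * V₂ k (t + 1) * (B 0)⁻¹ * (B 0 * V₁ k t * (B 0)⁻¹)
          = B 0 * (V₂ k (t + 1) * V₁ k t) * (B 0)⁻¹ := by group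
        _ = B 0 * (V₁ k (t + a k) * V₂ k t) * (B 0)⁻¹ := congrArg (B 0 * · * (B 0)⁻¹) this
        _ = _ := by group) hrel
  have haCD : ∀ᶠ k in l, a k ∈ CD g σ :=
    eventually_inf_principal.2 (Eventually.of_forall fun k hk => hk.1.1)
  refine exists_tendsto_of_forall_eventually (β := SmoothLoop) hl
    (P := fun k U => ∃ μ : ℝ, FiberedAction.FConj
      (FiberedAction.dilate (betaPred α k) (betaPred_ne_zero hα k)
        (FiberedAction.translate μ (FiberedAction.baseChange (cfBasis α k) (A.action α))))
      (U.action (alphaIter α k)))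
    (D := fun k U => U.csDist s₀ (E ((-1) ^ k * d))) fun ε hε => ?_
  filter_upwards [hmr, exists_conj_close hg (by linarith) haCD hus hum hu0 hud hU hUc s₀ hε]
    with k hk ⟨T, hT⟩
  rw [hk] at hT
  -- The blow-up is centred at the origin, so the translation is `0`. The full conjugacy is `T * W k
  -- * B 0`, and the periodicity of `T` keeps the first generator equal to `(1, Id)`.
  refine ⟨T.conj (U k) (a k), ⟨0, ?_⟩, hT⟩
  have hsm : Smooth fun t => T.toFun t * W k t * B 0 :=
    (T.smooth.mul (hW k)).mul fun _ _ => contDiff_const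
  refine FiberedAction.fConj_of_generators hsm (renorm_fst hα A k).1 (renorm_snd hα A k).1
    (fun t => ?_) fun t => ?_
  · rw [(renorm_fst hα A k).2, T.periodic t, ← hW1 k t]
    simp only [V₁, β]
    group
  · rw [(renorm_snd hα A k).2]
    simp only [SmoothLoop.conj, hWU, V₂, β, a]
    group
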